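/- Let $\Bbbk$ be a commutative ring with unit and let $\mathcal K$ be a simplicial complex on $[m]=\{1,\dots,m\}$ (containing $\varnothing$ and all singletons). Let $D^2\subset\mathbb C$ be the closed unit disc with boundary circle $S^1$, and let $$\mathcal Z_{\mathcal K}=\bigcup_{I\in\mathcal K}\{(z_1,\dots,z_m)\in (D^2)^m \mid z_j\in S^1 \text{ for } j\notin I\}$$ be the moment-angle complex, with the cell decomposition induced by the decomposition of $D^2$ into the $0$-cell $1$, the $1$-cell $S=S^1\setminus\{1\}$ and the open $2$-cell $D$. Its cells are the products $\varkappa(J,I)=\prod_{i\in I}D_i\times\prod_{j\in J}S_j$ (the other coordinates are equal to $1$) with $J\cap I=\varnothing$ and $I\in\mathcal K$, of dimension $|J|+2|I|$, with the product orientation. Let $\mathcal C_*(\mathcal Z_{\mathcal K};\Bbbk)$ be the cellular chain complex and $H_*(\mathcal Z_{\mathcal K};\Bbbk)$ its homology. Let $\Bbbk\langle m\rangle=\Bbbk\langle x_1,\dots,x_m\rangle$ be the symmetric coalgebra, with $\Bbbk$-basis the monomials $\mathfrak m$ and comultiplication $\Delta\mathfrak m=\sum_{\mathfrak m'\mathfrak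 m''=\mathfrak m}\mathfrak m'\otimes\mathfrak m''$, and let $\Bbbk\langle\mathcal K\rangle\subset\Bbbk\langle m\rangle$ be the face coalgebra, spanned by the monomials not divisible by $x_J=\prod_{j\in J}x_j$ for any missing face (minimal non-face) $J$ of $\mathcal K$. The Koszul complex of $\Bbbk\langle\mathcal K\rangle$ is $\Bbbk\langle\mathcal K\rangle\otimes\Lambda\langle y_1,\dots,y_m\rangle$ with $\partial_\Bbbk=\sum_i\frac{\partial}{\partial x_i}\otimes y_i$, where $\frac{\partial}{\partial x_i}$ divides a monomial by $x_i$ (and is zero on the monomials not divisible by $x_i$) and $y_i$ acts by left exterior multiplication. It is a chain complex with respect to the total degree, $\deg x_i=2$, $\deg y_i=1$, and a cochain complex with respect to the number $n$ of factors $y_i$. For $J=\{j_1<\dots<j_n\}$ put $y_J=y_{j_1}\wedge\dots\wedge y_{j_n}$. Finally, $\operatorname{Cotor}^n_{\Bbbk\langle m\rangle}(\Bbbk\langle\mathcal K\rangle,\Bbbk)$ is the $n$-th cohomology of $X^\bullet\boxtimes_{\Bbbk\langle m\rangle}\Bbbk$, where $\Bbbk\langle\mathcal K\rangle\to X^\bullet$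 is an injective resolution by right $\Bbbk\langle m\rangle$-comodules and $\Bbbk$ has the coaction $1\mapsto 1\otimes 1$. Then: 1. The assignment $\varkappa(J,I)\mapsto x_I\otimes y_J$ defines an injective morphism of chain complexes $$\mathcal C_*(\mathcal Z_{\mathcal K};\Bbbk)\to\bigl(\Bbbk\langle\mathcal K\rangle\otimes\Lambda\langle y_1,\dots,y_m\rangle,\partial_\Bbbk\bigr)$$ (graded by the total degree), and this morphism is a quasi-isomorphism. 2. For every injective resolution as above, $H^n\bigl(\Bbbk\langle\mathcal K\rangle\otimes\Lambda\langle y_1,\dots,y_m\rangle,\partial_\Bbbk\bigr)\cong\operatorname{Cotor}^n_{\Bbbk\langle m\rangle}(\Bbbk\langle\mathcal K\rangle,\Bbbk)$ as $\Bbbk$-modules for all $n\ge 0$, and $$\bigoplus_q H_q(\mathcal Z_{\mathcal K};\Bbbk)\cong\bigoplus_n\operatorname{Cotor}^n_{\Bbbk\langle m\rangle}(\Bbbk\langle\mathcal K\rangle,\Bbbk).$$ 3. The last isomorphism respects the total degree: if Cotor is calculated by an injective resolution in the category of nonnegatively graded comodules over the graded coalgebra $\Bbbk\langle m\rangle$ ($\deg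 x_i=2$), and $\operatorname{Cotor}^{n}(\cdot,\cdot)_{e}$ denotes its part of internal degree $e$, then for every $q\ge 0$ $$H_q(\mathcal Z_{\mathcal K};\Bbbk)\cong\bigoplus_{n\ge 0}\operatorname{Cotor}^{n}_{\Bbbk\langle m\rangle}(\Bbbk\langle\mathcal K\rangle,\Bbbk)_{q+n}.$$ -/

import Mathlib

open CategoryTheory Finset
open scoped TensorProduct DirectSum

universe u

noncomputable section

namespace MomentAngle

/-! ## Simplicial complexes on `[m]` and the moment-angle complex -/

/-- The faces of `K`, with the empty simplex counted as a face (Mathlib's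
`AbstractSimplicialComplex` lists the nonempty ones, among them all the singletons). -/
def IsFace {m : ℕ} (K : AbstractSimplicialComplex (Fin m)) (I : Finset (Fin m)) : Prop :=
  I = ∅ ∨ I ∈ K.faces

theorem IsFace.mono {m : ℕ} {K : AbstractSimplicialComplex (Fin m)} {I I' : Finset (Fin m)}
    (h : IsFace K I) (h' : I' ⊆ I) : IsFace K I' := by
  rcases I'.eq_empty_or_nonempty with h0 | h0
  · exact Or.inl h0
  · rcases h with rfl | h
    · exact Or.inl (Finset.subset_empty.1 h')
    · exact Or.inr ((K.isRelLowerSet_faces h).2 h' h0)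

/-- The missing faces of `K`: non-faces all of whose proper subsets are faces. -/
def IsMissingFace {m : ℕ} (K : AbstractSimplicialComplex (Fin m)) (J : Finset (Fin m)) : Prop :=
  ¬ IsFace K J ∧ ∀ I, I ⊂ J → IsFace K I

/-- The moment-angle complex `Z_K = (D², S¹)^K`, the union over the faces `I` of `K` of the sets
of points of `(D²)^m` whose coordinates outside `I` lie on the circle; `D²` is the unit disc
in `ℂ`. -/
def momentAngle {m : ℕ} (K : AbstractSimplicialComplex (Fin m)) : Set (Fin m → ℂ) :=
  {z | ∃ I, IsFace K I ∧ (∀ i, ‖z i‖ ≤ 1) ∧ ∀ j, j ∉ I → ‖z j‖ = 1}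

/-- The cell `κ(J,I)` of `(D²)^m`: the coordinates in `I` run through the open disc `D`, those
in `J` through the punctured circle `S`, and the other ones are equal to `1`. -/
def cellSet {m : ℕ} (J I : Finset (Fin m)) : Set (Fin m → ℂ) :=
  {z | (∀ i ∈ I, ‖z i‖ < 1) ∧ (∀ j ∈ J, ‖z j‖ = 1 ∧ z j ≠ 1) ∧ ∀ l, l ∉ J → l ∉ I → z l = 1}

theorem cellSet_subset_iff {m : ℕ} (K : AbstractSimplicialComplex (Fin m)) {J I : Finset (Fin m)}
    (hd : Disjoint J I) : cellSet J I ⊆ momentAngle K ↔ IsFace K I := by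
  classical
  constructor
  · intro h
    have hz : (fun i => if i ∈ I then (0 : ℂ) else if i ∈ J then -1 else 1) ∈ cellSet J I := by
      refine ⟨fun i hi => by simp [hi], fun j hj => ?_, fun l h1 h2 => by simp [h1, h2]⟩
      have : j ∉ I := Finset.disjoint_left.1 hd hj
      simp only [this, hj, if_true, if_false, norm_neg, norm_one, true_and]
      norm_num
    obtain ⟨I', hI', _, h2⟩ := h hz
    refine hI'.mono fun i hi => ?_
    by_contra hn
    have := h2 i hn
    simp [hi] at this
  · rintro h z ⟨h1, h2, h3⟩
    refine ⟨I, h, fun i => ?_, fun j hj => ?_⟩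
    · by_cases hi : i ∈ I
      · exact (h1 i hi).le
      · by_cases hj : i ∈ J
        · exact (h2 i hj).1.le
        · simp [h3 i hj hi]
    · by_cases hJ : j ∈ J
      · exact (h2 j hJ).1
      · simp [h3 j hJ hj]

/-- The `q`-dimensional cells of `Z_K`: the pairs `(J, I)` of disjoint subsets of `[m]` with
`κ(J,I) ⊆ Z_K` and `|J| + 2|I| = q`. -/
abbrev Cell {m : ℕ} (K : AbstractSimplicialComplex (Fin m)) (q : ℕ) : Type :=
  {p : Finset (Fin m) × Finset (Fin m) //
    Disjoint p.1 p.2 ∧ cellSet p.1 p.2 ⊆ momentAngle K ∧ #p.1 + 2 * #p.2 = q}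

instance {m : ℕ} (K : AbstractSimplicialComplex (Fin m)) (q : ℕ) : Fintype (Cell K q) :=
  Fintype.ofFinite _

/-! ## The cellular chain complex of `Z_K`

The cell `κ(J,I)` is parametrised by a cube, which has the coordinate `(i, true)` for `i ∈ J` and
the two coordinates `(i, false), (i, true)` for `i ∈ I`. The coordinates are ordered
lexicographically, and the cell is oriented by this order (so that it has the product of the
canonical orientations of the discs and circles in `ℂ`). -/

/-- The coordinates of the cube that parametrises `κ(J,I)`. -/
def coords {m : ℕ} (J I : Finset (Fin m)) : Finset (Fin m × Bool) :=
  I ×ˢ {false} ∪ (I ∪ J) ×ˢ {true}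

/-- The characteristic map of the cell `κ(J,I)`, as a map on the cube: `S` is parametrised
by `t ↦ exp(2πit)` and `D` by `(r, t) ↦ 1 + r (exp(2πit) - 1)`, which maps the open square
homeomorphically and with positive Jacobian onto the open disc. (The map is written as a function
of `2m` variables, of which only those in `coords J I` matter.) -/
def charMap {m : ℕ} (J I : Finset (Fin m)) (t : Fin m × Bool → unitInterval) : Fin m → ℂ :=
  fun i =>
    if i ∈ I then
      1 + ((t (i, false) : ℝ) : ℂ) *
        (Complex.exp (2 * Real.pi * Complex.I * ((t (i, true) : ℝ) : ℂ)) - 1)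
    else if i ∈ J then Complex.exp (2 * Real.pi * Complex.I * ((t (i, true) : ℝ) : ℂ))
    else 1

/-- The face of a cube on which the coordinate `s` has the value `e`. -/
def face {m : ℕ} (Φ : (Fin m × Bool → unitInterval) → Fin m → ℂ) (s : Fin m × Bool)
    (e : unitInterval) : (Fin m × Bool → unitInterval) → Fin m → ℂ :=
  fun t => Φ (Function.update t s e)

open Classical in
/-- The incidence number of the `q`-cell `κ(c')` in the boundary of the `(q+1)`-cell `κ(c)`: the
signed count of those faces of the characteristic cube of `κ(c)` that are the characteristic cube
of `κ(c')`. The face on which the `n`-th coordinate (counted from zero) is `1`, respectively `0`,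
is counted with the sign `(-1)^n`, respectively `-(-1)^n`, that is, with its orientation as
a part of the boundary of the cube. Every other face of the cube is mapped to a cell of
dimension less than `q` or is the characteristic cube of another `q`-cell, and so does
not contribute to the degree of the attaching map over `κ(c')`. -/
def incidence {m : ℕ} (c c' : Finset (Fin m) × Finset (Fin m)) : ℤ :=
  ∑ s ∈ coords c.1 c.2, (-1) ^ #{r ∈ coords c.1 c.2 | toLex r < toLex s} *
    ((if face (charMap c.1 c.2) s 1 = charMap c'.1 c'.2 then 1 else 0) -
      (if face (charMap c.1 c.2) s 0 = charMap c'.1 c'.2 then 1 else 0))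

/-- The cellular boundary operator `C_{q+1}(Z_K; k) → C_q(Z_K; k)`. -/
def cellBoundary (k : Type u) [CommRing k] {m : ℕ} (K : AbstractSimplicialComplex (Fin m))
    (q : ℕ) : (Cell K (q + 1) →₀ k) →ₗ[k] (Cell K q →₀ k) :=
  Finsupp.linearCombination k fun c =>
    ∑ c' : Cell K q, Finsupp.single c' ((incidence c.1 c'.1 : ℤ) : k)

theorem charMap_half {m : ℕ} (J I : Finset (Fin m)) (i : Fin m) :
    charMap J I (fun _ => ⟨1 / 2, by norm_num, by norm_num⟩) i =
      if i ∈ I then 0 else if i ∈ J then -1 else 1 := by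
  have : Complex.exp (2 * Real.pi * Complex.I * (((1 / 2 : ℝ)) : ℂ)) = -1 := by
    rw [← Complex.exp_pi_mul_I]; congr 1; push_cast; ring
  simp only [charMap, this]
  split_ifs <;> push_cast <;> norm_num

theorem charMap_inj {m : ℕ} {J I J' I' : Finset (Fin m)} (hd : Disjoint J I)
    (hd' : Disjoint J' I') (h : charMap J I = charMap J' I') : J = J' ∧ I = I' := by
  have key : ∀ i, (if i ∈ I then (0 : ℂ) else if i ∈ J then -1 else 1) =
      if i ∈ I' then 0 else if i ∈ J' then -1 else 1 := fun i => by
    rw [← charMap_half, ← charMap_half, h]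
  have hne : (-1 : ℂ) ≠ 1 := by norm_num
  have hI : ∀ i, i ∈ I ↔ i ∈ I' := fun i => by
    have := key i
    constructor
    · intro h1
      by_contra h2
      rw [if_pos h1, if_neg h2] at this
      split_ifs at this <;> norm_num at this
    · intro h1
      by_contra h2
      rw [if_pos h1, if_neg h2] at this
      split_ifs at this <;> norm_num at this
  have hJ : ∀ i, i ∈ J ↔ i ∈ J' := fun i => by
    have := key i
    by_cases hi : i ∈ I
    · exact iff_of_false (Finset.disjoint_right.1 hd hi)
        (Finset.disjoint_right.1 hd' ((hI i).1 hi))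
    · rw [if_neg hi, if_neg fun h => hi ((hI i).2 h)] at this
      split_ifs at this with h1 h2 h2
      · exact iff_of_true h1 h2
      · exact absurd this hne
      · exact absurd this.symm hne
      · exact iff_of_false h1 h2
  exact ⟨Finset.ext hJ, Finset.ext hI⟩

theorem face_true {m : ℕ} (J I : Finset (Fin m)) (i : Fin m) :
    face (charMap J I) (i, true) 1 = face (charMap J I) (i, true) 0 := by
  funext t l
  by_cases hl : l = i
  · subst hl
    simp [face, charMap, Complex.exp_two_pi_mul_I]
  · simp [face, charMap, hl]

theorem face_one {m : ℕ} {J I : Finset (Fin m)} {i : Fin m}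
    (hi : i ∈ I) :
    face (charMap J I) (i, false) 1 = charMap (insert i J) (I.erase i) := by
  funext t l
  by_cases hl : l = i
  · subst hl
    simp [face, charMap, hi]
  · simp [face, charMap, hl]

theorem face_zero {m : ℕ} {J I : Finset (Fin m)} (hd : Disjoint J I) {i : Fin m}
    (hi : i ∈ I) :
    face (charMap J I) (i, false) 0 = charMap J (I.erase i) := by
  have hJ : i ∉ J := Finset.disjoint_right.1 hd hi
  funext t l
  by_cases hl : l = i
  · subst hl
    simp [face, charMap, hi, hJ]
  · simp [face, charMap, hl]

theorem card_before {m : ℕ} {J I : Finset (Fin m)} (hd : Disjoint J I) {i : Fin m} :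
    #{r ∈ coords J I | toLex r < toLex (i, false)} = 2 * #{j ∈ I | j < i} + #{j ∈ J | j < i} := by
  have : {r ∈ coords J I | toLex r < toLex (i, false)} =
      ({j ∈ I | j < i} ×ˢ {false} ∪ {j ∈ I | j < i} ×ˢ {true}) ∪ {j ∈ J | j < i} ×ˢ {true} := by
    ext ⟨j, b⟩
    cases b <;> simp [coords, Prod.Lex.toLex_lt_toLex] <;> tauto
  rw [this, Finset.card_union_of_disjoint, Finset.card_union_of_disjoint]
  · simp; ring
  · rw [Finset.disjoint_left]; rintro ⟨j, b⟩; simp; rintro _ _ rfl; simp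
  · rw [Finset.disjoint_left]; rintro ⟨j, b⟩ h h'
    have : j ∈ I → j ∉ J := fun h => Finset.disjoint_right.1 hd h
    simp at h h'
    tauto

/-- The incidence numbers: `∂κ(J,I) = ∑_{i ∈ I} (-1)^{#{j ∈ J, j < i}} κ(J ∪ {i}, I ∖ {i})`. -/
theorem incidence_eq {m : ℕ} {c c' : Finset (Fin m) × Finset (Fin m)} (hd : Disjoint c.1 c.2)
    (hd' : Disjoint c'.1 c'.2) (hc : #c.1 + 2 * #c.2 = #c'.1 + 2 * #c'.2 + 1) :
    incidence c c' = ∑ i ∈ c.2, if c' = (insert i c.1, c.2.erase i)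
      then (-1) ^ #{j ∈ c.1 | j < i} else 0 := by
  classical
  obtain ⟨J, I⟩ := c
  obtain ⟨J', I'⟩ := c'
  simp only at hd hd' hc ⊢
  unfold incidence
  rw [coords, Finset.sum_union, Finset.sum_product, Finset.sum_product]
  · simp only [Finset.sum_singleton]
    rw [← coords, add_eq_left.2]
    · refine Finset.sum_congr rfl fun i hi => ?_
      have hJ : i ∉ J := Finset.disjoint_right.1 hd hi
      have hc1 := Finset.card_erase_add_one hi
      have e1 : (face (charMap J I) (i, false) 1 = charMap J' I') ↔
          ((J', I') = (insert i J, I.erase i)) := by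
        rw [face_one hi]
        constructor
        · intro h
          obtain ⟨rfl, rfl⟩ := charMap_inj (by
            rw [Finset.disjoint_insert_left]
            exact ⟨Finset.notMem_erase _ _, hd.mono_right (Finset.erase_subset _ _)⟩) hd' h
          rfl
        · rintro h
          rw [Prod.mk.injEq] at h
          rw [h.1, h.2]
      have e2 : ¬ (face (charMap J I) (i, false) 0 = charMap J' I') := by
        rw [face_zero hd hi]
        intro h
        obtain ⟨rfl, rfl⟩ := charMap_inj (hd.mono_right (Finset.erase_subset _ _)) hd' h
        omega
      rw [if_neg e2, card_before hd, pow_add, pow_mul]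
      simp only [e1]
      split_ifs <;> simp
    · refine Finset.sum_eq_zero fun i _ => ?_
      simp only [face_true, sub_self, mul_zero]
  · rw [Finset.disjoint_left]; rintro ⟨j, b⟩; simp; rintro _ rfl; simp

/-- The part of the boundary of a cell that is a cell again. -/
def flipCell {m : ℕ} (c : Finset (Fin m) × Finset (Fin m)) (i : Fin m) :
    Finset (Fin m) × Finset (Fin m) := (insert i c.1, c.2.erase i)

def cellSign {m : ℕ} (c : Finset (Fin m) × Finset (Fin m)) (i : Fin m) : ℤ :=
  (-1) ^ #{j ∈ c.1 | j < i}

theorem cellSign_flipCell {m : ℕ} {c : Finset (Fin m) × Finset (Fin m)} (hd : Disjoint c.1 c.2)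
    {i l : Fin m} (hi : i ∈ c.2) : cellSign (flipCell c i) l = (if i < l then -1 else 1) * cellSign c l := by
  have hJ : i ∉ c.1 := Finset.disjoint_right.1 hd hi
  unfold cellSign flipCell
  simp only [Finset.filter_insert]
  split_ifs with h
  · rw [Finset.card_insert_of_notMem (by simp [hJ]), pow_succ]; ring
  · ring

def totalBoundary (k : Type u) [CommRing k] (m : ℕ) :
    (Finset (Fin m) × Finset (Fin m) →₀ k) →ₗ[k] (Finset (Fin m) × Finset (Fin m) →₀ k) :=
  Finsupp.linearCombination k fun c =>
    ∑ i ∈ c.2, Finsupp.single (flipCell c i) ((cellSign c i : ℤ) : k)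

theorem totalBoundary_sq (k : Type u) [CommRing k] {m : ℕ}
    (c : Finset (Fin m) × Finset (Fin m)) (hd : Disjoint c.1 c.2) :
    totalBoundary k m (totalBoundary k m (Finsupp.single c 1)) = 0 := by
  simp only [totalBoundary, Finsupp.linearCombination_single, one_smul, map_sum, Finset.smul_sum,
    Finsupp.smul_single, smul_eq_mul]
  rw [Finset.sum_sigma']
  refine Finset.sum_involution (fun p _ => ⟨p.2, p.1⟩) ?_ ?_ ?_ ?_
  · rintro ⟨i, l⟩ hp
    simp only [flipCell, Finset.mem_sigma, Finset.mem_erase] at hp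
    obtain ⟨hi, hli, hl⟩ := hp
    have e : flipCell (flipCell c l) i = flipCell (flipCell c i) l := by
      simp only [flipCell, Finset.insert_comm i l, Finset.erase_right_comm]
    simp only [cellSign_flipCell hd hi, cellSign_flipCell hd hl]
    rw [e, ← Finsupp.single_add, Finsupp.single_eq_zero]
    rcases lt_or_gt_of_ne hli with h | h
    · simp [h, h.not_gt]; ring
    · simp [h, h.not_gt]; ring
  · rintro ⟨i, l⟩ hp _ h
    simp only [flipCell, Finset.mem_sigma, Finset.mem_erase] at hp
    simp only [Sigma.mk.injEq] at h
    exact hp.2.1 h.1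
  · rintro ⟨i, l⟩ hp
    simp only [flipCell, Finset.mem_sigma, Finset.mem_erase] at hp ⊢
    exact ⟨hp.2.2, hp.2.1.symm, hp.1⟩
  · rintro ⟨i, l⟩ hp
    rfl

def cellIncl (k : Type u) [CommRing k] {m : ℕ} (K : AbstractSimplicialComplex (Fin m))
    (q : ℕ) : (Cell K q →₀ k) →ₗ[k] (Finset (Fin m) × Finset (Fin m) →₀ k) :=
  Finsupp.lmapDomain k k Subtype.val

theorem cellIncl_boundary (k : Type u) [CommRing k] {m : ℕ}
    (K : AbstractSimplicialComplex (Fin m)) (q : ℕ) :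
    cellIncl k K q ∘ₗ cellBoundary k K q = totalBoundary k m ∘ₗ cellIncl k K (q + 1) := by
  classical
  refine Finsupp.lhom_ext' fun c => LinearMap.ext_ring ?_
  have hcell : ∀ i ∈ c.1.2, Disjoint (flipCell c.1 i).1 (flipCell c.1 i).2 ∧
      cellSet (flipCell c.1 i).1 (flipCell c.1 i).2 ⊆ momentAngle K ∧
      #(flipCell c.1 i).1 + 2 * #(flipCell c.1 i).2 = q := fun i hi => by
    have hJ : i ∉ c.1.1 := Finset.disjoint_right.1 c.2.1 hi
    have hd : Disjoint (flipCell c.1 i).1 (flipCell c.1 i).2 := by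
      simp only [flipCell]
      rw [Finset.disjoint_insert_left]
      exact ⟨Finset.notMem_erase _ _, c.2.1.mono_right (Finset.erase_subset _ _)⟩
    refine ⟨hd, ?_, ?_⟩
    · rw [cellSet_subset_iff K hd]
      exact ((cellSet_subset_iff K c.2.1).1 c.2.2.1).mono (Finset.erase_subset _ _)
    · have h1 := Finset.card_erase_add_one hi
      have h2 := c.2.2.2
      simp only [flipCell]
      rw [Finset.card_insert_of_notMem hJ]
      omega
  simp only [LinearMap.comp_apply, Finsupp.lsingle_apply, cellBoundary, cellIncl, totalBoundary,
    Finsupp.linearCombination_single, one_smul, Finsupp.lmapDomain_apply, Finsupp.mapDomain_single,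
    map_sum]
  have : ∀ c' : Cell K q, (Finsupp.single c'.1 ((incidence c.1 c'.1 : ℤ) : k)) =
      ∑ i ∈ c.1.2, if c'.1 = flipCell c.1 i then Finsupp.single (flipCell c.1 i) ((cellSign c.1 i : ℤ) : k)
        else 0 := fun c' => by
    rw [incidence_eq c.2.1 c'.2.1 (by rw [c.2.2.2, c'.2.2.2]), Int.cast_sum,
      ← Finsupp.lsingle_apply (R := k), map_sum]
    refine Finset.sum_congr rfl fun i _ => ?_
    have : ((insert i c.1.1, c.1.2.erase i) : Finset (Fin m) × Finset (Fin m)) = flipCell c.1 i := rfl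
    rw [this]
    split_ifs with h
    · rw [h]
      simp [cellSign]
    · simp
  simp only [this]
  rw [Finset.sum_comm]
  refine Finset.sum_congr rfl fun i hi => ?_
  rw [Finset.sum_eq_single ⟨flipCell c.1 i, hcell i hi⟩]
  · simp
  · intro c' _ h
    rw [if_neg]
    exact fun h' => h (Subtype.ext h')
  · simp

theorem cellBoundary_comp (k : Type u) [CommRing k] {m : ℕ}
    (K : AbstractSimplicialComplex (Fin m)) (q : ℕ) :
    cellBoundary k K q ∘ₗ cellBoundary k K (q + 1) = 0 := by
  have hinj : Function.Injective (cellIncl k K q) :=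
    Finsupp.mapDomain_injective Subtype.val_injective
  refine Finsupp.lhom_ext' fun c => LinearMap.ext_ring ?_
  apply hinj
  simp only [LinearMap.comp_apply, LinearMap.zero_apply, map_zero]
  rw [← LinearMap.comp_apply (cellIncl k K q), cellIncl_boundary, LinearMap.comp_apply,
    ← LinearMap.comp_apply (cellIncl k K (q + 1)), cellIncl_boundary, LinearMap.comp_apply]
  simp only [cellIncl, Finsupp.lsingle_apply, Finsupp.lmapDomain_apply, Finsupp.mapDomain_single]
  exact totalBoundary_sq k c.1 c.2.1

/-- The cellular chain complex `C_*(Z_K; k)`; its homology is `H_*(Z_K; k)`. -/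
def cellularComplex (k : Type u) [CommRing k] {m : ℕ} (K : AbstractSimplicialComplex (Fin m)) :
    ChainComplex (ModuleCat.{u} k) ℕ :=
  ChainComplex.of (fun q => ModuleCat.of k (Cell K q →₀ k))
    (fun q => ModuleCat.ofHom (cellBoundary k K q)) fun q => by
      rw [← ModuleCat.ofHom_comp, cellBoundary_comp]; rfl

/-! ## The symmetric coalgebra `k⟨x_1, …, x_m⟩` and the face coalgebra -/

/-- The underlying module of the symmetric coalgebra `k⟨x_1, …, x_m⟩`, the free module on the
monomials `x^a` in `m` variables (encoded by their exponent vectors `a`). -/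
def SymCoalg (k : Type u) [CommRing k] (m : ℕ) : Type u := (Fin m →₀ ℕ) →₀ k

instance (k : Type u) [CommRing k] (m : ℕ) : AddCommGroup (SymCoalg k m) :=
  inferInstanceAs (AddCommGroup ((Fin m →₀ ℕ) →₀ k))

instance (k : Type u) [CommRing k] (m : ℕ) : Module k (SymCoalg k m) :=
  inferInstanceAs (Module k ((Fin m →₀ ℕ) →₀ k))

/-- The basis of monomials of `k⟨x_1, …, x_m⟩`. -/
def mono (k : Type u) [CommRing k] (m : ℕ) : Module.Basis (Fin m →₀ ℕ) k (SymCoalg k m) :=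
  Module.Basis.ofRepr (LinearEquiv.refl k ((Fin m →₀ ℕ) →₀ k))

/-- The comultiplication `Δ x^a = ∑_{b + c = a} x^b ⊗ x^c`. -/
def symComul (k : Type u) [CommRing k] (m : ℕ) :
    SymCoalg k m →ₗ[k] SymCoalg k m ⊗[k] SymCoalg k m :=
  (mono k m).constr k fun a => ∑ p ∈ antidiagonal a, mono k m p.1 ⊗ₜ[k] mono k m p.2

/-- The counit, which maps `1` to `1` and the other monomials to `0`. -/
def symCounit (k : Type u) [CommRing k] (m : ℕ) : SymCoalg k m →ₗ[k] k :=
  (mono k m).constr k fun a => if a = 0 then 1 else 0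

theorem symComul_mono (k : Type u) [CommRing k] (m : ℕ) (a : Fin m →₀ ℕ) :
    symComul k m (mono k m a) = ∑ p ∈ antidiagonal a, mono k m p.1 ⊗ₜ[k] mono k m p.2 :=
  (mono k m).constr_basis k _ a

theorem symCounit_mono (k : Type u) [CommRing k] (m : ℕ) (a : Fin m →₀ ℕ) :
    symCounit k m (mono k m a) = if a = 0 then 1 else 0 :=
  (mono k m).constr_basis k _ a

instance (k : Type u) [CommRing k] (m : ℕ) : Coalgebra k (SymCoalg k m) where
  comul := symComul k m
  counit := symCounit k m
  coassoc := by
    refine (mono k m).ext fun a => ?_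
    simp only [LinearMap.comp_apply, symComul_mono, map_sum, LinearMap.rTensor_tmul,
      LinearMap.lTensor_tmul, TensorProduct.sum_tmul, TensorProduct.tmul_sum,
      LinearEquiv.coe_coe, TensorProduct.assoc_tmul]
    rw [Finset.sum_sigma', Finset.sum_sigma']
    refine Finset.sum_nbij' (fun p => ⟨(p.2.1, p.2.2 + p.1.2), (p.2.2, p.1.2)⟩)
      (fun p => ⟨(p.1.1 + p.2.1, p.2.2), (p.1.1, p.2.1)⟩) ?_ ?_ ?_ ?_ ?_
    all_goals
      rintro ⟨⟨a1, a2⟩, ⟨b1, b2⟩⟩ h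
      simp only [Finset.mem_sigma, Finset.HasAntidiagonal.mem_antidiagonal] at h ⊢
    · obtain ⟨rfl, rfl⟩ := h; simp [add_assoc]
    · obtain ⟨rfl, rfl⟩ := h; simp [add_assoc]
    · obtain ⟨rfl, rfl⟩ := h; simp
    · obtain ⟨rfl, rfl⟩ := h; simp
  rTensor_counit_comp_comul := by
    refine (mono k m).ext fun a => ?_
    simp only [LinearMap.comp_apply, symComul_mono, map_sum, LinearMap.rTensor_tmul,
      symCounit_mono, TensorProduct.mk_apply]
    rw [Finset.sum_eq_single (0, a)]
    · simp
    · rintro ⟨b, c⟩ h h'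
      rw [if_neg, TensorProduct.zero_tmul]
      rintro rfl
      simp at h
      exact h' (by rw [h])
    · simp
  lTensor_counit_comp_comul := by
    refine (mono k m).ext fun a => ?_
    simp only [LinearMap.comp_apply, symComul_mono, map_sum, LinearMap.lTensor_tmul,
      symCounit_mono, TensorProduct.mk_apply, LinearMap.flip_apply]
    rw [Finset.sum_eq_single (a, 0)]
    · simp
    · rintro ⟨b, c⟩ h h'
      rw [if_neg, TensorProduct.tmul_zero]
      rintro rfl
      simp at h
      exact h' (by rw [h])
    · simp

/-- The intrinsic grading of `k⟨x_1, …, x_m⟩`, in which each `x_i` has degree `2`. -/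
def symGrading (k : Type u) [CommRing k] (m e : ℕ) : Submodule k (SymCoalg k m) :=
  Submodule.span k (mono k m '' {a | 2 * a.degree = e})

/-- The operator `∂/∂x_i` of the symmetric coalgebra: it divides a monomial by `x_i` (and
annihilates it if it is not divisible by `x_i`). -/
def contr (k : Type u) [CommRing k] {m : ℕ} (i : Fin m) : SymCoalg k m →ₗ[k] SymCoalg k m :=
  (mono k m).constr k fun a => if a i = 0 then 0 else mono k m (a - Finsupp.single i 1)

theorem contr_mono (k : Type u) [CommRing k] {m : ℕ} (i : Fin m) (a : Fin m →₀ ℕ) :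
    contr k i (mono k m a) = if a i = 0 then 0 else mono k m (a - Finsupp.single i 1) :=
  (mono k m).constr_basis k _ a

/-- The submodule `C(S)` of `k⟨x_1, …, x_m⟩` spanned by the monomials that are not divisible by
any of the monomials in `S`. -/
def avoid (k : Type u) [CommRing k] {m : ℕ} (S : Set (Fin m →₀ ℕ)) :
    Submodule k (SymCoalg k m) :=
  Submodule.span k (mono k m '' {a | ∀ b ∈ S, ¬ b ≤ a})

theorem mono_mem_avoid (k : Type u) [CommRing k] {m : ℕ} {S : Set (Fin m →₀ ℕ)}
    {a : Fin m →₀ ℕ} (h : ∀ b ∈ S, ¬ b ≤ a) : mono k m a ∈ avoid k S :=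
  Submodule.subset_span ⟨a, h, rfl⟩

theorem contr_mem_avoid (k : Type u) [CommRing k] {m : ℕ} (S : Set (Fin m →₀ ℕ)) (i : Fin m) :
    ∀ x ∈ avoid k S, contr k i x ∈ avoid k S := by
  intro x hx
  induction hx using Submodule.span_induction with
  | mem x h =>
    obtain ⟨a, ha, rfl⟩ := h
    rw [contr_mono]
    split_ifs
    · exact Submodule.zero_mem _
    · exact mono_mem_avoid k fun b hb hle => ha b hb (hle.trans tsub_le_self)
  | zero => simp
  | add x y _ _ h1 h2 => rw [map_add]; exact Submodule.add_mem _ h1 h2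
  | smul r x _ h => rw [map_smul]; exact Submodule.smul_mem _ _ h

/-- The operator `∂/∂x_i` on `C(S)`. -/
def contrAvoid (k : Type u) [CommRing k] {m : ℕ} (S : Set (Fin m →₀ ℕ)) (i : Fin m) :
    avoid k S →ₗ[k] avoid k S :=
  (contr k i).restrict (contr_mem_avoid k S i)

open Classical in
/-- The projection of `k⟨x_1, …, x_m⟩` onto `C(S)` that annihilates all other monomials. -/
def avoidProj (k : Type u) [CommRing k] {m : ℕ} (S : Set (Fin m →₀ ℕ)) :
    SymCoalg k m →ₗ[k] avoid k S :=
  (mono k m).constr k fun a =>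
    if h : ∀ b ∈ S, ¬ b ≤ a then ⟨mono k m a, mono_mem_avoid k h⟩ else 0

theorem avoidProj_mono (k : Type u) [CommRing k] {m : ℕ} {S : Set (Fin m →₀ ℕ)}
    {a : Fin m →₀ ℕ} (h : ∀ b ∈ S, ¬ b ≤ a) :
    avoidProj k S (mono k m a) = ⟨mono k m a, mono_mem_avoid k h⟩ := by
  classical
  exact ((mono k m).constr_basis k _ a).trans (dif_pos h)

/-- The restriction `C(S) → C(S) ⊗ k⟨x_1, …, x_m⟩` of the comultiplication. -/
def avoidCoact (k : Type u) [CommRing k] {m : ℕ} (S : Set (Fin m →₀ ℕ)) :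
    avoid k S →ₗ[k] avoid k S ⊗[k] SymCoalg k m :=
  (avoidProj k S).rTensor _ ∘ₗ symComul k m ∘ₗ (avoid k S).subtype

theorem avoidProj_comp_subtype (k : Type u) [CommRing k] {m : ℕ} (S : Set (Fin m →₀ ℕ)) :
    avoidProj k S ∘ₗ (avoid k S).subtype = LinearMap.id := by
  ext ⟨x, hx⟩
  simp only [LinearMap.comp_apply, Submodule.subtype_apply, LinearMap.id_apply]
  induction hx using Submodule.span_induction with
  | mem x h => obtain ⟨a, ha, rfl⟩ := h; rw [avoidProj_mono k ha]
  | zero => simp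
  | add x y _ _ h1 h2 => rw [map_add]; push_cast; rw [h1, h2]
  | smul r x _ h => rw [map_smul]; push_cast; rw [h]

theorem subtype_avoidCoact (k : Type u) [CommRing k] {m : ℕ} (S : Set (Fin m →₀ ℕ)) :
    (avoid k S).subtype.rTensor _ ∘ₗ avoidCoact k S = symComul k m ∘ₗ (avoid k S).subtype := by
  ext ⟨x, hx⟩
  simp only [LinearMap.comp_apply, Submodule.subtype_apply, avoidCoact]
  induction hx using Submodule.span_induction with
  | mem x h =>
    obtain ⟨a, ha, rfl⟩ := h
    simp only [symComul_mono, map_sum, LinearMap.rTensor_tmul]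
    refine Finset.sum_congr rfl fun p hp => ?_
    rw [Finset.HasAntidiagonal.mem_antidiagonal] at hp
    rw [avoidProj_mono k fun b hb hle => ha b hb (hle.trans (hp ▸ le_self_add))]
    rfl
  | zero => simp
  | add x y _ _ h1 h2 => simp only [map_add, h1, h2]
  | smul r x _ h => simp only [map_smul, h]

/-! ## Comodules, the cotensor product and Cotor -/

/-- A right comodule over the coalgebra `Λ`. -/
structure RightComodule (k : Type u) [CommRing k] (Λ : Type u) [AddCommGroup Λ] [Module k Λ]
    [Coalgebra k Λ] where
  carrier : Type u
  [addCommGroup : AddCommGroup carrier]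
  [module : Module k carrier]
  coact : carrier →ₗ[k] carrier ⊗[k] Λ
  coassoc : (TensorProduct.assoc k carrier Λ Λ).toLinearMap ∘ₗ coact.rTensor Λ ∘ₗ coact =
    (Coalgebra.comul (R := k) (A := Λ)).lTensor carrier ∘ₗ coact
  counit : (Coalgebra.counit (R := k) (A := Λ)).lTensor carrier ∘ₗ coact =
    (TensorProduct.mk k carrier k).flip 1

/-- A left comodule over the coalgebra `Λ`. -/
structure LeftComodule (k : Type u) [CommRing k] (Λ : Type u) [AddCommGroup Λ] [Module k Λ]
    [Coalgebra k Λ] where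
  carrier : Type u
  [addCommGroup : AddCommGroup carrier]
  [module : Module k carrier]
  coact : carrier →ₗ[k] Λ ⊗[k] carrier
  coassoc : (TensorProduct.assoc k Λ Λ carrier).toLinearMap ∘ₗ
    (Coalgebra.comul (R := k) (A := Λ)).rTensor carrier ∘ₗ coact = coact.lTensor Λ ∘ₗ coact
  counit : (Coalgebra.counit (R := k) (A := Λ)).rTensor carrier ∘ₗ coact =
    TensorProduct.mk k k carrier 1

attribute [instance] RightComodule.addCommGroup RightComodule.module
attribute [instance] LeftComodule.addCommGroup LeftComodule.module

section Cotor

variable {k : Type u} [CommRing k] {Λ : Type u} [AddCommGroup Λ] [Module k Λ] [Coalgebra k Λ]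

/-- A linear map of comodules is a morphism if it commutes with the coactions. -/
def IsComoduleHom (M N : RightComodule k Λ) (f : M.carrier →ₗ[k] N.carrier) : Prop :=
  N.coact ∘ₗ f = f.rTensor Λ ∘ₗ M.coact

/-- Injective objects of the category of right comodules (over a coalgebra that is flat over `k`,
so that the monomorphisms are the injective morphisms). -/
def IsInjectiveComodule (E : RightComodule k Λ) : Prop :=
  ∀ (M N : RightComodule k Λ) (f : M.carrier →ₗ[k] N.carrier) (g : M.carrier →ₗ[k] E.carrier),
    IsComoduleHom M N f → Function.Injective f → IsComoduleHom M E g →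
      ∃ h : N.carrier →ₗ[k] E.carrier, IsComoduleHom N E h ∧ h ∘ₗ f = g

/-- The map whose kernel is the cotensor product. -/
def cotensorMap (A : RightComodule k Λ) (B : LeftComodule k Λ) :
    A.carrier ⊗[k] B.carrier →ₗ[k] A.carrier ⊗[k] (Λ ⊗[k] B.carrier) :=
  (TensorProduct.assoc k A.carrier Λ B.carrier).toLinearMap ∘ₗ A.coact.rTensor B.carrier -
    B.coact.lTensor A.carrier

/-- The cotensor product `A ⊠_Λ B = ker (∇_A ⊗ 1 - 1 ⊗ ∇_B)`. -/
def cotensor (A : RightComodule k Λ) (B : LeftComodule k Λ) :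
    Submodule k (A.carrier ⊗[k] B.carrier) :=
  LinearMap.ker (cotensorMap A B)

theorem cotensor_map_mem {A A' : RightComodule k Λ} (B : LeftComodule k Λ)
    {f : A.carrier →ₗ[k] A'.carrier} (hf : IsComoduleHom A A' f) :
    ∀ z ∈ cotensor A B, f.rTensor B.carrier z ∈ cotensor A' B := by
  have key : cotensorMap A' B ∘ₗ f.rTensor B.carrier =
      f.rTensor (Λ ⊗[k] B.carrier) ∘ₗ cotensorMap A B := by
    refine TensorProduct.ext' fun a b => ?_
    have h1 : A'.coact (f a) = f.rTensor Λ (A.coact a) := LinearMap.congr_fun hf a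
    have h2 : ∀ w : A.carrier ⊗[k] Λ,
        TensorProduct.assoc k A'.carrier Λ B.carrier (f.rTensor Λ w ⊗ₜ[k] b) =
        f.rTensor (Λ ⊗[k] B.carrier) (TensorProduct.assoc k A.carrier Λ B.carrier (w ⊗ₜ[k] b)) := by
      intro w
      induction w using TensorProduct.induction_on with
      | zero => simp
      | tmul x y => simp
      | add x y hx hy => simp only [map_add, TensorProduct.add_tmul, hx, hy]
    simp only [cotensorMap, LinearMap.comp_apply, LinearMap.sub_apply, LinearMap.rTensor_tmul,
      LinearMap.lTensor_tmul, LinearEquiv.coe_coe, h1, h2, map_sub]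
  intro z hz
  have hz' : cotensorMap A B z = 0 := hz
  change cotensorMap A' B (f.rTensor B.carrier z) = 0
  rw [← LinearMap.comp_apply, key, LinearMap.comp_apply, hz', map_zero]

/-- A resolution `0 → A → X^0 → X^1 → …` of a right comodule by right comodules. -/
structure ComoduleResolution (A : RightComodule k Λ) where
  X : ℕ → RightComodule k Λ
  aug : A.carrier →ₗ[k] (X 0).carrier
  d : ∀ n, (X n).carrier →ₗ[k] (X (n + 1)).carrier
  aug_hom : IsComoduleHom A (X 0) aug
  d_hom : ∀ n, IsComoduleHom (X n) (X (n + 1)) (d n)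
  aug_injective : Function.Injective aug
  exact_zero : Function.Exact aug (d 0)
  exact_succ : ∀ n, Function.Exact (d n) (d (n + 1))

namespace ComoduleResolution

variable {A : RightComodule k Λ} (R : ComoduleResolution A) (B : LeftComodule k Λ)

/-- An injective resolution. -/
def IsInjective : Prop := ∀ n, IsInjectiveComodule (R.X n)

/-- The differential of `X^• ⊠_Λ B`. -/
def cotensorD (n : ℕ) : cotensor (R.X n) B →ₗ[k] cotensor (R.X (n + 1)) B :=
  ((R.d n).rTensor B.carrier).restrict (cotensor_map_mem B (R.d_hom n))

theorem d_comp (n : ℕ) : R.d (n + 1) ∘ₗ R.d n = 0 :=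
  LinearMap.ext fun x => (R.exact_succ n (R.d n x)).2 ⟨x, rfl⟩

theorem cotensorD_comp (n : ℕ) : R.cotensorD B (n + 1) ∘ₗ R.cotensorD B n = 0 := by
  ext1 x
  apply Subtype.ext
  change (R.d (n + 1)).rTensor B.carrier ((R.d n).rTensor B.carrier x.1) = 0
  rw [← LinearMap.comp_apply, ← LinearMap.rTensor_comp, R.d_comp, LinearMap.rTensor_zero,
    LinearMap.zero_apply]

/-- The complex `X^• ⊠_Λ B`. -/
def cotensorComplex : CochainComplex (ModuleCat.{u} k) ℕ :=
  CochainComplex.of (fun n => ModuleCat.of k (cotensor (R.X n) B))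
    (fun n => ModuleCat.ofHom (R.cotensorD B n)) fun n => by
      rw [← ModuleCat.ofHom_comp, cotensorD_comp]; rfl

/-- `Cotor^n_Λ(A, B) = H^n(X^• ⊠_Λ B)`, calculated by the resolution `X^•` of `A` (which is
required to be injective where this is used). -/
def cotor (n : ℕ) : ModuleCat.{u} k := (R.cotensorComplex B).homology n

end ComoduleResolution

/-! ### The graded version -/

/-- `𝒜` makes the right comodule `A` a graded comodule over `Λ` with the grading `ℒ`. -/
def IsGradedComodule (ℒ : ℕ → Submodule k Λ) (A : RightComodule k Λ)
    (𝒜 : ℕ → Submodule k A.carrier) : Prop :=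
  DirectSum.IsInternal 𝒜 ∧ ∀ e, (𝒜 e).map A.coact ≤
    ⨆ p ∈ antidiagonal e, Submodule.map₂ (TensorProduct.mk k A.carrier Λ) (𝒜 p.1) (ℒ p.2)

/-- A linear map that preserves the degrees. -/
def IsHomogeneous {M N : Type u} [AddCommGroup M] [Module k M] [AddCommGroup N] [Module k N]
    (ℳ : ℕ → Submodule k M) (𝒩 : ℕ → Submodule k N) (f : M →ₗ[k] N) : Prop :=
  ∀ e, ∀ x ∈ ℳ e, f x ∈ 𝒩 e

/-- Injective objects of the category of graded right comodules and degree-preserving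
morphisms. -/
def IsGradedInjective (ℒ : ℕ → Submodule k Λ) (E : RightComodule k Λ)
    (ℰ : ℕ → Submodule k E.carrier) : Prop :=
  ∀ (M N : RightComodule k Λ) (ℳ : ℕ → Submodule k M.carrier) (𝒩 : ℕ → Submodule k N.carrier)
    (f : M.carrier →ₗ[k] N.carrier) (g : M.carrier →ₗ[k] E.carrier),
    IsGradedComodule ℒ M ℳ → IsGradedComodule ℒ N 𝒩 →
    IsComoduleHom M N f → IsHomogeneous ℳ 𝒩 f → Function.Injective f →
    IsComoduleHom M E g → IsHomogeneous ℳ ℰ g →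
      ∃ h : N.carrier →ₗ[k] E.carrier, IsComoduleHom N E h ∧ IsHomogeneous 𝒩 ℰ h ∧ h ∘ₗ f = g

/-- A resolution by graded comodules of a graded comodule `A` with the grading `𝒜`. -/
structure GradedComoduleResolution (ℒ : ℕ → Submodule k Λ) (A : RightComodule k Λ)
    (𝒜 : ℕ → Submodule k A.carrier) extends ComoduleResolution A where
  gr : ∀ n, ℕ → Submodule k (X n).carrier
  graded : ∀ n, IsGradedComodule ℒ (X n) (gr n)
  aug_homogeneous : IsHomogeneous 𝒜 (gr 0) aug
  d_homogeneous : ∀ n, IsHomogeneous (gr n) (gr (n + 1)) (d n)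

namespace GradedComoduleResolution

variable {ℒ : ℕ → Submodule k Λ} {A : RightComodule k Λ} {𝒜 : ℕ → Submodule k A.carrier}
  (R : GradedComoduleResolution ℒ A 𝒜) (B : LeftComodule k Λ)

/-- An injective resolution in the category of graded comodules. -/
def IsInjective : Prop := ∀ n, IsGradedInjective ℒ (R.X n) (R.gr n)

/-- The part of degree `e` of `X^n ⊠_Λ B`, where `B` is concentrated in degree `0`. -/
def cotensorDeg (e n : ℕ) : Submodule k (cotensor (R.X n) B) :=
  (Submodule.map₂ (TensorProduct.mk k (R.X n).carrier B.carrier) (R.gr n e) ⊤).comap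
    (cotensor (R.X n) B).subtype

theorem cotensorD_mem (e n : ℕ) : ∀ z ∈ R.cotensorDeg B e n,
    R.cotensorD B n z ∈ R.cotensorDeg B e (n + 1) := by
  rintro ⟨z, hz⟩ h
  change z ∈ Submodule.map₂ _ _ _ at h
  change (R.d n).rTensor B.carrier z ∈ Submodule.map₂ _ _ _
  have : Submodule.map₂ (TensorProduct.mk k (R.X n).carrier B.carrier) (R.gr n e) ⊤ ≤
      (Submodule.map₂ (TensorProduct.mk k (R.X (n + 1)).carrier B.carrier)
        (R.gr (n + 1) e) ⊤).comap ((R.d n).rTensor B.carrier) := by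
    rw [Submodule.map₂_le]
    intro x hx b hb
    exact Submodule.apply_mem_map₂ _ (R.d_homogeneous n e x hx) hb
  exact this h

/-- The differential of the part of degree `e` of `X^• ⊠_Λ B`. -/
def cotensorDegD (e n : ℕ) : R.cotensorDeg B e n →ₗ[k] R.cotensorDeg B e (n + 1) :=
  (R.cotensorD B n).restrict (R.cotensorD_mem B e n)

/-- The part of degree `e` of the complex `X^• ⊠_Λ B`. -/
def cotensorDegComplex (e : ℕ) : CochainComplex (ModuleCat.{u} k) ℕ :=
  CochainComplex.of (fun n => ModuleCat.of k (R.cotensorDeg B e n))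
    (fun n => ModuleCat.ofHom (R.cotensorDegD B e n)) fun n => by
      rw [← ModuleCat.ofHom_comp]
      have : R.cotensorDegD B e (n + 1) ∘ₗ R.cotensorDegD B e n = 0 := by
        ext1 x
        apply Subtype.ext
        exact LinearMap.congr_fun (R.cotensorD_comp B n) x.1
      rw [this]; rfl

/-- The part of internal degree `e` of `Cotor^n_Λ(A, B)`, calculated by the graded
resolution `X^•` of `A`. -/
def cotorDeg (n e : ℕ) : ModuleCat.{u} k := (R.cotensorDegComplex B e).homology n

end GradedComoduleResolution

end Cotor

/-! ## The Koszul complex of the face coalgebra -/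

section Koszul

variable (k : Type u) [CommRing k] {m : ℕ}

theorem avoidCoact_counit (S : Set (Fin m →₀ ℕ)) :
    (symCounit k m).lTensor (avoid k S) ∘ₗ avoidCoact k S =
      (TensorProduct.mk k (avoid k S) k).flip 1 := by
  have h : (symCounit k m).lTensor (SymCoalg k m) ∘ₗ symComul k m =
      (TensorProduct.mk k (SymCoalg k m) k).flip 1 :=
    Coalgebra.lTensor_counit_comp_comul (R := k) (A := SymCoalg k m)
  have h1 : (symCounit k m).lTensor (avoid k S) ∘ₗ (avoidProj k S).rTensor (SymCoalg k m) =
      (avoidProj k S).rTensor k ∘ₗ (symCounit k m).lTensor (SymCoalg k m) := by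
    rw [LinearMap.lTensor_comp_rTensor, LinearMap.rTensor_comp_lTensor]
  refine LinearMap.ext fun x => ?_
  have h2 := LinearMap.congr_fun h x.1
  have h3 := LinearMap.congr_fun (avoidProj_comp_subtype k S) x
  have h4 := LinearMap.congr_fun h1 (symComul k m x.1)
  simp only [LinearMap.comp_apply, LinearMap.flip_apply, TensorProduct.mk_apply,
    Submodule.subtype_apply, LinearMap.id_apply] at h2 h3 h4 ⊢
  rw [avoidCoact, LinearMap.comp_apply, LinearMap.comp_apply, Submodule.subtype_apply, h4, h2,
    LinearMap.rTensor_tmul, h3]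

theorem avoidCoact_coassoc (S : Set (Fin m →₀ ℕ)) :
    (TensorProduct.assoc k (avoid k S) (SymCoalg k m) (SymCoalg k m)).toLinearMap ∘ₗ
      (avoidCoact k S).rTensor (SymCoalg k m) ∘ₗ avoidCoact k S =
    (symComul k m).lTensor (avoid k S) ∘ₗ avoidCoact k S := by
  have h : (TensorProduct.assoc k (SymCoalg k m) (SymCoalg k m) (SymCoalg k m)).toLinearMap ∘ₗ
      (symComul k m).rTensor (SymCoalg k m) ∘ₗ symComul k m =
      (symComul k m).lTensor (SymCoalg k m) ∘ₗ symComul k m :=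
    Coalgebra.coassoc (R := k) (A := SymCoalg k m)
  have h1 : (symComul k m).lTensor (avoid k S) ∘ₗ (avoidProj k S).rTensor (SymCoalg k m) =
      (avoidProj k S).rTensor _ ∘ₗ (symComul k m).lTensor (SymCoalg k m) := by
    rw [LinearMap.lTensor_comp_rTensor, LinearMap.rTensor_comp_lTensor]
  have h2 : (TensorProduct.assoc k (avoid k S) (SymCoalg k m) (SymCoalg k m)).toLinearMap ∘ₗ
      ((avoidProj k S).rTensor (SymCoalg k m)).rTensor (SymCoalg k m) =
      (avoidProj k S).rTensor _ ∘ₗ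
        (TensorProduct.assoc k (SymCoalg k m) (SymCoalg k m) (SymCoalg k m)).toLinearMap := by
    refine TensorProduct.ext_threefold fun a b c => ?_
    simp
  have h3 : (avoidCoact k S).rTensor (SymCoalg k m) ∘ₗ avoidCoact k S =
      ((avoidProj k S).rTensor (SymCoalg k m)).rTensor (SymCoalg k m) ∘ₗ
        (symComul k m).rTensor (SymCoalg k m) ∘ₗ symComul k m ∘ₗ (avoid k S).subtype := by
    rw [← subtype_avoidCoact]
    nth_rw 1 [avoidCoact]
    simp only [LinearMap.rTensor_comp, LinearMap.comp_assoc]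
  rw [h3, ← LinearMap.comp_assoc, h2, LinearMap.comp_assoc]
  have h5 : (symComul k m).lTensor (avoid k S) ∘ₗ avoidCoact k S =
      (avoidProj k S).rTensor _ ∘ₗ ((symComul k m).lTensor (SymCoalg k m) ∘ₗ symComul k m) ∘ₗ
        (avoid k S).subtype := by
    rw [avoidCoact, ← LinearMap.comp_assoc, h1]
    simp only [LinearMap.comp_assoc]
  rw [h5, ← h]
  simp only [LinearMap.comp_assoc]

/-- `C(S)` as a right comodule over `k⟨x_1, …, x_m⟩`. -/
def avoidComodule (S : Set (Fin m →₀ ℕ)) : RightComodule k (SymCoalg k m) where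
  carrier := avoid k S
  coact := avoidCoact k S
  coassoc := avoidCoact_coassoc k S
  counit := avoidCoact_counit k S

/-- The ground ring `k` as a left comodule over `k⟨x_1, …, x_m⟩`, with the coaction
`r ↦ 1 ⊗ r`. -/
def trivialComodule (m : ℕ) : LeftComodule k (SymCoalg k m) where
  carrier := k
  coact := TensorProduct.mk k (SymCoalg k m) k (mono k m 0)
  coassoc := by
    refine LinearMap.ext fun r => ?_
    change TensorProduct.assoc k _ _ _ ((symComul k m).rTensor k (mono k m 0 ⊗ₜ[k] r)) =
      (TensorProduct.mk k (SymCoalg k m) k (mono k m 0)).lTensor _ (mono k m 0 ⊗ₜ[k] r)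
    simp [symComul_mono]
  counit := by
    refine LinearMap.ext fun r => ?_
    change (symCounit k m).rTensor k (mono k m 0 ⊗ₜ[k] r) = 1 ⊗ₜ[k] r
    simp [symCounit_mono]

/-- The exponent vector of the square-free monomial `x_I`. -/
def sqfree (I : Finset (Fin m)) : Fin m →₀ ℕ := Finsupp.indicator I fun _ _ => 1

variable (K : AbstractSimplicialComplex (Fin m))

/-- The exponent vectors of the monomials `x_J`, where `J` is a missing face of `K`. -/
def missingMonomials : Set (Fin m →₀ ℕ) := sqfree '' {J | IsMissingFace K J}

/-- The face coalgebra `k⟨K⟩ = C(x_J | J is a missing face of K)`. -/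
abbrev FaceCoalg : Type u := avoid k (missingMonomials K)

/-- The face coalgebra as a right comodule over `k⟨x_1, …, x_m⟩`. -/
def faceComodule : RightComodule k (SymCoalg k m) := avoidComodule k (missingMonomials K)

/-- The intrinsic grading of `k⟨K⟩`. -/
def faceGrading (e : ℕ) : Submodule k (FaceCoalg k K) :=
  (symGrading k m e).comap (avoid k (missingMonomials K)).subtype

theorem sqfree_le_iff {I J : Finset (Fin m)} : sqfree J ≤ sqfree I ↔ J ⊆ I := by
  classical
  constructor
  · intro h i hi
    have := h i
    by_contra hn
    simp [sqfree, hi, hn] at this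
  · intro h i
    by_cases hi : i ∈ J
    · simp [sqfree, hi, h hi]
    · simp [sqfree, hi]

/-- The element `x_I` of `k⟨K⟩`, for a face `I` of `K`. -/
def faceMono {I : Finset (Fin m)} (h : IsFace K I) : FaceCoalg k K :=
  ⟨mono k m (sqfree I), mono_mem_avoid k (by
    rintro _ ⟨J, hJ, rfl⟩ hle
    exact hJ.1 (h.mono (sqfree_le_iff.1 hle)))⟩

/-- The exterior coalgebra `Λ⟨y_1, …, y_m⟩` (only its module structure and the multiplication by
the `y_i` are needed). -/
abbrev ExtCoalg (m : ℕ) : Type u := ExteriorAlgebra k (Fin m → k)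

/-- The generator `y_i`. -/
def yGen (i : Fin m) : ExtCoalg k m := ExteriorAlgebra.ι k (Pi.single i 1)

/-- The exterior monomial `y_J = y_{j_1} ∧ ⋯ ∧ y_{j_n}`, where `J = {j_1 < ⋯ < j_n}`. -/
def yMono (J : Finset (Fin m)) : ExtCoalg k m := ((J.sort (· ≤ ·)).map (yGen k)).prod

/-- The differential `∂ = ∑ᵢ ∂/∂x_i ⊗ y_i` of `k⟨K⟩ ⊗ Λ⟨y_1, …, y_m⟩`. -/
def koszulD : FaceCoalg k K ⊗[k] ExtCoalg k m →ₗ[k] FaceCoalg k K ⊗[k] ExtCoalg k m :=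
  ∑ i, TensorProduct.map (contrAvoid k (missingMonomials K) i) (LinearMap.mulLeft k (yGen k i))

theorem koszulD_comp : koszulD k K ∘ₗ koszulD k K = 0 := by
  have hc : ∀ i l, contrAvoid k (missingMonomials K) i ∘ₗ contrAvoid k (missingMonomials K) l =
      contrAvoid k (missingMonomials K) l ∘ₗ contrAvoid k (missingMonomials K) i := by
    have h : ∀ i l : Fin m, contr k i ∘ₗ contr k l = contr k l ∘ₗ contr k i := fun i l => by
      refine (mono k m).ext fun a => ?_
      by_cases hil : i = l
      · rw [hil]
      · have h1 : (Finsupp.single l 1 : Fin m →₀ ℕ) i = 0 := by simp [Ne.symm hil]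
        have h2 : (Finsupp.single i 1 : Fin m →₀ ℕ) l = 0 := by simp [hil]
        simp only [LinearMap.comp_apply, contr_mono]
        by_cases hi : a i = 0 <;> by_cases hl : a l = 0 <;>
          simp [hi, hl, contr_mono, h1, h2, tsub_right_comm]
    intro i l
    refine LinearMap.ext fun x => Subtype.ext ?_
    exact LinearMap.congr_fun (h i l) x.1
  rw [← Module.End.mul_eq_comp, koszulD, Finset.sum_mul_sum, ← Finset.sum_product']
  simp only [Module.End.mul_eq_comp]
  refine Finset.sum_involution (fun p _ => (p.2, p.1)) ?_ ?_ ?_ ?_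
  · rintro ⟨i, l⟩ _
    simp only [← TensorProduct.map_comp]
    rw [hc i l, ← TensorProduct.map_add_right]
    have : LinearMap.mulLeft k (yGen k l) ∘ₗ LinearMap.mulLeft k (yGen k i) +
        LinearMap.mulLeft k (yGen k i) ∘ₗ LinearMap.mulLeft k (yGen k l) = 0 := by
      refine LinearMap.ext fun z => ?_
      simp only [LinearMap.add_apply, LinearMap.comp_apply, LinearMap.mulLeft_apply,
        ← mul_assoc, ← add_mul, LinearMap.zero_apply]
      rw [yGen, yGen, ExteriorAlgebra.ι_add_mul_swap, zero_mul]
    first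
      | rw [this, TensorProduct.map_zero_right]
      | rw [add_comm] at this; rw [this, TensorProduct.map_zero_right]
  · rintro ⟨i, l⟩ _ hne heq
    simp only [Prod.mk.injEq] at heq
    obtain ⟨rfl, -⟩ := heq
    refine hne ?_
    simp only [← TensorProduct.map_comp]
    have : LinearMap.mulLeft k (yGen k l) ∘ₗ LinearMap.mulLeft k (yGen (m := m) k l) = 0 := by
      refine LinearMap.ext fun z => ?_
      simp only [LinearMap.comp_apply, LinearMap.mulLeft_apply, ← mul_assoc, LinearMap.zero_apply]
      rw [yGen, ExteriorAlgebra.ι_sq_zero, zero_mul]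
    rw [this, TensorProduct.map_zero_right]
  · simp
  · simp

/-- The part of `k⟨K⟩ ⊗ Λ⟨y_1, …, y_m⟩` of total degree `q`, where `x_i` has degree `2` and
`y_i` has degree `1`. -/
def koszulDeg (q : ℕ) : Submodule k (FaceCoalg k K ⊗[k] ExtCoalg k m) :=
  ⨆ p ∈ antidiagonal q, Submodule.map₂ (TensorProduct.mk k (FaceCoalg k K) (ExtCoalg k m))
    (faceGrading k K p.1) (⋀[k]^p.2 (Fin m → k))

/-- The part `k⟨K⟩ ⊗ Λ^n⟨y_1, …, y_m⟩` of the Koszul complex. -/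
def koszulCoDeg (n : ℕ) : Submodule k (FaceCoalg k K ⊗[k] ExtCoalg k m) :=
  Submodule.map₂ (TensorProduct.mk k (FaceCoalg k K) (ExtCoalg k m)) ⊤ (⋀[k]^n (Fin m → k))

theorem yGen_mul_mem (i : Fin m) {n : ℕ} {y : ExtCoalg k m} (hy : y ∈ ⋀[k]^n (Fin m → k)) :
    yGen k i * y ∈ ⋀[k]^(n + 1) (Fin m → k) := by
  have : ⋀[k]^(n + 1) (Fin m → k) = LinearMap.range (ExteriorAlgebra.ι k) *
      ⋀[k]^n (Fin m → k) := pow_succ' _ _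
  rw [this]
  exact Submodule.mul_mem_mul ⟨_, rfl⟩ hy

theorem contr_mem_symGrading (i : Fin m) (e : ℕ) :
    ∀ x ∈ symGrading k m e, contr k i x ∈ symGrading k m (e - 2) ∧ (e < 2 → contr k i x = 0) := by
  intro x hx
  induction hx using Submodule.span_induction with
  | mem x h =>
    obtain ⟨a, ha, rfl⟩ := h
    rw [contr_mono]
    split_ifs with hi
    · exact ⟨Submodule.zero_mem _, fun _ => rfl⟩
    · have hle : Finsupp.single i 1 ≤ a := by
        rw [Finsupp.single_le_iff]; omega
      have hdeg : (a - Finsupp.single i 1).degree + 1 = a.degree := by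
        conv_rhs => rw [← tsub_add_cancel_of_le hle]
        rw [map_add, Finsupp.degree_single]
      have ha' : 2 * a.degree = e := ha
      refine ⟨Submodule.subset_span ⟨_, ?_, rfl⟩, fun h => by omega⟩
      change 2 * (a - Finsupp.single i 1).degree = e - 2
      omega
  | zero => simp
  | add x y _ _ h1 h2 =>
    rw [map_add]
    exact ⟨Submodule.add_mem _ h1.1 h2.1, fun h => by rw [h1.2 h, h2.2 h, add_zero]⟩
  | smul r x _ h =>
    rw [map_smul]
    exact ⟨Submodule.smul_mem _ _ h.1, fun h' => by rw [h.2 h', smul_zero]⟩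

theorem koszulD_mem_deg (q : ℕ) : ∀ z ∈ koszulDeg k K (q + 1), koszulD k K z ∈ koszulDeg k K q := by
  suffices h : koszulDeg k K (q + 1) ≤ (koszulDeg k K q).comap (koszulD k K) from h
  refine iSup₂_le fun p hp => ?_
  rw [Submodule.map₂_le]
  intro x hx y hy
  rw [Finset.HasAntidiagonal.mem_antidiagonal] at hp
  rw [Submodule.mem_comap, koszulD, LinearMap.sum_apply]
  refine Submodule.sum_mem _ fun i _ => ?_
  rw [TensorProduct.mk_apply, TensorProduct.map_tmul, LinearMap.mulLeft_apply]
  obtain ⟨h1, h2⟩ := contr_mem_symGrading k i p.1 x.1 hx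
  by_cases he : p.1 < 2
  · have : contrAvoid k (missingMonomials K) i x = 0 := Subtype.ext (h2 he)
    rw [this, TensorProduct.zero_tmul]
    exact Submodule.zero_mem _
  · refine Submodule.mem_iSup_of_mem (p.1 - 2, p.2 + 1) (Submodule.mem_iSup_of_mem ?_ ?_)
    · rw [Finset.HasAntidiagonal.mem_antidiagonal]; simp only; omega
    · exact Submodule.apply_mem_map₂ _ h1 (yGen_mul_mem k i hy)

theorem koszulD_mem_coDeg (n : ℕ) :
    ∀ z ∈ koszulCoDeg k K n, koszulD k K z ∈ koszulCoDeg k K (n + 1) := by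
  suffices h : koszulCoDeg k K n ≤ (koszulCoDeg k K (n + 1)).comap (koszulD k K) from h
  rw [koszulCoDeg, Submodule.map₂_le]
  intro x _ y hy
  rw [Submodule.mem_comap, koszulD, LinearMap.sum_apply]
  refine Submodule.sum_mem _ fun i _ => ?_
  rw [TensorProduct.mk_apply, TensorProduct.map_tmul, LinearMap.mulLeft_apply]
  exact Submodule.apply_mem_map₂ _ Submodule.mem_top (yGen_mul_mem k i hy)

/-- The Koszul complex `(k⟨K⟩ ⊗ Λ⟨y_1, …, y_m⟩, ∂)`, graded by the total degree. -/
def koszulComplex : ChainComplex (ModuleCat.{u} k) ℕ :=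
  ChainComplex.of (fun q => ModuleCat.of k (koszulDeg k K q))
    (fun q => ModuleCat.ofHom ((koszulD k K).restrict (koszulD_mem_deg k K q))) fun q => by
      rw [← ModuleCat.ofHom_comp]
      have : (koszulD k K).restrict (koszulD_mem_deg k K q) ∘ₗ
          (koszulD k K).restrict (koszulD_mem_deg k K (q + 1)) = 0 := by
        refine LinearMap.ext fun x => Subtype.ext ?_
        exact LinearMap.congr_fun (koszulD_comp k K) x.1
      rw [this]; rfl

/-- The same Koszul complex, graded by the number of factors `y_i`:
`k⟨K⟩ ⊗ Λ^0 → k⟨K⟩ ⊗ Λ^1 → k⟨K⟩ ⊗ Λ^2 → …`. -/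
def koszulCoComplex : CochainComplex (ModuleCat.{u} k) ℕ :=
  CochainComplex.of (fun n => ModuleCat.of k (koszulCoDeg k K n))
    (fun n => ModuleCat.ofHom ((koszulD k K).restrict (koszulD_mem_coDeg k K n))) fun n => by
      rw [← ModuleCat.ofHom_comp]
      have : (koszulD k K).restrict (koszulD_mem_coDeg k K (n + 1)) ∘ₗ
          (koszulD k K).restrict (koszulD_mem_coDeg k K n) = 0 := by
        refine LinearMap.ext fun x => Subtype.ext ?_
        exact LinearMap.congr_fun (koszulD_comp k K) x.1
      rw [this]; rfl

/-- The basis element of `C_q(Z_K; k)` given by a cell. -/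
def cellChain {q : ℕ} (c : Cell K q) : (cellularComplex k K).X q :=
  (Finsupp.single c 1 : Cell K q →₀ k)

/-- The inclusion of the part of total degree `q` of the Koszul complex into
`k⟨K⟩ ⊗ Λ⟨y_1, …, y_m⟩`. -/
def koszulIncl (q : ℕ) : (koszulComplex k K).X q →ₗ[k] FaceCoalg k K ⊗[k] ExtCoalg k m :=
  (koszulDeg k K q).subtype

/-- The element `x_I ⊗ y_J` for a cell `κ(J,I)` of `Z_K`. -/
def koszulMono {q : ℕ} (c : Cell K q) : FaceCoalg k K ⊗[k] ExtCoalg k m :=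
  faceMono k K ((cellSet_subset_iff K c.2.1).1 c.2.2.1) ⊗ₜ[k] yMono k c.1.1

/-- `H_q(Z_K; k)`. -/
def cellularHomology (q : ℕ) : ModuleCat.{u} k := (cellularComplex k K).homology q

end Koszul

end MomentAngle
end

open MomentAngle

/-! One homotopy serves both halves of the theorem. Let commuting operators t_i of a module M define
∂ = ∑ t_i ⊗ y_i on M ⊗ Λ, let ι_i be the contraction with the i-th coordinate, and put h_i = s_i ⊗
ι_i. If s_i commutes with t_l for l ≠ i, the mixed terms of ∂h_i + h_i∂ cancel, because ι_i
anticommutes with y_l. Hence 1 - (∂h_i + h_i∂) is diagonal in the exterior monomials: it acts on x ⊗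
y_J through 1 - t_i s_i if i ∈ J and through 1 - s_i t_i otherwise (`koszulProj_apply`). The product
of these operators over all i commutes with ∂ and moves cycles by boundaries only
(`koszulProj_list_cycle`).

Cells. On k⟨K⟩ let t_i = ∂/∂x_i, and let s_i raise the exponent of x_i if it is already positive and
be zero otherwise; supports do not change, so k⟨K⟩ is preserved. The product of the diagonal
operators is then the projection onto the span of the x_I ⊗ y_J with I a face disjoint from J
(`cellProj_koszulBasis`). These are the images of the cells, and ∂ restricts to the cellular
boundary: the incidence number is the sign of sorting y_i into y_J (`koszulD_cellMap`). A subcomplex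
that is the image of such a projection has the same homology (`quasiIso_cellularToKoszul`).

Cotor. The coefficients of x_1, …, x_m in the coaction of any right comodule X are commuting
operators, so X has a Koszul complex X ⊗ Λ. Its cycles without factors y_i are the x with coaction x
⊗ 1, that is, X ⊠ k (`tmul_trivialOne_mem_cotensor_iff`). For a cofree comodule V ⊗ k⟨m⟩ the choice
of multiplication by x_i for s_i makes the projection vanish in positive exterior degrees. An
injective comodule is a retract of a cofree one through its coaction, so its Koszul complex is exact
in positive degrees too (`IsCofreeRetract.exists_koszulOp_eq`). In the double complex X^p ⊗ Λ^n of
an injective resolution of k⟨K⟩ the rows are then exact because Λ is free, and the columns are exact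
in positive degrees. One edge is the Koszul complex of k⟨K⟩, the other one is X^• ⊠ k, and a
staircase of isomorphisms identifies their cohomology (`IsResolvingDoubleComplex.nonempty_equiv`).

Degrees. Replacing x_i by y_i preserves the internal degree if y_i counts 2 in it, so the double
complex splits into internal degrees. An element of total degree q with n factors y_i has internal
degree q + n, whence the indices of the graded statement. The ungraded direct sums agree because ker
∂ / im ∂ decomposes both by total degree and by the number of factors y_i. -/

noncomputable section

namespace MomentAngle

/-! ### Exterior monomials, multiplication by generators and contraction -/

section Exterior

variable (k : Type u) [CommRing k] {m : ℕ}

theorem yMono_empty : yMono k (∅ : Finset (Fin m)) = 1 := by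
  simp [yMono]

theorem yMono_insert_of_lt {i : Fin m} {J : Finset (Fin m)} (h : ∀ j ∈ J, i < j) :
    yMono k (insert i J) = yGen k i * yMono k J := by
  have hi : i ∉ J := fun hi => lt_irrefl _ (h i hi)
  rw [yMono, Finset.sort_insert _ (fun j hj => (h j hj).le) hi, List.map_cons, List.prod_cons, yMono]

theorem yGen_mul_self (i : Fin m) : yGen k i * yGen k i = 0 :=
  ExteriorAlgebra.ι_sq_zero _

theorem yGen_mul_comm (i j : Fin m) : yGen k i * yGen k j = -(yGen k j * yGen k i) :=
  eq_neg_of_add_eq_zero_left (ExteriorAlgebra.ι_add_mul_swap _ _)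

theorem yGen_mul_yMono_of_mem {i : Fin m} {J : Finset (Fin m)} (hi : i ∈ J) :
    yGen k i * yMono k J = 0 := by
  induction J using Finset.induction_on_min with
  | empty => simp at hi
  | insert a J ha ih =>
    rw [yMono_insert_of_lt k ha, ← mul_assoc]
    rcases Finset.mem_insert.1 hi with rfl | h
    · rw [yGen_mul_self, zero_mul]
    · rw [yGen_mul_comm, neg_mul, mul_assoc, ih h, mul_zero, neg_zero]

/-- Each transposition of y_i with a y_j, j < i, on the way to its sorted place costs one sign. The
same sign is the incidence number of the cellular boundary. -/
theorem yGen_mul_yMono {i : Fin m} {J : Finset (Fin m)} (hi : i ∉ J) :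
    yGen k i * yMono k J = ((-1) ^ #{j ∈ J | j < i} : k) • yMono k (insert i J) := by
  induction J using Finset.induction_on_min with
  | empty => rw [yMono_insert_of_lt k (by simp)]; simp
  | insert a J ha ih =>
    simp only [Finset.mem_insert, not_or] at hi
    have haJ : a ∉ J := fun h => lt_irrefl _ (ha a h)
    rcases lt_or_gt_of_ne hi.1 with h | h
    · have hlt : ∀ j ∈ insert a J, i < j := by
        intro j hj
        rcases Finset.mem_insert.1 hj with rfl | hj
        · exact h
        · exact h.trans (ha j hj)
      rw [yMono_insert_of_lt k hlt, Finset.filter_false_of_mem fun j hj => (hlt j hj).not_gt]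
      simp
    · rw [yMono_insert_of_lt k ha, ← mul_assoc, yGen_mul_comm, neg_mul, mul_assoc, ih hi.2,
        Finset.insert_comm, yMono_insert_of_lt k (i := a) (J := insert i J),
        Finset.filter_insert, if_pos h,
        Finset.card_insert_of_notMem (by simp [haJ]), pow_succ, mul_smul_comm]
      · simp
      · intro j hj
        rcases Finset.mem_insert.1 hj with rfl | hj
        · exact h
        · exact ha j hj

/-- The basis of exterior monomials `y_J`. -/
def yBasis (m : ℕ) : Module.Basis (Finset (Fin m)) k (ExtCoalg k m) :=
  (Pi.basisFun k (Fin m)).ExteriorAlgebra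

/-- Both products run through J in increasing order. This makes the sorted products `yMono` a basis
of the exterior algebra. -/
theorem yBasis_apply (J : Finset (Fin m)) : yBasis k m J = yMono k J := by
  rw [yBasis, ExteriorAlgebra.basis_apply_ofCard _ (rfl : #J = #J), ExteriorAlgebra.ιMulti_family,
    ExteriorAlgebra.ιMulti_apply, yMono]
  congr 1
  refine List.ext_getElem (by simp) fun n h1 h2 => ?_
  simp only [List.getElem_ofFn, Function.comp_apply, List.getElem_map, yGen,
    Set.powersetCard.ofFinEmbEquiv_symm_apply, Pi.basisFun_apply]
  rfl

theorem exteriorPower_eq_span (n : ℕ) :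
    ⋀[k]^n (Fin m → k) = Submodule.span k (yBasis k m '' {J | #J = n}) := by
  have h := congrArg (Submodule.map (⋀[k]^n (Fin m → k)).subtype)
    ((Pi.basisFun k (Fin m)).exteriorPower n).span_eq
  rw [Submodule.map_top, Submodule.range_subtype, Submodule.map_span, ← Set.range_comp] at h
  rw [← h]
  congr 1
  ext y
  constructor
  · rintro ⟨s, rfl⟩
    refine ⟨s.1, s.2, ?_⟩
    rw [yBasis, ExteriorAlgebra.basis_eq_coe_basis]
    rfl
  · rintro ⟨J, hJ, rfl⟩
    refine ⟨⟨J, hJ⟩, ?_⟩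
    rw [yBasis, Function.comp_apply, Submodule.subtype_apply,
      ← ExteriorAlgebra.basis_eq_coe_basis]

/-- Contraction with the `i`-th coordinate. -/
def yContr (i : Fin m) : ExtCoalg k m →ₗ[k] ExtCoalg k m :=
  CliffordAlgebra.contractLeft (LinearMap.proj i)

theorem yContr_yGen_mul (i l : Fin m) (z : ExtCoalg k m) :
    yContr k i (yGen k l * z) = (if i = l then z else 0) - yGen k l * yContr k i z := by
  have h := CliffordAlgebra.contractLeft_ι_mul (Q := (0 : QuadraticForm k (Fin m → k)))
    (d := LinearMap.proj i) (Pi.single l 1) z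
  rw [LinearMap.proj_apply, Pi.single_apply, ite_smul, one_smul, zero_smul] at h
  exact h

theorem yContr_yMono_of_notMem {i : Fin m} {J : Finset (Fin m)} (hi : i ∉ J) :
    yContr k i (yMono k J) = 0 := by
  induction J using Finset.induction_on_min with
  | empty => rw [yMono_empty]; exact CliffordAlgebra.contractLeft_one (R := k) (Q := 0) _
  | insert a J ha ih =>
    simp only [Finset.mem_insert, not_or] at hi
    rw [yMono_insert_of_lt k ha, yContr_yGen_mul, if_neg hi.1, ih hi.2, mul_zero, sub_zero]

/-- If i ∈ J, then y_i y_J = 0, and contracting this product by the Leibniz rule yields y_J - y_i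
ι_i(y_J) = 0. -/
theorem yGen_mul_yContr_yMono (i : Fin m) (J : Finset (Fin m)) :
    yGen k i * yContr k i (yMono k J) = if i ∈ J then yMono k J else 0 := by
  split_ifs with h
  · have := yContr_yGen_mul k i i (yMono k J)
    rw [yGen_mul_yMono_of_mem k h, map_zero, if_pos rfl] at this
    exact (sub_eq_zero.1 this.symm).symm
  · rw [yContr_yMono_of_notMem k h, mul_zero]

end Exterior

/-! ### Koszul differentials of commuting operators and their diagonal homotopies -/

section KoszulOperator

variable {k : Type u} [CommRing k] {m : ℕ} {M : Type u} [AddCommGroup M] [Module k M]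

/-- The Koszul differential `∑ᵢ tᵢ ⊗ yᵢ` on `M ⊗ Λ⟨y_1, …, y_m⟩` given by operators `tᵢ` of a
module `M`. -/
def koszulOp (t : Fin m → M →ₗ[k] M) : M ⊗[k] ExtCoalg k m →ₗ[k] M ⊗[k] ExtCoalg k m :=
  ∑ i, TensorProduct.map (t i) (LinearMap.mulLeft k (yGen k i))

theorem koszulOp_tmul (t : Fin m → M →ₗ[k] M) (x : M) (y : ExtCoalg k m) :
    koszulOp t (x ⊗ₜ y) = ∑ i, t i x ⊗ₜ (yGen k i * y) := by
  simp [koszulOp]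

/-- The terms indexed by (i, l) and (l, i) cancel: the t commute and the y anticommute. -/
theorem koszulOp_comp_self {t : Fin m → M →ₗ[k] M} (ht : ∀ i l x, t i (t l x) = t l (t i x)) :
    koszulOp t ∘ₗ koszulOp t = 0 := by
  refine TensorProduct.ext' fun x y => ?_
  simp only [LinearMap.comp_apply, koszulOp_tmul, map_sum, LinearMap.zero_apply]
  rw [← Finset.sum_product']
  refine Finset.sum_involution (fun p _ => (p.2, p.1)) ?_ ?_ ?_ ?_
  · rintro ⟨i, l⟩ _
    simp only [← mul_assoc]
    rw [ht l i, ← TensorProduct.tmul_add, ← add_mul, yGen_mul_comm k l i, neg_add_cancel, zero_mul,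
      TensorProduct.tmul_zero]
  · rintro ⟨i, l⟩ _ hne heq
    simp only [Prod.mk.injEq] at heq
    obtain ⟨rfl, -⟩ := heq
    refine hne ?_
    simp only [← mul_assoc, yGen_mul_self, zero_mul, TensorProduct.tmul_zero]
  · simp
  · simp

/-- The operator `1 - (∂h + h∂)`, where `∂` is the Koszul differential and `h` is the homotopy given
by an operator `s` of `M` and the contraction with the `i`-th coordinate. -/
def koszulProj (t : Fin m → M →ₗ[k] M) (s : M →ₗ[k] M) (i : Fin m) :
    M ⊗[k] ExtCoalg k m →ₗ[k] M ⊗[k] ExtCoalg k m :=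
  LinearMap.id - (koszulOp t ∘ₗ TensorProduct.map s (yContr k i) +
    TensorProduct.map s (yContr k i) ∘ₗ koszulOp t)

/-- For l ≠ i the two contributions of y_l differ by a sign, since ι_i and y_l anticommute and s
commutes with t_l. In the remaining term, y_i ι_i is the identity on y_J if i ∈ J and zero
otherwise, and ι_i y_i is complementary to it. -/
theorem koszulProj_apply (t : Fin m → M →ₗ[k] M) (s : M →ₗ[k] M) (i : Fin m)
    (hs : ∀ l, l ≠ i → ∀ x, t l (s x) = s (t l x)) (x : M) (J : Finset (Fin m)) :
    koszulProj t s i (x ⊗ₜ yMono k J) =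
      (x - if i ∈ J then t i (s x) else s (t i x)) ⊗ₜ yMono k J := by
  have h1 : (koszulOp t ∘ₗ TensorProduct.map s (yContr k i) +
      TensorProduct.map s (yContr k i) ∘ₗ koszulOp t) (x ⊗ₜ yMono k J) =
      (if i ∈ J then t i (s x) else s (t i x)) ⊗ₜ yMono k J := by
    simp only [LinearMap.add_apply, LinearMap.comp_apply, TensorProduct.map_tmul, koszulOp_tmul,
      map_sum]
    rw [← Finset.sum_add_distrib, Finset.sum_eq_single i]
    · rw [yContr_yGen_mul, if_pos rfl, yGen_mul_yContr_yMono]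
      split_ifs with h
      · simp
      · simp
    · intro l _ hl
      rw [yContr_yGen_mul, if_neg hl.symm, zero_sub, hs l hl, ← TensorProduct.tmul_add,
        add_neg_cancel, TensorProduct.tmul_zero]
    · simp
  rw [koszulProj, LinearMap.sub_apply, h1, LinearMap.id_apply, TensorProduct.sub_tmul]

theorem koszulProj_list_cycle {t : Fin m → M →ₗ[k] M}
    (ht : ∀ i l x, t i (t l x) = t l (t i x)) (s : Fin m → M →ₗ[k] M) (L : List (Fin m))
    {z : M ⊗[k] ExtCoalg k m} (hz : koszulOp t z = 0) :
    ∃ w, koszulOp t w = z - (L.map fun i => koszulProj t (s i) i).prod z := by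
  -- The induction has to carry along that the image is again a cycle: only on cycles does each
  -- factor amount to subtracting a boundary.
  suffices h : koszulOp t ((L.map fun i => koszulProj t (s i) i).prod z) = 0 ∧
      ∃ w, koszulOp t w = z - (L.map fun i => koszulProj t (s i) i).prod z from h.2
  have hD := koszulOp_comp_self ht
  induction L with
  | nil => exact ⟨by simpa using hz, 0, by simp⟩
  | cons i L ih =>
    obtain ⟨h1, w, hw⟩ := ih
    rw [List.map_cons, List.prod_cons, Module.End.mul_apply]
    set x := (L.map fun i => koszulProj t (s i) i).prod z
    have hx : koszulProj t (s i) i x =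
        x - koszulOp t (TensorProduct.map (s i) (yContr k i) x) := by
      simp [koszulProj, h1]
    rw [hx]
    refine ⟨?_, w + TensorProduct.map (s i) (yContr k i) x, ?_⟩
    · rw [map_sub, h1, ← LinearMap.comp_apply (koszulOp t), hD, LinearMap.zero_apply, sub_zero]
    · rw [map_add, hw]; abel

theorem koszulOp_comp_koszulProj {t : Fin m → M →ₗ[k] M}
    (ht : ∀ i l x, t i (t l x) = t l (t i x)) (s : M →ₗ[k] M) (i : Fin m)
    (z : M ⊗[k] ExtCoalg k m) :
    koszulOp t (koszulProj t s i z) = koszulProj t s i (koszulOp t z) := by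
  have hD := fun z => LinearMap.congr_fun (koszulOp_comp_self ht) z
  simp only [LinearMap.comp_apply, LinearMap.zero_apply] at hD
  simp [koszulProj, hD]

theorem koszulOp_comp_koszulProj_list {t : Fin m → M →ₗ[k] M}
    (ht : ∀ i l x, t i (t l x) = t l (t i x)) (s : Fin m → M →ₗ[k] M) (L : List (Fin m))
    (z : M ⊗[k] ExtCoalg k m) :
    koszulOp t ((L.map fun i => koszulProj t (s i) i).prod z) =
      (L.map fun i => koszulProj t (s i) i).prod (koszulOp t z) := by
  induction L with
  | nil => simp
  | cons i L ih =>
    rw [List.map_cons, List.prod_cons, Module.End.mul_apply, Module.End.mul_apply,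
      koszulOp_comp_koszulProj ht, ih]

/-- If the operators `koszulProj` fix or annihilate a tensor, so does their product. -/
theorem koszulProj_list_apply (t s : Fin m → M →ₗ[k] M) (L : List (Fin m)) (P : Fin m → Prop)
    [DecidablePred P] {z : M ⊗[k] ExtCoalg k m}
    (h : ∀ i, koszulProj t (s i) i z = if P i then z else 0) :
    (L.map fun i => koszulProj t (s i) i).prod z = if ∀ i ∈ L, P i then z else 0 := by
  induction L with
  | nil => simp
  | cons i L ih =>
    rw [List.map_cons, List.prod_cons, Module.End.mul_apply, ih, apply_ite (koszulProj t (s i) i),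
      h, map_zero]
    simp only [List.mem_cons, forall_eq_or_imp]
    split_ifs <;> tauto

end KoszulOperator

/-! ### Subquotients of a module -/

section Subquotient

variable {k : Type u} [CommRing k] {M : Type u} [AddCommGroup M] [Module k M]

/-- The quotient of a submodule `Z` by (its intersection with) a submodule `N`. -/
abbrev Subquot (Z N : Submodule k M) : Type u := ↥Z ⧸ N.submoduleOf Z

/-- A surjection from a submodule `W` onto `Z` induces an isomorphism of `W / f⁻¹(N)` with
`Z / N`. -/
theorem Subquot.nonempty_equiv_of_surjective {M' : Type u} [AddCommGroup M'] [Module k M']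
    (f : M' →ₗ[k] M) {W U : Submodule k M'} {Z N : Submodule k M} (hW : W.map f = Z)
    (hU : ∀ w ∈ W, w ∈ U ↔ f w ∈ N) : Nonempty (Subquot W U ≃ₗ[k] Subquot Z N) := by
  have hWZ : ∀ w ∈ W, f w ∈ Z := fun w hw => hW ▸ Submodule.mem_map_of_mem hw
  let g : W →ₗ[k] Subquot Z N := (N.submoduleOf Z).mkQ ∘ₗ f.restrict hWZ
  have hg : Function.Surjective g := by
    rintro ⟨⟨z, hz⟩⟩
    obtain ⟨w, hw, rfl⟩ := hW.symm ▸ hz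
    exact ⟨⟨w, hw⟩, rfl⟩
  have hk : LinearMap.ker g = U.submoduleOf W := by
    ext ⟨w, hw⟩
    exact (Submodule.Quotient.mk_eq_zero _).trans (hU w hw).symm
  exact ⟨(Submodule.quotEquivOfEq _ _ hk.symm).trans (g.quotKerEquivOfSurjective hg)⟩

theorem Subquot.nonempty_equiv_of_eq {Z Z' N N' : Submodule k M} (hZ : Z = Z') (hN : N = N') :
    Nonempty (Subquot Z N ≃ₗ[k] Subquot Z' N') := by
  subst hZ hN
  exact ⟨LinearEquiv.refl _ _⟩

end Subquotient

/-! ### Gradings described by families of projections -/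

section Grading

variable {k : Type u} [CommRing k] {M : Type u} [AddCommGroup M] [Module k M] {ι : Type*}

/-- `π` is the family of projections of a grading `S` of a module. -/
structure IsProjFamily (S : ι → Submodule k M) (π : ι → M →ₗ[k] M) : Prop where
  mem : ∀ i x, π i x ∈ S i
  fix : ∀ i, ∀ x ∈ S i, π i x = x
  kill : ∀ i j, i ≠ j → ∀ x ∈ S i, π j x = 0
  iSup_eq_top : ⨆ i, S i = ⊤

namespace IsProjFamily

variable {S : ι → Submodule k M} {π : ι → M →ₗ[k] M}

theorem exists_sum (h : IsProjFamily S π) (z : M) : ∃ s : Finset ι, ∑ i ∈ s, π i z = z := by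
  classical
  -- The claim for all larger index sets is stable under addition: for a sum of two elements the
  -- union of their index sets works.
  suffices hs : ∃ s : Finset ι, ∀ s', s ⊆ s' → ∑ i ∈ s', π i z = z from
    hs.imp fun s hs => hs s subset_rfl
  have hz : z ∈ ⨆ i, S i := h.iSup_eq_top ▸ Submodule.mem_top
  induction hz using Submodule.iSup_induction' with
  | mem i x hx =>
    refine ⟨{i}, fun s' hs' => ?_⟩
    rw [Finset.sum_eq_single i, h.fix i x hx]
    · exact fun j _ hj => h.kill i j hj.symm x hx
    · exact fun hi => absurd (hs' (Finset.mem_singleton_self i)) hi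
  | zero => exact ⟨∅, by simp⟩
  | add x y _ _ hx hy =>
    obtain ⟨s, hs⟩ := hx
    obtain ⟨s', hs'⟩ := hy
    refine ⟨s ∪ s', fun t ht => ?_⟩
    simp only [map_add, Finset.sum_add_distrib]
    rw [hs t (Finset.union_subset_left ht), hs' t (Finset.union_subset_right ht)]

theorem isInternal [DecidableEq ι] (h : IsProjFamily S π) : DirectSum.IsInternal S := by
  have hc : ∀ j, π j ∘ₗ DirectSum.coeLinearMap S =
      (S j).subtype ∘ₗ DirectSum.component k ι (fun i => S i) j := fun j => by
    refine DirectSum.linearMap_ext k fun i => LinearMap.ext fun x => ?_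
    simp only [LinearMap.comp_apply, DirectSum.coeLinearMap_lof, Submodule.subtype_apply]
    by_cases hij : i = j
    · subst hij
      rw [DirectSum.component.lof_self, h.fix _ _ x.2]
    · rw [DirectSum.component.of, dif_neg (fun h => hij h), h.kill i j hij _ x.2]
      rfl
  constructor
  · refine (injective_iff_map_eq_zero (DirectSum.coeAddMonoidHom S)).2 fun f hf => ?_
    refine DirectSum.ext fun j => Subtype.ext ?_
    have := LinearMap.congr_fun (hc j) f
    have hf' : DirectSum.coeLinearMap S f = 0 := hf
    rw [LinearMap.comp_apply, hf', map_zero] at this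
    exact this.symm
  · intro z
    obtain ⟨s, hs⟩ := h.exists_sum z
    refine ⟨∑ i ∈ s, DirectSum.of (fun i => S i) i ⟨π i z, h.mem i z⟩, ?_⟩
    rw [map_sum]
    simpa only [DirectSum.coeAddMonoidHom_of] using hs

theorem of_isInternal [DecidableEq ι] (h : DirectSum.IsInternal S) :
    ∃ π : ι → M →ₗ[k] M, IsProjFamily S π := by
  let E := LinearEquiv.ofBijective (DirectSum.coeLinearMap S) h
  have hE : ∀ i (x : M) (hx : x ∈ S i), E.symm x = DirectSum.lof k ι (fun i => S i) i ⟨x, hx⟩ :=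
    fun i x hx => by
      rw [LinearEquiv.symm_apply_eq]
      exact (DirectSum.coeLinearMap_lof S i ⟨x, hx⟩).symm
  refine ⟨fun i => (S i).subtype ∘ₗ DirectSum.component k ι (fun i => S i) i ∘ₗ
    E.symm.toLinearMap, fun i x => Subtype.mem _, fun i x hx => ?_, fun i j hij x hx => ?_,
    h.submodule_iSup_eq_top⟩
  · simp only [LinearMap.comp_apply, LinearEquiv.coe_coe, hE i x hx, DirectSum.component.lof_self,
      Submodule.subtype_apply]
  · simp only [LinearMap.comp_apply, LinearEquiv.coe_coe, hE i x hx]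
    rw [DirectSum.component.of, dif_neg (fun h => hij h)]
    rfl

theorem linearMap_ext (h : IsProjFamily S π) {M' : Type*} [AddCommGroup M'] [Module k M']
    {f g : M →ₗ[k] M'} (hfg : ∀ i, ∀ x ∈ S i, f x = g x) (z : M) : f z = g z := by
  obtain ⟨s, hs⟩ := h.exists_sum z
  rw [← hs, map_sum, map_sum]
  exact Finset.sum_congr rfl fun i _ => hfg i _ (h.mem i z)

/-- The quotient of homogeneous submodules of a graded module is the direct sum of the quotients of
their homogeneous parts. -/
theorem nonempty_subquot_equiv [DecidableEq ι] (h : IsProjFamily S π) {Z N : Submodule k M}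
    (hZ : ∀ i, ∀ x ∈ Z, π i x ∈ Z) (hN : ∀ i, ∀ x ∈ N, π i x ∈ N) :
    Nonempty (Subquot Z N ≃ₗ[k] ⨁ i, Subquot (Z ⊓ S i) (N ⊓ S i)) := by
  let φ : ∀ i, Subquot (Z ⊓ S i) (N ⊓ S i) →ₗ[k] Subquot Z N := fun i =>
    Submodule.mapQ _ _ (Submodule.inclusion inf_le_left) fun x hx => hx.1
  let ρ : ∀ i, Subquot Z N →ₗ[k] Subquot (Z ⊓ S i) (N ⊓ S i) := fun i =>
    Submodule.mapQ _ _ ((π i).restrict fun x hx => ⟨hZ i x hx, h.mem i x⟩)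
      fun x hx => ⟨hN i _ hx, h.mem i _⟩
  let Φ := DirectSum.toModule k ι (Subquot Z N) φ
  -- The maps induced by the projections recover the components, which gives the injectivity of Φ.
  have hρ : ∀ j, ρ j ∘ₗ Φ = DirectSum.component k ι (fun i => Subquot (Z ⊓ S i) (N ⊓ S i)) j := by
    refine fun j => DirectSum.linearMap_ext k fun i => LinearMap.ext fun q => ?_
    obtain ⟨⟨x, hx⟩, rfl⟩ := Submodule.Quotient.mk_surjective _ q
    simp only [LinearMap.comp_apply, Φ, DirectSum.toModule_lof]
    by_cases hij : i = j
    · subst hij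
      rw [DirectSum.component.lof_self]
      exact congrArg (Submodule.Quotient.mk) (Subtype.ext (h.fix i x hx.2))
    · rw [DirectSum.component.of, dif_neg (fun h => hij h)]
      have : (⟨π j x, hZ j x hx.1, h.mem j x⟩ : ↥(Z ⊓ S j)) = 0 :=
        Subtype.ext (h.kill i j hij x hx.2)
      exact (congrArg (Submodule.Quotient.mk) this).trans (Submodule.Quotient.mk_zero _)
  refine ⟨(LinearEquiv.ofBijective Φ ⟨?_, ?_⟩).symm⟩
  · intro f g hfg
    refine DFinsupp.ext fun j => ?_
    have h1 := LinearMap.congr_fun (hρ j) f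
    have h2 := LinearMap.congr_fun (hρ j) g
    rw [LinearMap.comp_apply] at h1 h2
    exact (h1.symm.trans (congrArg (ρ j) hfg)).trans h2
  · rintro ⟨⟨z, hz⟩⟩
    obtain ⟨s, hs⟩ := h.exists_sum z
    refine ⟨∑ i ∈ s, DirectSum.lof k ι _ i
      (Submodule.Quotient.mk ⟨π i z, hZ i z hz, h.mem i z⟩), ?_⟩
    simp only [map_sum, Φ, DirectSum.toModule_lof]
    change ∑ i ∈ s, (N.submoduleOf Z).mkQ ⟨π i z, hZ i z hz⟩ = (N.submoduleOf Z).mkQ ⟨z, hz⟩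
    rw [← map_sum]
    congr 1
    exact Subtype.ext (by simpa using hs)

end IsProjFamily

/-- The projection of a module with a basis onto the span of the basis elements with index in `s`. -/
def basisProj (b : Module.Basis ι k M) (s : Set ι) : M →ₗ[k] M :=
  open Classical in b.constr k fun i => if i ∈ s then b i else 0

theorem basisProj_basis_of_mem (b : Module.Basis ι k M) {s : Set ι} {i : ι} (hi : i ∈ s) :
    basisProj b s (b i) = b i := by
  rw [basisProj, Module.Basis.constr_basis, if_pos hi]

theorem basisProj_basis_of_notMem (b : Module.Basis ι k M) {s : Set ι} {i : ι} (hi : i ∉ s) :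
    basisProj b s (b i) = 0 := by
  rw [basisProj, Module.Basis.constr_basis, if_neg hi]

theorem basisProj_mem (b : Module.Basis ι k M) (s : Set ι) (x : M) :
    basisProj b s x ∈ Submodule.span k (b '' s) := by
  suffices h : LinearMap.range (basisProj b s) ≤ Submodule.span k (b '' s) from h ⟨x, rfl⟩
  rw [LinearMap.range_eq_map, ← b.span_eq, Submodule.map_span, Submodule.span_le]
  rintro _ ⟨_, ⟨i, rfl⟩, rfl⟩
  by_cases hi : i ∈ s
  · rw [basisProj_basis_of_mem b hi]
    exact Submodule.subset_span ⟨i, hi, rfl⟩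
  · rw [basisProj_basis_of_notMem b hi]
    exact Submodule.zero_mem _

theorem basisProj_mem_span (b : Module.Basis ι k M) (s t : Set ι) {x : M}
    (hx : x ∈ Submodule.span k (b '' t)) : basisProj b s x ∈ Submodule.span k (b '' t) := by
  suffices h : Submodule.span k (b '' t) ≤ (Submodule.span k (b '' t)).comap (basisProj b s) from
    h hx
  rw [Submodule.span_le]
  rintro _ ⟨i, hi, rfl⟩
  rw [SetLike.mem_coe, Submodule.mem_comap]
  by_cases his : i ∈ s
  · rw [basisProj_basis_of_mem b his]
    exact Submodule.subset_span ⟨i, hi, rfl⟩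
  · rw [basisProj_basis_of_notMem b his]
    exact Submodule.zero_mem _

theorem isProjFamily_basisProj (b : Module.Basis ι k M) {κ : Type*} (deg : ι → κ) :
    IsProjFamily (fun d => Submodule.span k (b '' {i | deg i = d}))
      fun d => basisProj b {i | deg i = d} where
  mem d x := basisProj_mem b _ x
  fix d x hx := by
    refine LinearMap.eqOn_span (f := basisProj b {i | deg i = d}) (g := LinearMap.id) ?_ hx
    rintro _ ⟨i, hi, rfl⟩
    exact basisProj_basis_of_mem b hi
  kill d d' hd x hx := by
    refine LinearMap.eqOn_span (f := basisProj b {i | deg i = d'}) (g := 0) ?_ hx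
    rintro _ ⟨i, hi, rfl⟩
    exact basisProj_basis_of_notMem b fun h => hd (hi.symm.trans h)
  iSup_eq_top := by
    rw [eq_top_iff, ← b.span_eq, Submodule.span_le]
    rintro _ ⟨i, rfl⟩
    exact Submodule.mem_iSup_of_mem (deg i) (Submodule.subset_span ⟨i, rfl, rfl⟩)

end Grading

/-! ### The staircase argument in a double complex -/

section DoubleComplex

variable {k : Type u} [CommRing k]

/-- The image under `D` of the preceding term of a complex, where `S n` is the term in
degree `n`. -/
def prevImage {M : Type u} [AddCommGroup M] [Module k M] (D : M →ₗ[k] M)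
    (S : ℕ → Submodule k M) : ℕ → Submodule k M
  | 0 => ⊥
  | n + 1 => (S n).map D

/-- The image under `d` of the preceding term of a complex, where the terms are submodules of
different modules. -/
def prevRange {M : ℕ → Type u} [∀ p, AddCommGroup (M p)] [∀ p, Module k (M p)]
    (d : ∀ p, M p →ₗ[k] M (p + 1)) (S : ∀ p, Submodule k (M p)) : ∀ p, Submodule k (M p)
  | 0 => ⊥
  | p + 1 => (S p).map (d p)

/-- A first quadrant double complex with the terms `S p n ⊆ M p`, whose rows are resolutions of the
terms `T n` of a complex in `A` and whose columns are exact in positive degrees. -/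
structure IsResolvingDoubleComplex {A : Type u} [AddCommGroup A] [Module k A]
    (T : ℕ → Submodule k A) (D₀ : A →ₗ[k] A)
    {M : ℕ → Type u} [∀ p, AddCommGroup (M p)] [∀ p, Module k (M p)] (aug : A →ₗ[k] M 0)
    (S : ∀ p, ℕ → Submodule k (M p)) (d : ∀ p, M p →ₗ[k] M (p + 1))
    (D : ∀ p, M p →ₗ[k] M p) : Prop where
  aug_injective : Function.Injective aug
  aug_mem : ∀ n, ∀ x ∈ T n, aug x ∈ S 0 n
  aug_comm : ∀ x, aug (D₀ x) = D 0 (aug x)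
  d_aug : ∀ x, d 0 (aug x) = 0
  d_mem : ∀ p n, ∀ x ∈ S p n, d p x ∈ S (p + 1) n
  d_comm : ∀ p x, d p (D p x) = D (p + 1) (d p x)
  d_d : ∀ p x, d (p + 1) (d p x) = 0
  D_mem : ∀ p n, ∀ x ∈ S p n, D p x ∈ S p (n + 1)
  D_D : ∀ p x, D p (D p x) = 0
  row_exact_zero : ∀ n, ∀ z ∈ S 0 n, d 0 z = 0 → ∃ w ∈ T n, aug w = z
  row_exact : ∀ p n, ∀ z ∈ S (p + 1) n, d (p + 1) z = 0 → ∃ w ∈ S p n, d p w = z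
  col_exact : ∀ p n, ∀ z ∈ S p (n + 1), D p z = 0 → ∃ w ∈ S p n, D p w = z

namespace IsResolvingDoubleComplex

variable {A : Type u} [AddCommGroup A] [Module k A] {T : ℕ → Submodule k A} {D₀ : A →ₗ[k] A}
  {M : ℕ → Type u} [∀ p, AddCommGroup (M p)] [∀ p, Module k (M p)] {aug : A →ₗ[k] M 0}
  {S : ∀ p, ℕ → Submodule k (M p)} {d : ∀ p, M p →ₗ[k] M (p + 1)} {D : ∀ p, M p →ₗ[k] M p}

/-- Both sides are the quotient of W = {w ∈ S p n | d(Dw) = 0} by U, the sum of the kernels of d and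
D in S p n. Exactness of the column makes D a surjection of W onto the first numerator, exactness of
the row makes d a surjection of W onto the second one, and within W the preimage of either
denominator is U. -/
theorem nonempty_equiv_step (h : IsResolvingDoubleComplex T D₀ aug S d D) (p n : ℕ) :
    Nonempty (Subquot (S p (n + 1) ⊓ LinearMap.ker (d p) ⊓ LinearMap.ker (D p))
        ((S p n ⊓ LinearMap.ker (d p)).map (D p)) ≃ₗ[k]
      Subquot (S (p + 1) n ⊓ LinearMap.ker (d (p + 1)) ⊓ LinearMap.ker (D (p + 1)))
        ((S p n ⊓ LinearMap.ker (D p)).map (d p))) := by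
  let W : Submodule k (M p) := S p n ⊓ LinearMap.ker (d p ∘ₗ D p)
  let U : Submodule k (M p) := (S p n ⊓ LinearMap.ker (d p)) ⊔ (S p n ⊓ LinearMap.ker (D p))
  obtain ⟨e⟩ := Subquot.nonempty_equiv_of_surjective (D p) (W := W) (U := U)
    (Z := S p (n + 1) ⊓ LinearMap.ker (d p) ⊓ LinearMap.ker (D p))
    (N := (S p n ⊓ LinearMap.ker (d p)).map (D p)) (by
      ext z
      constructor
      · rintro ⟨w, ⟨hw1, hw2⟩, rfl⟩
        exact ⟨⟨h.D_mem p n w hw1, hw2⟩, h.D_D p w⟩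
      · rintro ⟨⟨h1, h2⟩, h3⟩
        obtain ⟨w, hw, rfl⟩ := h.col_exact p n z h1 h3
        exact ⟨w, ⟨hw, h2⟩, rfl⟩) (by
      rintro w ⟨hw, -⟩
      constructor
      · intro hU
        obtain ⟨a, ha, b, hb, rfl⟩ := Submodule.mem_sup.1 hU
        exact ⟨a, ha, by rw [map_add, LinearMap.mem_ker.1 hb.2, add_zero]⟩
      · rintro ⟨a, ha, hwa⟩
        exact Submodule.mem_sup.2 ⟨a, ha, w - a, ⟨Submodule.sub_mem _ hw ha.1, by
          rw [SetLike.mem_coe, LinearMap.mem_ker, map_sub, hwa, sub_self]⟩, by abel⟩)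
  obtain ⟨e'⟩ := Subquot.nonempty_equiv_of_surjective (d p) (W := W) (U := U)
    (Z := S (p + 1) n ⊓ LinearMap.ker (d (p + 1)) ⊓ LinearMap.ker (D (p + 1)))
    (N := (S p n ⊓ LinearMap.ker (D p)).map (d p)) (by
      ext z
      constructor
      · rintro ⟨w, ⟨hw1, hw2⟩, rfl⟩
        refine ⟨⟨h.d_mem p n w hw1, h.d_d p w⟩, ?_⟩
        rw [SetLike.mem_coe, LinearMap.mem_ker, ← h.d_comm]
        exact hw2
      · rintro ⟨⟨h1, h2⟩, h3⟩
        obtain ⟨w, hw, rfl⟩ := h.row_exact p n z h1 h2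
        refine ⟨w, ⟨hw, ?_⟩, rfl⟩
        rw [SetLike.mem_coe, LinearMap.mem_ker, LinearMap.comp_apply, h.d_comm]
        exact h3) (by
      rintro w ⟨hw, -⟩
      constructor
      · intro hU
        obtain ⟨a, ha, b, hb, rfl⟩ := Submodule.mem_sup.1 hU
        exact ⟨b, hb, by rw [map_add, LinearMap.mem_ker.1 ha.2, zero_add]⟩
      · rintro ⟨b, hb, hwb⟩
        exact Submodule.mem_sup.2 ⟨w - b, ⟨Submodule.sub_mem _ hw hb.1, by
          rw [SetLike.mem_coe, LinearMap.mem_ker, map_sub, hwb, sub_self]⟩, b, hb, by abel⟩)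
  exact ⟨e.symm.trans e'⟩

/-- Both sides are the image of S p n under dD = Dd, by exactness of the column and of the row.
Hence the target of one step of the staircase is the source of the next. -/
theorem map_ker_eq (h : IsResolvingDoubleComplex T D₀ aug S d D) (p n : ℕ) :
    (S p (n + 1) ⊓ LinearMap.ker (D p)).map (d p) =
      (S (p + 1) n ⊓ LinearMap.ker (d (p + 1))).map (D (p + 1)) := by
  ext x
  constructor
  · rintro ⟨w, ⟨hw1, hw2⟩, rfl⟩
    obtain ⟨v, hv, rfl⟩ := h.col_exact p n w hw1 hw2
    exact ⟨d p v, ⟨h.d_mem p n v hv, h.d_d p v⟩, (h.d_comm p v).symm⟩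
  · rintro ⟨w, ⟨hw1, hw2⟩, rfl⟩
    obtain ⟨v, hv, rfl⟩ := h.row_exact p n w hw1 hw2
    exact ⟨D p v, ⟨h.D_mem p n v hv, h.D_D p v⟩, h.d_comm p v⟩

/-- The steps descend along an antidiagonal until the second index is 0, where the denominator is
that of the edge complex. The equation q = p + n is a hypothesis so that no transport between M (p +
1 + n) and M (p + (n + 1)) arises. -/
theorem nonempty_equiv_diagonal (h : IsResolvingDoubleComplex T D₀ aug S d D) (n : ℕ) :
    ∀ p q, q = p + n →
      Nonempty (Subquot (S p (n + 1) ⊓ LinearMap.ker (d p) ⊓ LinearMap.ker (D p))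
        ((S p n ⊓ LinearMap.ker (d p)).map (D p)) ≃ₗ[k]
      Subquot (S (q + 1) 0 ⊓ LinearMap.ker (d (q + 1)) ⊓ LinearMap.ker (D (q + 1)))
        ((S q 0 ⊓ LinearMap.ker (D q)).map (d q))) := by
  induction n with
  | zero =>
    intro p q hq
    obtain rfl : q = p := hq
    exact h.nonempty_equiv_step q 0
  | succ n ih =>
    intro p q hq
    obtain ⟨e⟩ := h.nonempty_equiv_step p (n + 1)
    obtain ⟨e'⟩ := ih (p + 1) q (by omega)
    rw [h.map_ker_eq] at e
    exact ⟨e.trans e'⟩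

/-- Both edges of the double complex have the same cohomology. -/
theorem nonempty_equiv (h : IsResolvingDoubleComplex T D₀ aug S d D) (n : ℕ) :
    Nonempty (Subquot (T n ⊓ LinearMap.ker D₀) (prevImage D₀ T n) ≃ₗ[k]
      Subquot (S n 0 ⊓ LinearMap.ker (d n) ⊓ LinearMap.ker (D n))
        (prevRange d (fun p => S p 0 ⊓ LinearMap.ker (D p)) n)) := by
  -- Exactness at the start of the rows identifies the complex T with the kernel of d in the column
  -- p = 0, which is where the staircase begins.
  have hT : ∀ n, (T n).map aug = S 0 n ⊓ LinearMap.ker (d 0) := fun n => by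
    ext z
    constructor
    · rintro ⟨x, hx, rfl⟩
      exact ⟨h.aug_mem n x hx, h.d_aug x⟩
    · rintro ⟨h1, h2⟩
      exact h.row_exact_zero n z h1 h2
  have hZ : ∀ n, (T n ⊓ LinearMap.ker D₀).map aug =
      S 0 n ⊓ LinearMap.ker (d 0) ⊓ LinearMap.ker (D 0) := fun n => by
    rw [← hT]
    ext z
    constructor
    · rintro ⟨x, ⟨hx, hx'⟩, rfl⟩
      refine ⟨⟨x, hx, rfl⟩, ?_⟩
      rw [SetLike.mem_coe, LinearMap.mem_ker, ← h.aug_comm, LinearMap.mem_ker.1 hx', map_zero]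
    · rintro ⟨⟨x, hx, rfl⟩, hx'⟩
      rw [SetLike.mem_coe, LinearMap.mem_ker, ← h.aug_comm, map_eq_zero_iff _ h.aug_injective] at hx'
      exact ⟨x, ⟨hx, hx'⟩, rfl⟩
  cases n with
  | zero =>
    -- In degree 0 both denominators are zero and no staircase is needed.
    refine Subquot.nonempty_equiv_of_surjective aug (hZ 0) fun w _ => ?_
    change w ∈ (⊥ : Submodule k A) ↔ aug w ∈ (⊥ : Submodule k (M 0))
    rw [Submodule.mem_bot, Submodule.mem_bot, map_eq_zero_iff _ h.aug_injective]
  | succ n =>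
    obtain ⟨e⟩ := Subquot.nonempty_equiv_of_surjective aug (hZ (n + 1))
      (U := prevImage D₀ T (n + 1)) (N := (S 0 n ⊓ LinearMap.ker (d 0)).map (D 0)) fun w _ => by
        rw [← hT]
        constructor
        · rintro ⟨x, hx, rfl⟩
          exact ⟨aug x, ⟨x, hx, rfl⟩, (h.aug_comm x).symm⟩
        · rintro ⟨_, ⟨x, hx, rfl⟩, hw⟩
          rw [← h.aug_comm] at hw
          exact ⟨x, hx, h.aug_injective hw⟩
    obtain ⟨e'⟩ := h.nonempty_equiv_diagonal n 0 n (by omega)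
    exact ⟨e.trans e'⟩

end IsResolvingDoubleComplex

end DoubleComplex

/-! ### Homology of complexes of modules as subquotients -/

section Homology

variable {k : Type u} [CommRing k] {M : Type u} [AddCommGroup M] [Module k M]

/-- Moving homology into an ambient module M turns later comparisons of complexes into equalities of
submodules of M. -/
theorem nonempty_shortComplex_homology_equiv (S : ShortComplex (ModuleCat.{u} k))
    (f : S.X₂ →ₗ[k] M) (hf : Function.Injective f) {Z N : Submodule k M}
    (hZ : (LinearMap.ker S.g.hom).map f = Z) (hN : (LinearMap.range S.f.hom).map f = N) :
    Nonempty (S.homology ≃ₗ[k] Subquot Z N) := by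
  let e := S.moduleCatHomologyIso.toLinearEquiv
  obtain ⟨e'⟩ := Subquot.nonempty_equiv_of_surjective f hZ (U := LinearMap.range S.f.hom)
    (N := N) fun w _ => by
      rw [← hN]
      exact (hf.mem_set_image (s := (LinearMap.range S.f.hom : Set S.X₂))).symm
  refine ⟨e.trans (LinearEquiv.trans (Submodule.quotEquivOfEq _ _ ?_) e')⟩
  ext ⟨x, hx⟩
  constructor
  · rintro ⟨y, hy⟩
    exact ⟨y, congrArg Subtype.val hy⟩
  · rintro ⟨y, hy⟩
    exact ⟨y, Subtype.ext hy⟩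

theorem nonempty_cochain_homology_equiv (C : CochainComplex (ModuleCat.{u} k) ℕ) (n : ℕ)
    (f : C.X n →ₗ[k] M) (hf : Function.Injective f) {Z N : Submodule k M}
    (hZ : (LinearMap.ker (C.d n (n + 1)).hom).map f = Z)
    (hN₀ : n = 0 → N = ⊥)
    (hN : ∀ l, l + 1 = n → (LinearMap.range (C.d l n).hom).map f = N) :
    Nonempty (C.homology n ≃ₗ[k] Subquot Z N) := by
  obtain _ | n := n
  · obtain ⟨e⟩ := nonempty_shortComplex_homology_equiv (C.sc' 0 0 1) f hf hZ (N := N) (by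
      -- In degree 0 the index preceding 0 is by convention 0 itself, and the corresponding
      -- differential vanishes.
      have : C.d 0 0 = 0 := C.shape _ _ (by simp)
      rw [hN₀ rfl]
      change (LinearMap.range (C.d 0 0).hom).map f = ⊥
      rw [this]
      simp)
    exact ⟨(C.homologyIsoSc' 0 0 1 (by simp) (by simp)).toLinearEquiv.trans e⟩
  · obtain ⟨e⟩ := nonempty_shortComplex_homology_equiv (C.sc' n (n + 1) (n + 1 + 1)) f hf hZ
      (hN n rfl)
    exact ⟨(C.homologyIsoSc' n (n + 1) (n + 1 + 1) (by simp) (by simp)).toLinearEquiv.trans e⟩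

theorem nonempty_chain_homology_equiv (C : ChainComplex (ModuleCat.{u} k) ℕ) (q : ℕ)
    (f : C.X q →ₗ[k] M) (hf : Function.Injective f) {Z N : Submodule k M}
    (hN : (LinearMap.range (C.d (q + 1) q).hom).map f = N)
    (hZ₀ : q = 0 → Z = LinearMap.range f)
    (hZ : ∀ l, l + 1 = q → (LinearMap.ker (C.d q l).hom).map f = Z) :
    Nonempty (C.homology q ≃ₗ[k] Subquot Z N) := by
  obtain _ | q := q
  · obtain ⟨e⟩ := nonempty_shortComplex_homology_equiv (C.sc' 1 0 0) f hf (Z := Z) (by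
      -- The outgoing differential in degree 0 is again the zero map from degree 0 to itself, so
      -- everything is a cycle.
      have : C.d 0 0 = 0 := C.shape _ _ (by simp)
      rw [hZ₀ rfl]
      change (LinearMap.ker (C.d 0 0).hom).map f = _
      rw [this]
      simp) hN
    exact ⟨(C.homologyIsoSc' 1 0 0 (by simp) (by simp)).toLinearEquiv.trans e⟩
  · obtain ⟨e⟩ := nonempty_shortComplex_homology_equiv (C.sc' (q + 1 + 1) (q + 1) q) f hf
      (hZ q rfl) hN
    exact ⟨(C.homologyIsoSc' (q + 1 + 1) (q + 1) q (by simp) (by simp)).toLinearEquiv.trans e⟩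

end Homology

/-! ### Coordinates in M ⊗ Λ and the parts G ⊗ Λ^n -/

section KoszulCoordinates

variable {k : Type u} [CommRing k] {m : ℕ} {M : Type u} [AddCommGroup M] [Module k M]

/-- The coordinates of an element of `M ⊗ Λ⟨y_1, …, y_m⟩` with respect to the exterior monomials. -/
def kCoord : M ⊗[k] ExtCoalg k m ≃ₗ[k] (Finset (Fin m) →₀ M) :=
  TensorProduct.equivFinsuppOfBasisRight (yBasis k m)

theorem kCoord_tmul (x : M) (J : Finset (Fin m)) :
    kCoord (x ⊗ₜ[k] yMono k J) = Finsupp.single J x := by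
  classical
  rw [kCoord, ← yBasis_apply, TensorProduct.equivFinsuppOfBasisRight_apply_tmul,
    Module.Basis.repr_self, Finsupp.mapRange_single, one_smul]

theorem sum_kCoord_tmul (z : M ⊗[k] ExtCoalg k m) : ∑ J, kCoord z J ⊗ₜ[k] yMono k J = z := by
  apply (kCoord (k := k) (m := m) (M := M)).injective
  rw [map_sum]
  simp only [kCoord_tmul]
  exact Finsupp.univ_sum_single _

theorem koszul_linearMap_ext {M' : Type*} [AddCommGroup M'] [Module k M']
    {f g : M ⊗[k] ExtCoalg k m →ₗ[k] M'}
    (h : ∀ x J, f (x ⊗ₜ yMono k J) = g (x ⊗ₜ yMono k J)) (z : M ⊗[k] ExtCoalg k m) :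
    f z = g z := by
  rw [← sum_kCoord_tmul z, map_sum, map_sum]
  exact Finset.sum_congr rfl fun J _ => h _ J

theorem kCoord_rTensor {M' : Type u} [AddCommGroup M'] [Module k M'] (f : M →ₗ[k] M')
    (z : M ⊗[k] ExtCoalg k m) (J : Finset (Fin m)) :
    kCoord (f.rTensor (ExtCoalg k m) z) J = f (kCoord z J) := by
  refine koszul_linearMap_ext
    (f := Finsupp.lapply J ∘ₗ kCoord.toLinearMap ∘ₗ f.rTensor (ExtCoalg k m))
    (g := f ∘ₗ Finsupp.lapply J ∘ₗ kCoord.toLinearMap) (fun x J' => ?_) z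
  classical
  simp only [LinearMap.comp_apply, LinearEquiv.coe_coe, LinearMap.rTensor_tmul, kCoord_tmul,
    Finsupp.lapply_apply, Finsupp.single_apply]
  split_ifs <;> simp

variable (m) in
/-- The submodule `G ⊗ Λ^n⟨y_1, …, y_m⟩` of `M ⊗ Λ⟨y_1, …, y_m⟩`. -/
def kSub (G : Submodule k M) (n : ℕ) : Submodule k (M ⊗[k] ExtCoalg k m) :=
  Submodule.map₂ (TensorProduct.mk k M (ExtCoalg k m)) G (⋀[k]^n (Fin m → k))

theorem yMono_mem {J : Finset (Fin m)} {n : ℕ} (hJ : #J = n) :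
    yMono k J ∈ ⋀[k]^n (Fin m → k) := by
  rw [exteriorPower_eq_span, ← yBasis_apply]
  exact Submodule.subset_span ⟨J, hJ, rfl⟩

theorem tmul_mem_kSub {G : Submodule k M} {n : ℕ} {x : M} (hx : x ∈ G) {J : Finset (Fin m)}
    (hJ : #J = n) : x ⊗ₜ[k] yMono k J ∈ kSub m G n :=
  Submodule.apply_mem_map₂ _ hx (yMono_mem hJ)

theorem kSub_eq_span (G : Submodule k M) (n : ℕ) :
    kSub m G n =
      Submodule.span k (Set.image2 (fun x J => x ⊗ₜ[k] yMono k J) (G : Set M) {J | #J = n}) := by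
  have h := Submodule.map₂_span_span k (TensorProduct.mk k M (ExtCoalg k m)) (G : Set M)
    (yBasis k m '' {J | #J = n})
  rw [← exteriorPower_eq_span, Submodule.span_eq] at h
  rw [kSub, h, Set.image2_image_right]
  simp only [yBasis_apply, TensorProduct.mk_apply]

/-- Freeness of Λ on the y_J reduces membership to a condition on each coordinate, for an arbitrary
submodule G. -/
theorem mem_kSub_iff {G : Submodule k M} {n : ℕ} {z : M ⊗[k] ExtCoalg k m} :
    z ∈ kSub m G n ↔ ∀ J, kCoord z J ∈ G ∧ (#J ≠ n → kCoord z J = 0) := by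
  classical
  constructor
  · intro hz J
    rw [kSub_eq_span] at hz
    induction hz using Submodule.span_induction with
    | mem z hz =>
      obtain ⟨x, hx, J', hJ', rfl⟩ := hz
      simp only [kCoord_tmul, Finsupp.single_apply]
      split_ifs with h
      · exact ⟨hx, fun hJ => absurd (h ▸ hJ') hJ⟩
      · exact ⟨G.zero_mem, fun _ => rfl⟩
    | zero => simp
    | add x y _ _ hx hy =>
      rw [map_add, Finsupp.add_apply]
      exact ⟨G.add_mem hx.1 hy.1, fun h => by rw [hx.2 h, hy.2 h, add_zero]⟩
    | smul r x _ hx =>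
      rw [map_smul, Finsupp.smul_apply]
      exact ⟨G.smul_mem r hx.1, fun h => by rw [hx.2 h, smul_zero]⟩
  · intro h
    rw [← sum_kCoord_tmul z]
    refine Submodule.sum_mem _ fun J _ => ?_
    by_cases hJ : #J = n
    · exact tmul_mem_kSub (h J).1 hJ
    · rw [(h J).2 hJ, TensorProduct.zero_tmul]
      exact Submodule.zero_mem _

theorem koszulOp_mem_kSub {t : Fin m → M →ₗ[k] M} {G G' : Submodule k M}
    (h : ∀ i, ∀ x ∈ G, t i x ∈ G') {n : ℕ} {z : M ⊗[k] ExtCoalg k m} (hz : z ∈ kSub m G n) :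
    koszulOp t z ∈ kSub m G' (n + 1) := by
  suffices hle : kSub m G n ≤ (kSub m G' (n + 1)).comap (koszulOp t) from hle hz
  rw [kSub, Submodule.map₂_le]
  intro x hx y hy
  rw [Submodule.mem_comap, TensorProduct.mk_apply, koszulOp_tmul]
  exact Submodule.sum_mem _ fun i _ =>
    Submodule.apply_mem_map₂ _ (h i x hx) (yGen_mul_mem k i hy)

theorem rTensor_mem_kSub {M' : Type u} [AddCommGroup M'] [Module k M'] {f : M →ₗ[k] M'}
    {G : Submodule k M} {G' : Submodule k M'} (h : ∀ x ∈ G, f x ∈ G') {n : ℕ}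
    {z : M ⊗[k] ExtCoalg k m} (hz : z ∈ kSub m G n) :
    f.rTensor (ExtCoalg k m) z ∈ kSub m G' n := by
  rw [mem_kSub_iff] at hz ⊢
  intro J
  rw [kCoord_rTensor]
  exact ⟨h _ (hz J).1, fun hJ => by rw [(hz J).2 hJ, map_zero]⟩

/-- Preimages are chosen coordinate by coordinate. This is how exactness of a resolution passes to
the rows of the double complex. -/
theorem exists_rTensor_eq {M' : Type u} [AddCommGroup M'] [Module k M'] {f : M →ₗ[k] M'}
    {G : Submodule k M} {G' : Submodule k M'} {n : ℕ} {z : M' ⊗[k] ExtCoalg k m}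
    (hz : z ∈ kSub m G' n) (h : ∀ J, ∃ x ∈ G, f x = kCoord z J) :
    ∃ w ∈ kSub m G n, f.rTensor (ExtCoalg k m) w = z := by
  choose x hx hfx using h
  refine ⟨∑ J with #J = n, x J ⊗ₜ yMono k J, Submodule.sum_mem _ fun J hJ =>
    tmul_mem_kSub (hx J) (Finset.mem_filter.1 hJ).2, ?_⟩
  rw [map_sum, Finset.sum_filter]
  conv_rhs => rw [← sum_kCoord_tmul z]
  refine Finset.sum_congr rfl fun J _ => ?_
  split_ifs with hJ
  · rw [LinearMap.rTensor_tmul, hfx]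
  · rw [(mem_kSub_iff.1 hz J).2 hJ, TensorProduct.zero_tmul]

theorem koszulOp_rTensor {M' : Type u} [AddCommGroup M'] [Module k M'] {f : M →ₗ[k] M'}
    {t : Fin m → M →ₗ[k] M} {t' : Fin m → M' →ₗ[k] M'} (h : ∀ i x, f (t i x) = t' i (f x))
    (z : M ⊗[k] ExtCoalg k m) :
    f.rTensor (ExtCoalg k m) (koszulOp t z) = koszulOp t' (f.rTensor (ExtCoalg k m) z) := by
  refine LinearMap.congr_fun (f := f.rTensor (ExtCoalg k m) ∘ₗ koszulOp t)
    (g := koszulOp t' ∘ₗ f.rTensor (ExtCoalg k m)) (TensorProduct.ext' fun x y => ?_) z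
  simp [koszulOp_tmul, h]

/-- The projection to the part with `n` factors `y_i`, combined with an endomorphism of `M`. -/
def kProj (π : M →ₗ[k] M) (n : ℕ) : M ⊗[k] ExtCoalg k m →ₗ[k] M ⊗[k] ExtCoalg k m :=
  TensorProduct.map π (basisProj (yBasis k m) {J | #J = n})

theorem kProj_tmul (π : M →ₗ[k] M) (n : ℕ) (x : M) (J : Finset (Fin m)) :
    kProj π n (x ⊗ₜ yMono k J) = if #J = n then π x ⊗ₜ yMono k J else 0 := by
  rw [kProj, TensorProduct.map_tmul, ← yBasis_apply]
  split_ifs with h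
  · rw [basisProj_basis_of_mem _ (show J ∈ {J | #J = n} from h)]
  · rw [basisProj_basis_of_notMem _ (show J ∉ {J | #J = n} from h), TensorProduct.tmul_zero]

theorem kProj_mem {π : M →ₗ[k] M} {G : Submodule k M} (h : ∀ x, π x ∈ G) (n : ℕ)
    (z : M ⊗[k] ExtCoalg k m) : kProj π n z ∈ kSub m G n := by
  rw [← sum_kCoord_tmul z, map_sum]
  refine Submodule.sum_mem _ fun J _ => ?_
  rw [kProj_tmul]
  split_ifs with hJ
  · exact tmul_mem_kSub (h _) hJ
  · exact Submodule.zero_mem _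

theorem kProj_fix {π : M →ₗ[k] M} {G : Submodule k M} (h : ∀ x ∈ G, π x = x) {n : ℕ}
    {z : M ⊗[k] ExtCoalg k m} (hz : z ∈ kSub m G n) : kProj π n z = z := by
  rw [mem_kSub_iff] at hz
  conv_rhs => rw [← sum_kCoord_tmul z]
  rw [← sum_kCoord_tmul z, map_sum, sum_kCoord_tmul]
  refine Finset.sum_congr rfl fun J _ => ?_
  rw [kProj_tmul]
  split_ifs with hJ
  · rw [h _ (hz J).1]
  · rw [(hz J).2 hJ, TensorProduct.zero_tmul]

/-- Each y_i raises the exterior degree by one. Two endomorphisms are needed because t_i may shift a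
grading of M, so that π and π' project onto different degrees. -/
theorem koszulOp_kProj {t : Fin m → M →ₗ[k] M} {π π' : M →ₗ[k] M}
    (h : ∀ i x, t i (π x) = π' (t i x)) (n : ℕ) (z : M ⊗[k] ExtCoalg k m) :
    koszulOp t (kProj π n z) = kProj π' (n + 1) (koszulOp t z) := by
  refine koszul_linearMap_ext (f := koszulOp t ∘ₗ kProj π n) (g := kProj π' (n + 1) ∘ₗ koszulOp t)
    (fun x J => ?_) z
  have hi : ∀ i, kProj π' (n + 1) (t i x ⊗ₜ (yGen k i * yMono k J)) =
      if #J = n then t i (π x) ⊗ₜ (yGen k i * yMono k J) else 0 := by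
    intro i
    by_cases hi : i ∈ J
    · simp [yGen_mul_yMono_of_mem k hi]
    · rw [yGen_mul_yMono k hi, TensorProduct.tmul_smul, TensorProduct.tmul_smul, map_smul,
        kProj_tmul, Finset.card_insert_of_notMem hi, h]
      simp only [Nat.add_right_cancel_iff, smul_ite, smul_zero]
  simp only [LinearMap.comp_apply, kProj_tmul, koszulOp_tmul, map_sum, hi]
  split_ifs <;> simp [koszulOp_tmul]

end KoszulCoordinates

/-! ### Cofree comodules -/

section CofreeComodule

variable {k : Type u} [CommRing k] {Λ : Type u} [AddCommGroup Λ] [Module k Λ] [Coalgebra k Λ]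

/-- The cofree right comodule `V ⊗ Λ`. -/
def cofreeComodule (V : Type u) [AddCommGroup V] [Module k V] (Λ : Type u) [AddCommGroup Λ]
    [Module k Λ] [Coalgebra k Λ] : RightComodule k Λ where
  carrier := V ⊗[k] Λ
  coact := (TensorProduct.assoc k V Λ Λ).symm.toLinearMap ∘ₗ
    (Coalgebra.comul (R := k) (A := Λ)).lTensor V
  coassoc := by
    refine TensorProduct.ext' fun v l => ?_
    have h := LinearMap.congr_fun (Coalgebra.coassoc (R := k) (A := Λ)) l
    have h1 : ∀ w : Λ ⊗[k] Λ,
        TensorProduct.assoc k (V ⊗[k] Λ) Λ Λ (((TensorProduct.assoc k V Λ Λ).symm.toLinearMap ∘ₗ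
          (Coalgebra.comul (R := k) (A := Λ)).lTensor V).rTensor Λ
            ((TensorProduct.assoc k V Λ Λ).symm (v ⊗ₜ w))) =
        (TensorProduct.assoc k V Λ (Λ ⊗[k] Λ)).symm (v ⊗ₜ TensorProduct.assoc k Λ Λ Λ
          ((Coalgebra.comul (R := k) (A := Λ)).rTensor Λ w)) := by
      intro w
      induction w using TensorProduct.induction_on with
      | zero => simp
      | add x y hx hy => simp only [map_add, TensorProduct.tmul_add, hx, hy]
      | tmul a b =>
        simp only [TensorProduct.assoc_symm_tmul, LinearMap.rTensor_tmul, LinearMap.comp_apply,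
          LinearMap.lTensor_tmul, LinearEquiv.coe_coe]
        generalize Coalgebra.comul (R := k) a = w
        induction w using TensorProduct.induction_on with
        | zero => simp
        | add x y hx hy => simp only [map_add, TensorProduct.tmul_add, TensorProduct.add_tmul, hx, hy]
        | tmul c d => simp
    have h2 : ∀ w : Λ ⊗[k] Λ,
        (Coalgebra.comul (R := k) (A := Λ)).lTensor (V ⊗[k] Λ)
          ((TensorProduct.assoc k V Λ Λ).symm (v ⊗ₜ w)) =
        (TensorProduct.assoc k V Λ (Λ ⊗[k] Λ)).symm
          (v ⊗ₜ (Coalgebra.comul (R := k) (A := Λ)).lTensor Λ w) := by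
      intro w
      induction w using TensorProduct.induction_on with
      | zero => simp
      | add x y hx hy => simp only [map_add, TensorProduct.tmul_add, hx, hy]
      | tmul a b => simp
    have h3 := h1 (Coalgebra.comul (R := k) l)
    have h4 := h2 (Coalgebra.comul (R := k) l)
    simp only [LinearMap.comp_apply, LinearEquiv.coe_coe] at h
    rw [h, ← h4] at h3
    exact h3
  counit := by
    refine TensorProduct.ext' fun v l => ?_
    have h := LinearMap.congr_fun (Coalgebra.lTensor_counit_comp_comul (R := k) (A := Λ)) l
    have h1 : ∀ w : Λ ⊗[k] Λ, (Coalgebra.counit (R := k) (A := Λ)).lTensor (V ⊗[k] Λ)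
          ((TensorProduct.assoc k V Λ Λ).symm (v ⊗ₜ w)) =
        (TensorProduct.assoc k V Λ k).symm
          (v ⊗ₜ (Coalgebra.counit (R := k) (A := Λ)).lTensor Λ w) := by
      intro w
      induction w using TensorProduct.induction_on with
      | zero => simp
      | add x y hx hy => simp only [map_add, TensorProduct.tmul_add, hx, hy]
      | tmul a b => simp
    have h2 := h1 (Coalgebra.comul (R := k) l)
    simp only [LinearMap.comp_apply] at h
    rw [h] at h2
    exact h2

/-- The coaction embeds a comodule into a cofree one. -/
theorem isComoduleHom_coact (X : RightComodule k Λ) :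
    IsComoduleHom X (cofreeComodule X.carrier Λ) X.coact := by
  have h := X.coassoc
  refine LinearMap.ext fun x => ?_
  have hx := LinearMap.congr_fun h x
  simp only [LinearMap.comp_apply, LinearEquiv.coe_coe] at hx
  change (TensorProduct.assoc k X.carrier Λ Λ).symm
    ((Coalgebra.comul (R := k) (A := Λ)).lTensor X.carrier (X.coact x)) = _
  rw [← hx, LinearEquiv.symm_apply_apply]
  rfl

/-- The counit provides a left inverse. -/
theorem coact_injective (X : RightComodule k Λ) : Function.Injective X.coact := by
  intro x y hxy
  have h : ∀ x, TensorProduct.rid k X.carrier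
      ((Coalgebra.counit (R := k) (A := Λ)).lTensor X.carrier (X.coact x)) = x := fun x => by
    have := LinearMap.congr_fun X.counit x
    rw [LinearMap.comp_apply] at this
    rw [this]
    simp
  rw [← h x, hxy, h y]

end CofreeComodule

/-! ### Comodules over the symmetric coalgebra as modules with commuting operators -/

section ComoduleOperators

variable {k : Type u} [CommRing k] {m : ℕ}

/-- The operator of a right comodule over `k⟨x_1, …, x_m⟩` that gives the coefficient of the
monomial `x^a` in the coaction. -/
def coeffOp (X : RightComodule k (SymCoalg k m)) (a : Fin m →₀ ℕ) : X.carrier →ₗ[k] X.carrier :=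
  (TensorProduct.rid k X.carrier).toLinearMap ∘ₗ ((mono k m).coord a).lTensor X.carrier ∘ₗ X.coact

theorem coeffOp_apply (X : RightComodule k (SymCoalg k m)) (a : Fin m →₀ ℕ) (x : X.carrier) :
    coeffOp X a x =
      TensorProduct.rid k X.carrier (((mono k m).coord a).lTensor X.carrier (X.coact x)) :=
  rfl

theorem coeffOp_hom {X Y : RightComodule k (SymCoalg k m)} {f : X.carrier →ₗ[k] Y.carrier}
    (hf : IsComoduleHom X Y f) (a : Fin m →₀ ℕ) (x : X.carrier) :
    f (coeffOp X a x) = coeffOp Y a (f x) := by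
  have h : Y.coact (f x) = f.rTensor _ (X.coact x) := LinearMap.congr_fun hf x
  rw [coeffOp_apply, coeffOp_apply, h]
  generalize X.coact x = w
  induction w using TensorProduct.induction_on with
  | zero => simp
  | add x y hx hy => simp only [map_add, hx, hy]
  | tmul x l => simp

theorem coord_mono (a b : Fin m →₀ ℕ) :
    (mono k m).coord a (mono k m b) = if b = a then 1 else 0 := by
  classical
  rw [Module.Basis.coord_apply, Module.Basis.repr_self, Finsupp.single_apply]

/-- Comultiplication is dual to the multiplication of a polynomial ring: the only splitting seen by
the two coordinates is x^a ⊗ x^b. -/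
theorem coord_comul (a b : Fin m →₀ ℕ) :
    (TensorProduct.lid k k).toLinearMap ∘ₗ
      TensorProduct.map ((mono k m).coord a) ((mono k m).coord b) ∘ₗ symComul k m =
        (mono k m).coord (a + b) := by
  refine (mono k m).ext fun c => ?_
  simp only [LinearMap.comp_apply, symComul_mono, map_sum, TensorProduct.map_tmul, coord_mono,
    LinearEquiv.coe_coe, TensorProduct.lid_tmul, smul_eq_mul]
  rw [Finset.sum_congr rfl fun p _ => show
    ((if p.1 = a then 1 else 0) * (if p.2 = b then 1 else 0) : k) = if p = (a, b) then 1 else 0 by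
      simp only [Prod.ext_iff]; split_ifs <;> simp_all]
  rw [Finset.sum_ite_eq']
  simp only [Finset.HasAntidiagonal.mem_antidiagonal, eq_comm]

/-- This is coassociativity, evaluated at a pair of coordinate functions. The coefficients of the
coaction thus form an action of the polynomial ring, and in particular they commute. -/
theorem coeffOp_coeffOp (X : RightComodule k (SymCoalg k m)) (a b : Fin m →₀ ℕ) (x : X.carrier) :
    coeffOp X a (coeffOp X b x) = coeffOp X (a + b) x := by
  let F : X.carrier ⊗[k] (SymCoalg k m ⊗[k] SymCoalg k m) →ₗ[k] X.carrier :=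
    (TensorProduct.rid k X.carrier).toLinearMap ∘ₗ ((TensorProduct.lid k k).toLinearMap ∘ₗ
      TensorProduct.map ((mono k m).coord a) ((mono k m).coord b)).lTensor X.carrier
  have h : F (TensorProduct.assoc k X.carrier (SymCoalg k m) (SymCoalg k m)
      (X.coact.rTensor (SymCoalg k m) (X.coact x))) =
        F ((Coalgebra.comul (R := k) (A := SymCoalg k m)).lTensor X.carrier (X.coact x)) :=
    congrArg F (LinearMap.congr_fun X.coassoc x)
  have h1 : F ((Coalgebra.comul (R := k) (A := SymCoalg k m)).lTensor X.carrier (X.coact x)) =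
      coeffOp X (a + b) x := by
    rw [coeffOp_apply, ← coord_comul]
    simp only [F, LinearMap.comp_apply, LinearMap.lTensor_comp]
    rfl
  have h2 : ∀ w, F (TensorProduct.assoc k X.carrier (SymCoalg k m) (SymCoalg k m)
      (X.coact.rTensor (SymCoalg k m) w)) = coeffOp X a (TensorProduct.rid k X.carrier
        (((mono k m).coord b).lTensor X.carrier w)) := by
    intro w
    induction w using TensorProduct.induction_on with
    | zero => simp
    | add x y hx hy => simp only [map_add, hx, hy]
    | tmul x l =>
      rw [LinearMap.rTensor_tmul, LinearMap.lTensor_tmul, TensorProduct.rid_tmul, map_smul,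
        coeffOp_apply]
      generalize X.coact x = v
      induction v using TensorProduct.induction_on with
      | zero => simp
      | add x y hx hy => simp only [map_add, TensorProduct.add_tmul, smul_add, hx, hy]
      | tmul y l' =>
        simp only [F, LinearMap.comp_apply, LinearEquiv.coe_coe, TensorProduct.assoc_tmul,
          LinearMap.lTensor_tmul, TensorProduct.map_tmul, TensorProduct.lid_tmul,
          TensorProduct.rid_tmul, smul_eq_mul]
        rw [mul_comm, mul_smul]
  rw [h2, h1] at h
  exact h

theorem coeffOp_zero (X : RightComodule k (SymCoalg k m)) (x : X.carrier) :
    coeffOp X 0 x = x := by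
  have h : (mono k m).coord 0 = symCounit k m :=
    (mono k m).ext fun a => by rw [coord_mono, symCounit_mono]
  have := LinearMap.congr_fun X.counit x
  rw [coeffOp_apply, h]
  exact (congrArg (TensorProduct.rid k X.carrier) this).trans (by simp)

/-- The operator of a right comodule over `k⟨x_1, …, x_m⟩` that generalizes `∂/∂x_i`. -/
def partialOp (X : RightComodule k (SymCoalg k m)) (i : Fin m) : X.carrier →ₗ[k] X.carrier :=
  coeffOp X (Finsupp.single i 1)

theorem partialOp_comm (X : RightComodule k (SymCoalg k m)) (i l : Fin m) (x : X.carrier) :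
    partialOp X i (partialOp X l x) = partialOp X l (partialOp X i x) := by
  rw [partialOp, partialOp, coeffOp_coeffOp, coeffOp_coeffOp, add_comm]

/-- The coefficient of x^a with a i ≠ 0 factors through `partialOp X i`, and the coefficient of 1 is
always x by the counit law. So the operators `partialOp` alone detect the elements with trivial
coaction. -/
theorem coact_eq_iff (X : RightComodule k (SymCoalg k m)) (x : X.carrier) :
    X.coact x = x ⊗ₜ mono k m 0 ↔ ∀ i, partialOp X i x = 0 := by
  classical
  constructor
  · intro h i
    rw [partialOp, coeffOp_apply, h, LinearMap.lTensor_tmul, coord_mono, if_neg, TensorProduct.rid_tmul,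
      zero_smul]
    intro h0
    simpa using DFunLike.congr_fun h0 i
  · intro h
    apply (TensorProduct.equivFinsuppOfBasisRight (M := X.carrier) (mono k m)).injective
    ext a
    rw [TensorProduct.equivFinsuppOfBasisRight_apply, TensorProduct.equivFinsuppOfBasisRight_apply,
      ← coeffOp_apply, LinearMap.lTensor_tmul, coord_mono, TensorProduct.rid_tmul]
    split_ifs with ha
    · rw [← ha, coeffOp_zero, one_smul]
    · obtain ⟨i, hi⟩ : ∃ i, a i ≠ 0 := by
        by_contra hn
        push Not at hn
        exact ha (Finsupp.ext fun i => (hn i).symm)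
      have hle : Finsupp.single i 1 ≤ a := Finsupp.single_le_iff.2 (Nat.one_le_iff_ne_zero.2 hi)
      rw [← tsub_add_cancel_of_le hle, ← coeffOp_coeffOp]
      have := h i
      rw [partialOp] at this
      rw [this, map_zero, zero_smul]

theorem coord_single_comul (i : Fin m) :
    (TensorProduct.rid k (SymCoalg k m)).toLinearMap ∘ₗ
      ((mono k m).coord (Finsupp.single i 1)).lTensor (SymCoalg k m) ∘ₗ symComul k m =
        contr k i := by
  refine (mono k m).ext fun a => ?_
  simp only [LinearMap.comp_apply, symComul_mono, map_sum, LinearMap.lTensor_tmul, coord_mono,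
    LinearEquiv.coe_coe, TensorProduct.rid_tmul, contr_mono, ite_smul, one_smul, zero_smul]
  split_ifs with hi
  · refine Finset.sum_eq_zero fun p hp => if_neg fun h => ?_
    rw [Finset.HasAntidiagonal.mem_antidiagonal] at hp
    have := DFunLike.congr_fun hp i
    rw [Finsupp.add_apply, h, Finsupp.single_eq_same] at this
    omega
  · have hle : Finsupp.single i 1 ≤ a := Finsupp.single_le_iff.2 (Nat.one_le_iff_ne_zero.2 hi)
    rw [Finset.sum_eq_single (a - Finsupp.single i 1, Finsupp.single i 1)]
    · simp
    · rintro ⟨b, c⟩ hp hne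
      rw [Finset.HasAntidiagonal.mem_antidiagonal] at hp
      refine if_neg fun h => hne ?_
      simp only at hp h
      rw [← hp, h, add_tsub_cancel_right]
    · intro h
      exact absurd (Finset.HasAntidiagonal.mem_antidiagonal.2 (tsub_add_cancel_of_le hle)) h

theorem partialOp_faceComodule (K : AbstractSimplicialComplex (Fin m)) (i : Fin m) :
    partialOp (faceComodule k K) i = contrAvoid k (missingMonomials K) i := by
  refine LinearMap.ext fun (x : FaceCoalg k K) => Subtype.ext ?_
  have h1 : (avoid k (missingMonomials K)).subtype.rTensor _
      (avoidCoact k (missingMonomials K) x) = symComul k m x.1 :=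
    LinearMap.congr_fun (subtype_avoidCoact k (missingMonomials K)) x
  have h2 : TensorProduct.rid k (SymCoalg k m) (((mono k m).coord (Finsupp.single i 1)).lTensor
      (SymCoalg k m) (symComul k m x.1)) = contr k i x.1 :=
    LinearMap.congr_fun (coord_single_comul (k := k) i) x.1
  rw [← h1] at h2
  refine Eq.trans ?_ h2
  change (avoid k (missingMonomials K)).subtype (TensorProduct.rid k _
    (((mono k m).coord _).lTensor _ (avoidCoact k (missingMonomials K) x))) = _
  generalize avoidCoact k (missingMonomials K) x = w
  induction w using TensorProduct.induction_on with
  | zero => simp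
  | add x y hx hy => simp only [map_add, hx, hy]
  | tmul x l => simp

theorem partialOp_cofreeComodule (V : Type u) [AddCommGroup V] [Module k V] (i : Fin m) :
    partialOp (cofreeComodule V (SymCoalg k m)) i = (contr k i).lTensor V := by
  refine TensorProduct.ext' fun v l => ?_
  change _ = v ⊗ₜ contr k i l
  rw [← coord_single_comul]
  change _ = v ⊗ₜ (TensorProduct.rid k (SymCoalg k m)
    (((mono k m).coord (Finsupp.single i 1)).lTensor (SymCoalg k m) (symComul k m l)))
  change TensorProduct.rid k (V ⊗[k] SymCoalg k m) (((mono k m).coord _).lTensor _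
    ((TensorProduct.assoc k V _ _).symm (v ⊗ₜ symComul k m l))) = _
  generalize symComul k m l = w
  induction w using TensorProduct.induction_on with
  | zero => simp
  | add x y hx hy => simp only [map_add, TensorProduct.tmul_add, hx, hy]
  | tmul x l => simp

end ComoduleOperators

/-! ### Exactness of the Koszul complex of cofree and injective comodules -/

section CofreeExact

variable {k : Type u} [CommRing k] {m : ℕ}

variable (k) in
/-- Multiplication of monomials by `x_i`. -/
def mulGen (i : Fin m) : SymCoalg k m →ₗ[k] SymCoalg k m :=
  (mono k m).constr k fun a => mono k m (a + Finsupp.single i 1)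

theorem mulGen_mono (i : Fin m) (a : Fin m →₀ ℕ) :
    mulGen k i (mono k m a) = mono k m (a + Finsupp.single i 1) :=
  (mono k m).constr_basis k _ a

theorem contr_mulGen_self (i : Fin m) (x : SymCoalg k m) : contr k i (mulGen k i x) = x := by
  refine LinearMap.congr_fun (f := contr k i ∘ₗ mulGen k i) (g := LinearMap.id)
    ((mono k m).ext fun a => ?_) x
  simp [mulGen_mono, contr_mono]

theorem contr_mulGen {i l : Fin m} (h : l ≠ i) (x : SymCoalg k m) :
    contr k l (mulGen k i x) = mulGen k i (contr k l x) := by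
  refine LinearMap.congr_fun (f := contr k l ∘ₗ mulGen k i) (g := mulGen k i ∘ₗ contr k l)
    ((mono k m).ext fun a => ?_) x
  have h0 : (Finsupp.single i 1 : Fin m →₀ ℕ) l = 0 := by simp [h]
  simp only [LinearMap.comp_apply, mulGen_mono, contr_mono, Finsupp.add_apply, h0, add_zero]
  split_ifs with hl
  · rw [map_zero]
  · have hle : Finsupp.single l 1 ≤ a := Finsupp.single_le_iff.2 (Nat.one_le_iff_ne_zero.2 hl)
    rw [mulGen_mono, tsub_add_eq_add_tsub hle]

theorem mulGen_contr_mono (i : Fin m) (a : Fin m →₀ ℕ) :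
    mulGen k i (contr k i (mono k m a)) = if a i = 0 then 0 else mono k m a := by
  rw [contr_mono]
  split_ifs with hi
  · rw [map_zero]
  · have hle : Finsupp.single i 1 ≤ a := Finsupp.single_le_iff.2 (Nat.one_le_iff_ne_zero.2 hi)
    rw [mulGen_mono, tsub_add_cancel_of_le hle]

/-- A Poincaré lemma: multiplication by x_i is a right inverse of ∂/∂x_i, so the diagonal operator
of any i ∈ J annihilates x ⊗ y_J. In positive exterior degree every J is nonempty, hence a cycle
equals the boundary by which the product of these operators changes it. -/
theorem exists_koszulOp_lTensor_contr_eq {V : Type u} [AddCommGroup V] [Module k V] {n : ℕ}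
    {z : (V ⊗[k] SymCoalg k m) ⊗[k] ExtCoalg k m} (hz : z ∈ kSub m ⊤ (n + 1))
    (hD : koszulOp (fun i => (contr k i).lTensor V) z = 0) :
    ∃ w, koszulOp (fun i => (contr k i).lTensor V) w = z := by
  classical
  let t : Fin m → V ⊗[k] SymCoalg k m →ₗ[k] V ⊗[k] SymCoalg k m := fun i => (contr k i).lTensor V
  let s : Fin m → V ⊗[k] SymCoalg k m →ₗ[k] V ⊗[k] SymCoalg k m := fun i => (mulGen k i).lTensor V
  have ht : ∀ i l x, t i (t l x) = t l (t i x) := fun i l x => by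
    have h := partialOp_comm (cofreeComodule V (SymCoalg k m)) i l x
    rw [partialOp_cofreeComodule, partialOp_cofreeComodule] at h
    exact h
  have hs : ∀ i l, l ≠ i → ∀ x, t l (s i x) = s i (t l x) := fun i l hl x => by
    refine LinearMap.congr_fun (f := t l ∘ₗ s i) (g := s i ∘ₗ t l)
      (TensorProduct.ext' fun v y => ?_) x
    simp [t, s, contr_mulGen hl]
  obtain ⟨w, hw⟩ := koszulProj_list_cycle ht s Finset.univ.toList hD
  refine ⟨w, hw.trans (sub_eq_self.2 ?_)⟩
  set P := ((Finset.univ : Finset (Fin m)).toList.map fun i => koszulProj t (s i) i).prod with hP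
  have key : ∀ (J : Finset (Fin m)), #J = n + 1 → ∀ x, P (x ⊗ₜ yMono k J) = 0 := by
    intro J hJ x
    refine LinearMap.congr_fun
      (f := P ∘ₗ (TensorProduct.mk k (V ⊗[k] SymCoalg k m) (ExtCoalg k m)).flip (yMono k J))
      (g := 0) (TensorProduct.ext' fun v y => ?_) x
    refine LinearMap.congr_fun (f := P ∘ₗ (TensorProduct.mk k (V ⊗[k] SymCoalg k m)
      (ExtCoalg k m)).flip (yMono k J) ∘ₗ TensorProduct.mk k V (SymCoalg k m) v)
      (g := 0) ((mono k m).ext fun a => ?_) y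
    change P ((v ⊗ₜ mono k m a) ⊗ₜ yMono k J) = 0
    -- The i-th factor is 1 - t_i s_i = 0 for i ∈ J, and for i ∉ J it is 1 - s_i t_i, which keeps
    -- exactly the monomials not divisible by x_i.
    rw [hP, koszulProj_list_apply t s _ (fun i => a i = 0 ∧ i ∉ J)]
    · rw [if_neg]
      intro h
      obtain ⟨j, hj⟩ : J.Nonempty := Finset.card_pos.1 (by omega)
      exact (h j (by simp)).2 hj
    · intro i
      rw [koszulProj_apply t (s i) i (hs i)]
      simp only [t, s, LinearMap.lTensor_tmul, contr_mulGen_self, mulGen_contr_mono]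
      by_cases hi : i ∈ J <;> by_cases ha : a i = 0 <;> simp [hi, ha]
  rw [← sum_kCoord_tmul z, map_sum]
  refine Finset.sum_eq_zero fun J _ => ?_
  by_cases hJ : #J = n + 1
  · exact key J hJ _
  · rw [(mem_kSub_iff.1 hz J).2 hJ, TensorProduct.zero_tmul, map_zero]

/-- The comodule `X` is a retract of a cofree comodule. -/
def IsCofreeRetract (X : RightComodule k (SymCoalg k m)) : Prop :=
  ∃ h : X.carrier ⊗[k] SymCoalg k m →ₗ[k] X.carrier,
    IsComoduleHom (cofreeComodule X.carrier (SymCoalg k m)) X h ∧ h ∘ₗ X.coact = LinearMap.id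

/-- Injectivity extends the identity of X along its coaction, which embeds X into a cofree comodule.
-/
theorem IsInjectiveComodule.isCofreeRetract {X : RightComodule k (SymCoalg k m)}
    (hX : IsInjectiveComodule X) : IsCofreeRetract X :=
  hX X (cofreeComodule X.carrier (SymCoalg k m)) X.coact LinearMap.id (isComoduleHom_coact X)
    (coact_injective X) (by rw [IsComoduleHom, LinearMap.rTensor_id]; rfl)

/-- The Koszul complex of a retract of a cofree comodule is exact in positive degrees. -/
theorem IsCofreeRetract.exists_koszulOp_eq {X : RightComodule k (SymCoalg k m)}
    (hX : IsCofreeRetract X) {n : ℕ} {z : X.carrier ⊗[k] ExtCoalg k m} (hz : z ∈ kSub m ⊤ (n + 1))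
    (hD : koszulOp (partialOp X) z = 0) : ∃ w, koszulOp (partialOp X) w = z := by
  obtain ⟨h, hh, hid⟩ := hX
  let C : RightComodule k (SymCoalg k m) := cofreeComodule X.carrier (SymCoalg k m)
  have hp : ∀ i, partialOp C i = (contr k i).lTensor X.carrier := partialOp_cofreeComodule X.carrier
  have h1 : ∀ i x, X.coact (partialOp X i x) = (contr k i).lTensor X.carrier (X.coact x) :=
    fun i x => by
      rw [← hp]
      exact coeffOp_hom (isComoduleHom_coact X) _ x
  have h2 : ∀ i x, h ((contr k i).lTensor X.carrier x) = partialOp X i (h x) := fun i x => by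
    rw [← hp]
    exact coeffOp_hom hh _ x
  -- The cycle is carried into the cofree comodule by the coaction; a primitive found there is
  -- brought back by the retraction. Both are comodule maps and so commute with ∂.
  obtain ⟨w, hw⟩ := exists_koszulOp_lTensor_contr_eq
    (z := X.coact.rTensor (ExtCoalg k m) z)
    (rTensor_mem_kSub (fun _ _ => Submodule.mem_top) hz) (by
      rw [← koszulOp_rTensor h1, hD, map_zero])
  refine ⟨h.rTensor (ExtCoalg k m) w, ?_⟩
  rw [← koszulOp_rTensor h2, hw, ← LinearMap.comp_apply, ← LinearMap.rTensor_comp, hid,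
    LinearMap.rTensor_id, LinearMap.id_apply]

/-- Any primitive of z may be cut down by π: since ∂ intertwines π with π', and π' fixes z, its
boundary is still z. -/
theorem IsCofreeRetract.exists_mem_kSub {X : RightComodule k (SymCoalg k m)}
    (hX : IsCofreeRetract X) {G G' : Submodule k X.carrier} {π π' : X.carrier →ₗ[k] X.carrier}
    (hπ : ∀ x, π x ∈ G) (hπ' : ∀ x ∈ G', π' x = x)
    (hc : ∀ i x, partialOp X i (π x) = π' (partialOp X i x)) {n : ℕ}
    {z : X.carrier ⊗[k] ExtCoalg k m} (hz : z ∈ kSub m G' (n + 1))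
    (hD : koszulOp (partialOp X) z = 0) : ∃ w ∈ kSub m G n, koszulOp (partialOp X) w = z := by
  obtain ⟨w, hw⟩ := hX.exists_koszulOp_eq
    (mem_kSub_iff.2 fun J => ⟨Submodule.mem_top, (mem_kSub_iff.1 hz J).2⟩) hD
  exact ⟨kProj π n w, kProj_mem hπ n w, by rw [koszulOp_kProj hc, hw, kProj_fix hπ' hz]⟩

end CofreeExact

/-! ### Graded comodules and internal degrees -/

section GradedComodule

variable {k : Type u} [CommRing k] {m : ℕ}

/-- The total grading of a tensor product of graded modules. -/
def tensorGrading {V W : Type u} [AddCommGroup V] [Module k V] [AddCommGroup W] [Module k W]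
    (𝒱 : ℕ → Submodule k V) (𝒲 : ℕ → Submodule k W) (e : ℕ) : Submodule k (V ⊗[k] W) :=
  ⨆ p ∈ antidiagonal e, Submodule.map₂ (TensorProduct.mk k V W) (𝒱 p.1) (𝒲 p.2)

theorem tmul_mem_tensorGrading {V W : Type u} [AddCommGroup V] [Module k V] [AddCommGroup W]
    [Module k W] {𝒱 : ℕ → Submodule k V} {𝒲 : ℕ → Submodule k W} {p q e : ℕ} (h : p + q = e)
    {v : V} {w : W} (hv : v ∈ 𝒱 p) (hw : w ∈ 𝒲 q) : v ⊗ₜ w ∈ tensorGrading 𝒱 𝒲 e :=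
  Submodule.mem_iSup_of_mem (p, q) (Submodule.mem_iSup_of_mem
    (Finset.HasAntidiagonal.mem_antidiagonal.2 h) (Submodule.apply_mem_map₂ _ hv hw))

theorem tensorGrading_le {V W : Type u} [AddCommGroup V] [Module k V] [AddCommGroup W]
    [Module k W] {𝒱 : ℕ → Submodule k V} {𝒲 : ℕ → Submodule k W} {e : ℕ}
    {U : Submodule k (V ⊗[k] W)}
    (h : ∀ p q, p + q = e → ∀ v ∈ 𝒱 p, ∀ w ∈ 𝒲 q, v ⊗ₜ w ∈ U) : tensorGrading 𝒱 𝒲 e ≤ U :=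
  iSup₂_le fun p hp => Submodule.map₂_le.2 fun v hv w hw =>
    h p.1 p.2 (Finset.HasAntidiagonal.mem_antidiagonal.1 hp) v hv w hw

theorem IsProjFamily.apply_eq_ite {M : Type u} [AddCommGroup M] [Module k M]
    {S : ℕ → Submodule k M} {π : ℕ → M →ₗ[k] M} (h : IsProjFamily S π) {i : ℕ} {x : M}
    (hx : x ∈ S i) (j : ℕ) : π j x = if i = j then x else 0 := by
  split_ifs with hij
  · subst hij; exact h.fix i x hx
  · exact h.kill i j hij x hx

theorem IsProjFamily.tensor {V W : Type u} [AddCommGroup V] [Module k V] [AddCommGroup W]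
    [Module k W] {𝒱 : ℕ → Submodule k V} {𝒲 : ℕ → Submodule k W} {π : ℕ → V →ₗ[k] V}
    {ρ : ℕ → W →ₗ[k] W} (hV : IsProjFamily 𝒱 π) (hW : IsProjFamily 𝒲 ρ) :
    IsProjFamily (tensorGrading 𝒱 𝒲)
      fun e => ∑ p ∈ antidiagonal e, TensorProduct.map (π p.1) (ρ p.2) := by
  have key : ∀ p q e, ∀ v ∈ 𝒱 p, ∀ w ∈ 𝒲 q,
      (∑ p ∈ antidiagonal e, TensorProduct.map (π p.1) (ρ p.2)) (v ⊗ₜ w) =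
        if p + q = e then v ⊗ₜ w else 0 := by
    intro p q e v hv w hw
    rw [LinearMap.sum_apply]
    simp only [TensorProduct.map_tmul, hV.apply_eq_ite hv, hW.apply_eq_ite hw]
    split_ifs with h
    · rw [Finset.sum_eq_single (p, q)]
      · simp
      · rintro ⟨p', q'⟩ _ hne
        by_cases hp : p = p'
        · by_cases hq : q = q'
          · exact absurd (by rw [hp, hq]) hne
          · simp [hq]
        · simp [hp]
      · exact fun hn => absurd (Finset.HasAntidiagonal.mem_antidiagonal.2 h) hn
    · refine Finset.sum_eq_zero ?_
      rintro ⟨p', q'⟩ hp'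
      rw [Finset.HasAntidiagonal.mem_antidiagonal] at hp'
      by_cases hp : p = p'
      · by_cases hq : q = q'
        · subst hp hq; exact absurd hp' h
        · simp [hq]
      · simp [hp]
  refine ⟨fun e x => ?_, fun e x hx => ?_, fun e e' he x hx => ?_, ?_⟩
  · induction x using TensorProduct.induction_on with
    | zero => rw [map_zero]; exact Submodule.zero_mem _
    | add x y hx hy => rw [map_add]; exact Submodule.add_mem _ hx hy
    | tmul v w =>
      rw [LinearMap.sum_apply]
      exact Submodule.sum_mem _ fun p hp => tmul_mem_tensorGrading
        (Finset.HasAntidiagonal.mem_antidiagonal.1 hp) (hV.mem _ _) (hW.mem _ _)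
  · exact tensorGrading_le (U := LinearMap.eqLocus _ LinearMap.id)
      (fun p q hpq v hv w hw => (key p q e v hv w hw).trans (if_pos hpq)) hx
  · exact tensorGrading_le (U := LinearMap.ker _)
      (fun p q hpq v hv w hw => (key p q e' v hv w hw).trans
        (if_neg fun h => he (hpq.symm.trans h))) hx
  · rw [eq_top_iff, ← TensorProduct.map₂_mk_top_top_eq_top, ← hV.iSup_eq_top, ← hW.iSup_eq_top,
      Submodule.map₂_iSup_left]
    refine iSup_le fun p => ?_
    rw [Submodule.map₂_iSup_right]
    refine iSup_le fun q => Submodule.map₂_le.2 fun v hv w hw => ?_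
    exact Submodule.mem_iSup_of_mem (p + q) (tmul_mem_tensorGrading rfl hv hw)

variable (k m) in
theorem isProjFamily_symGrading :
    ∃ σ : ℕ → SymCoalg k m →ₗ[k] SymCoalg k m, IsProjFamily (symGrading k m) σ :=
  ⟨_, isProjFamily_basisProj (mono k m) fun a => 2 * a.degree⟩

theorem mono_mem_symGrading {a : Fin m →₀ ℕ} {e : ℕ} (h : 2 * a.degree = e) :
    mono k m a ∈ symGrading k m e :=
  Submodule.subset_span ⟨a, h, rfl⟩

/-- The degrees of the two factors of a split monomial add up to its degree. The cofree comodule is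
thereby admissible as a test object for graded injectivity. -/
theorem isGradedComodule_cofreeComodule {V : Type u} [AddCommGroup V] [Module k V]
    {𝒱 : ℕ → Submodule k V} (h : DirectSum.IsInternal 𝒱) :
    IsGradedComodule (symGrading k m) (cofreeComodule V (SymCoalg k m))
      (tensorGrading 𝒱 (symGrading k m)) := by
  obtain ⟨π, hπ⟩ := IsProjFamily.of_isInternal h
  obtain ⟨σ, hσ⟩ := isProjFamily_symGrading k m
  refine ⟨(hπ.tensor hσ).isInternal, fun e => ?_⟩
  refine Submodule.map_le_iff_le_comap.2 (tensorGrading_le fun p q hpq v hv l hl => ?_)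
  change (TensorProduct.assoc k V (SymCoalg k m) (SymCoalg k m)).symm (v ⊗ₜ symComul k m l) ∈
    tensorGrading (tensorGrading 𝒱 (symGrading k m)) (symGrading k m) e
  induction hl using Submodule.span_induction with
  | mem l hl =>
    obtain ⟨a, ha, rfl⟩ := hl
    rw [symComul_mono, TensorProduct.tmul_sum, map_sum]
    refine Submodule.sum_mem _ fun r hr => ?_
    rw [Finset.HasAntidiagonal.mem_antidiagonal] at hr
    rw [TensorProduct.assoc_symm_tmul]
    refine tmul_mem_tensorGrading ?_ (tmul_mem_tensorGrading rfl hv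
      (mono_mem_symGrading (a := r.1) rfl)) (mono_mem_symGrading (a := r.2) rfl)
    have ha' : 2 * a.degree = q := ha
    rw [← hr, map_add] at ha'
    omega
  | zero => rw [map_zero, TensorProduct.tmul_zero, map_zero]; exact Submodule.zero_mem _
  | add x y _ _ hx hy =>
    rw [map_add, TensorProduct.tmul_add, map_add]; exact Submodule.add_mem _ hx hy
  | smul r x _ hx =>
    rw [map_smul, TensorProduct.tmul_smul, map_smul]; exact Submodule.smul_mem _ _ hx

/-- The coaction is homogeneous for the total grading of X ⊗ k⟨m⟩, so the extension problem of the
ungraded case is a graded one. Homogeneity of the resulting retraction is dropped; homogeneous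
primitives are later obtained by projecting. -/
theorem IsGradedInjective.isCofreeRetract {X : RightComodule k (SymCoalg k m)}
    {𝒳 : ℕ → Submodule k X.carrier} (hg : IsGradedComodule (symGrading k m) X 𝒳)
    (hX : IsGradedInjective (symGrading k m) X 𝒳) : IsCofreeRetract X := by
  obtain ⟨h, h1, -, h2⟩ := hX X (cofreeComodule X.carrier (SymCoalg k m)) 𝒳
    (tensorGrading 𝒳 (symGrading k m)) X.coact LinearMap.id hg
    (isGradedComodule_cofreeComodule hg.1) (isComoduleHom_coact X)
    (fun e x hx => hg.2 e ⟨x, hx, rfl⟩) (coact_injective X)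
    (by rw [IsComoduleHom, LinearMap.rTensor_id]; rfl) (fun e x hx => hx)
  exact ⟨h, h1, h2⟩

/-- Taking the coefficient of x_i removes a factor of degree 2. The value ⊥ below degree 2 guards
against truncated subtraction. -/
theorem partialOp_mem {X : RightComodule k (SymCoalg k m)} {𝒳 : ℕ → Submodule k X.carrier}
    (hg : IsGradedComodule (symGrading k m) X 𝒳) (i : Fin m) (e : ℕ) {x : X.carrier}
    (hx : x ∈ 𝒳 e) : partialOp X i x ∈ if 2 ≤ e then 𝒳 (e - 2) else ⊥ := by
  have hc : X.coact x ∈ tensorGrading 𝒳 (symGrading k m) e := hg.2 e ⟨x, hx, rfl⟩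
  let F : X.carrier ⊗[k] SymCoalg k m →ₗ[k] X.carrier :=
    (TensorProduct.rid k X.carrier).toLinearMap ∘ₗ
      ((mono k m).coord (Finsupp.single i 1)).lTensor X.carrier
  suffices h : tensorGrading 𝒳 (symGrading k m) e ≤
      (if 2 ≤ e then 𝒳 (e - 2) else ⊥ : Submodule k X.carrier).comap F from h hc
  refine tensorGrading_le fun p q hpq y hy l hl => ?_
  have hF : F (y ⊗ₜ l) = (mono k m).coord (Finsupp.single i 1) l • y := by simp [F]
  rw [Submodule.mem_comap, hF]
  by_cases hq : q = 2
  · rw [if_pos (by omega), show e - 2 = p by omega]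
    exact Submodule.smul_mem _ _ hy
  · have h0 : (mono k m).coord (Finsupp.single i 1) l = 0 := by
      refine LinearMap.eqOn_span (f := (mono k m).coord (Finsupp.single i 1)) (g := 0) ?_ hl
      rintro _ ⟨a, ha, rfl⟩
      rw [coord_mono, if_neg]
      · rfl
      · rintro rfl
        have ha' : 2 * (Finsupp.single i 1 : Fin m →₀ ℕ).degree = q := ha
        rw [Finsupp.degree_single] at ha'
        omega
    rw [h0, zero_smul]
    exact Submodule.zero_mem _

theorem partialOp_proj {X : RightComodule k (SymCoalg k m)} {𝒳 : ℕ → Submodule k X.carrier}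
    (hg : IsGradedComodule (symGrading k m) X 𝒳) {π : ℕ → X.carrier →ₗ[k] X.carrier}
    (hπ : IsProjFamily 𝒳 π) (i : Fin m) (e : ℕ) (x : X.carrier) :
    partialOp X i (π (e + 2) x) = π e (partialOp X i x) := by
  refine hπ.linearMap_ext (f := partialOp X i ∘ₗ π (e + 2)) (g := π e ∘ₗ partialOp X i)
    (fun j x hx => ?_) x
  rw [LinearMap.comp_apply, LinearMap.comp_apply, hπ.apply_eq_ite hx]
  have h := partialOp_mem hg i j hx
  by_cases hj : 2 ≤ j
  · rw [if_pos hj] at h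
    rw [hπ.apply_eq_ite h, apply_ite (partialOp X i), map_zero]
    exact if_congr (by omega) rfl rfl
  · rw [if_neg hj, Submodule.mem_bot] at h
    rw [h, map_zero, if_neg (by omega), map_zero]

/-- The components of the `x`-degrees that contribute to the part of internal degree `e` of the
Koszul complex. -/
def strand {M : Type u} [AddCommGroup M] [Module k M] (𝒢 : ℕ → Submodule k M) (e n : ℕ) :
    Submodule k M :=
  if 2 * n ≤ e then 𝒢 (e - 2 * n) else ⊥

theorem apply_mem_strand {M M' : Type u} [AddCommGroup M] [Module k M] [AddCommGroup M']
    [Module k M'] {𝒢 : ℕ → Submodule k M} {𝒢' : ℕ → Submodule k M'} {f : M →ₗ[k] M'}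
    (hf : IsHomogeneous 𝒢 𝒢' f) {e n : ℕ} {x : M} (hx : x ∈ strand 𝒢 e n) :
    f x ∈ strand 𝒢' e n := by
  unfold strand at hx ⊢
  split_ifs at hx ⊢
  · exact hf _ x hx
  · rw [Submodule.mem_bot] at hx ⊢
    rw [hx, map_zero]

/-- A preimage of a homogeneous element can be replaced by its component of the same degree, so a
graded resolution is exact in each degree. -/
theorem exists_mem_strand {M M' : Type u} [AddCommGroup M] [Module k M] [AddCommGroup M']
    [Module k M'] {𝒢 : ℕ → Submodule k M} {𝒢' : ℕ → Submodule k M'} {f : M →ₗ[k] M'}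
    (hf : IsHomogeneous 𝒢 𝒢' f) {π : ℕ → M →ₗ[k] M} (hπ : IsProjFamily 𝒢 π)
    {π' : ℕ → M' →ₗ[k] M'} (hπ' : IsProjFamily 𝒢' π') {e n : ℕ} {x : M}
    (hx : f x ∈ strand 𝒢' e n) : ∃ y ∈ strand 𝒢 e n, f y = f x := by
  unfold strand at hx ⊢
  split_ifs at hx ⊢ with he
  · refine ⟨π (e - 2 * n) x, hπ.mem _ x, ?_⟩
    have hc : ∀ x, f (π (e - 2 * n) x) = π' (e - 2 * n) (f x) :=
      hπ.linearMap_ext (f := f ∘ₗ π (e - 2 * n)) (g := π' (e - 2 * n) ∘ₗ f) fun j x hx => by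
        rw [LinearMap.comp_apply, LinearMap.comp_apply, hπ.apply_eq_ite hx,
          hπ'.apply_eq_ite (hf j x hx), apply_ite f, map_zero]
    rw [hc, hπ'.fix _ _ hx]
  · rw [Submodule.mem_bot] at hx
    exact ⟨0, Submodule.zero_mem _, by rw [hx, map_zero]⟩

/-- The internal degree is the degree in X plus 2 for each y_i, so exchanging x_i for y_i does not
change it. -/
theorem partialOp_mem_strand {X : RightComodule k (SymCoalg k m)}
    {𝒳 : ℕ → Submodule k X.carrier} (hg : IsGradedComodule (symGrading k m) X 𝒳) (i : Fin m)
    {e n : ℕ} {x : X.carrier} (hx : x ∈ strand 𝒳 e n) : partialOp X i x ∈ strand 𝒳 e (n + 1) := by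
  unfold strand at hx ⊢
  split_ifs at hx with he
  · have h := partialOp_mem hg i _ hx
    split_ifs at h ⊢ with h1 h2 h2
    · rwa [show e - 2 * (n + 1) = e - 2 * n - 2 by omega]
    · omega
    · omega
    · exact h
  · rw [Submodule.mem_bot] at hx
    rw [hx, map_zero]
    exact Submodule.zero_mem _

theorem IsCofreeRetract.exists_mem_kSub_strand {X : RightComodule k (SymCoalg k m)}
    (hX : IsCofreeRetract X) {𝒳 : ℕ → Submodule k X.carrier}
    (hg : IsGradedComodule (symGrading k m) X 𝒳) {e n : ℕ}
    {z : X.carrier ⊗[k] ExtCoalg k m} (hz : z ∈ kSub m (strand 𝒳 e (n + 1)) (n + 1))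
    (hD : koszulOp (partialOp X) z = 0) :
    ∃ w ∈ kSub m (strand 𝒳 e n) n, koszulOp (partialOp X) w = z := by
  obtain ⟨π, hπ⟩ := IsProjFamily.of_isInternal hg.1
  unfold strand at hz ⊢
  split_ifs at hz with he
  · rw [if_pos (by omega)]
    refine hX.exists_mem_kSub (hπ.mem _) (hπ.fix _) (fun i x => ?_) hz hD
    rw [← partialOp_proj hg hπ, show e - 2 * (n + 1) + 2 = e - 2 * n by omega]
  -- For e < 2(n + 1) the strand is zero in position n + 1, and so is z.
  · refine ⟨0, Submodule.zero_mem _, ?_⟩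
    rw [map_zero]
    simpa [kSub, Submodule.map₂_bot_left, eq_comm] using hz

end GradedComodule

/-! ### Cohomology of a complex embedded in ambient modules -/

section ComplexHomology

variable {k : Type u} [CommRing k]

/-- The homology of a complex whose terms `Y n` are identified with submodules `B n` of `M n`. -/
theorem nonempty_homology_of_equiv {M : ℕ → Type u} [∀ p, AddCommGroup (M p)]
    [∀ p, Module k (M p)] {d : ∀ p, M p →ₗ[k] M (p + 1)} {B : ∀ p, Submodule k (M p)}
    {Y : ℕ → Type u} [∀ p, AddCommGroup (Y p)] [∀ p, Module k (Y p)]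
    {dY : ∀ p, Y p →ₗ[k] Y (p + 1)}
    (sq : ∀ n, ModuleCat.ofHom (dY n) ≫ ModuleCat.ofHom (dY (n + 1)) = 0)
    (g : ∀ p, Y p →ₗ[k] M p) (hg : ∀ p, Function.Injective (g p))
    (hB : ∀ p, LinearMap.range (g p) = B p) (hd : ∀ p y, g (p + 1) (dY p y) = d p (g p y)) (n : ℕ) :
    Nonempty ((CochainComplex.of (fun n => ModuleCat.of k (Y n)) (fun n => ModuleCat.ofHom (dY n))
      sq).homology n ≃ₗ[k] Subquot (B n ⊓ LinearMap.ker (d n)) (prevRange d B n)) := by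
  have hof : ∀ n, ((CochainComplex.of (fun n => ModuleCat.of k (Y n))
      (fun n => ModuleCat.ofHom (dY n)) sq).d n (n + 1)).hom = dY n := fun n =>
    congrArg ModuleCat.Hom.hom (CochainComplex.of_d (fun n => ModuleCat.of k (Y n))
      (fun n => ModuleCat.ofHom (dY n)) n)
  refine nonempty_cochain_homology_equiv _ n (g n) (hg n) ?_ ?_ ?_
  · rw [hof, ← hB]
    ext z
    constructor
    · rintro ⟨y, hy, rfl⟩
      refine ⟨⟨y, rfl⟩, ?_⟩
      rw [SetLike.mem_coe, LinearMap.mem_ker] at hy ⊢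
      rw [← hd, hy, map_zero]
    · rintro ⟨⟨y, rfl⟩, hy⟩
      rw [SetLike.mem_coe, LinearMap.mem_ker, ← hd, map_eq_zero_iff _ (hg _)] at hy
      exact ⟨y, hy, rfl⟩
  · rintro rfl
    rfl
  · rintro l rfl
    rw [hof]
    change _ = (B l).map (d l)
    rw [← hB, ← LinearMap.range_comp, ← LinearMap.range_comp]
    congr 1
    exact LinearMap.ext fun y => hd l y

end ComplexHomology

/-! ### The cotensor product with k as the Koszul cycles of degree 0 -/

section Cotensor

variable {k : Type u} [CommRing k] {m : ℕ}

/-- The element `1` of the trivial comodule. -/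
def trivialOne : (trivialComodule k m).carrier := (1 : k)

/-- The isomorphism `X ⊗ k ≅ X`. -/
def trivialRid (X : RightComodule k (SymCoalg k m)) :
    X.carrier ⊗[k] (trivialComodule k m).carrier ≃ₗ[k] X.carrier :=
  TensorProduct.rid k X.carrier

theorem trivialRid_tmul_one (X : RightComodule k (SymCoalg k m)) (x : X.carrier) :
    trivialRid X (x ⊗ₜ trivialOne) = x :=
  (TensorProduct.rid_tmul (R := k) x 1).trans (one_smul k x)

theorem trivialRid_tmul_mem (X : RightComodule k (SymCoalg k m)) {G : Submodule k X.carrier}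
    {x : X.carrier} (hx : x ∈ G) (r : (trivialComodule k m).carrier) :
    trivialRid X (x ⊗ₜ r) ∈ G :=
  (TensorProduct.rid_tmul (R := k) x r).symm ▸ G.smul_mem _ hx

theorem exists_tmul_trivialOne (X : RightComodule k (SymCoalg k m))
    (z : X.carrier ⊗[k] (trivialComodule k m).carrier) : ∃ x, x ⊗ₜ trivialOne = z :=
  ⟨trivialRid X z, (trivialRid X).injective (trivialRid_tmul_one X _)⟩

/-- After the identification Λ ⊗ k ≅ Λ of the coefficient coalgebra, the cotensor condition says
that the coaction maps x to x ⊗ 1, which `coact_eq_iff` expresses by the partial operators. -/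
theorem tmul_trivialOne_mem_cotensor_iff (X : RightComodule k (SymCoalg k m)) (x : X.carrier) :
    x ⊗ₜ trivialOne ∈ cotensor X (trivialComodule k m) ↔ ∀ i, partialOp X i x = 0 := by
  have h1 : ∀ w : X.carrier ⊗[k] SymCoalg k m,
      TensorProduct.assoc k X.carrier (SymCoalg k m) k (w ⊗ₜ[k] (1 : k)) =
        (TensorProduct.rid k (SymCoalg k m)).symm.toLinearMap.lTensor X.carrier w := by
    intro w
    induction w using TensorProduct.induction_on with
    | zero => simp
    | add x y hx hy => simp only [map_add, TensorProduct.add_tmul, hx, hy]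
    | tmul x l => simp
  have h2 : cotensorMap X (trivialComodule k m) (x ⊗ₜ trivialOne) =
      (TensorProduct.rid k (SymCoalg k m)).symm.toLinearMap.lTensor X.carrier
        (X.coact x - x ⊗ₜ mono k m 0) := by
    rw [map_sub, ← h1]
    rfl
  have h3 : Function.Injective
      ((TensorProduct.rid k (SymCoalg k m)).symm.toLinearMap.lTensor X.carrier) :=
    ((TensorProduct.rid k (SymCoalg k m)).symm.lTensor X.carrier).injective
  rw [← coact_eq_iff, ← sub_eq_zero, ← map_eq_zero_iff _ h3]
  exact Eq.congr h2 rfl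

/-- The boundary of x ⊗ 1 is ∑ t_i x ⊗ y_i, and its coordinates are the t_i x. -/
theorem tmul_yMono_empty_mem_ker_iff {M : Type u} [AddCommGroup M] [Module k M]
    (t : Fin m → M →ₗ[k] M) (x : M) :
    koszulOp t (x ⊗ₜ yMono k ∅) = 0 ↔ ∀ i, t i x = 0 := by
  have h : koszulOp t (x ⊗ₜ yMono k ∅) = ∑ i, t i x ⊗ₜ yMono k {i} := by
    rw [koszulOp_tmul]
    refine Finset.sum_congr rfl fun i _ => ?_
    rw [yGen_mul_yMono k (Finset.notMem_empty i)]
    simp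
  constructor
  · intro h0 i
    rw [h] at h0
    have := DFunLike.congr_fun (congrArg kCoord h0) {i}
    simp only [map_sum, kCoord_tmul, Finsupp.coe_finsetSum, Finset.sum_apply, map_zero,
      Finsupp.coe_zero, Pi.zero_apply] at this
    rw [Finset.sum_eq_single i] at this
    · simpa using this
    · intro l _ hl
      rw [Finsupp.single_eq_of_ne]
      simpa using hl.symm
    · simp
  · intro h0
    rw [h]
    exact Finset.sum_eq_zero fun i _ => by rw [h0, TensorProduct.zero_tmul]

theorem mem_kSub_zero_iff {M : Type u} [AddCommGroup M] [Module k M] {G : Submodule k M}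
    {z : M ⊗[k] ExtCoalg k m} : z ∈ kSub m G 0 ↔ ∃ x ∈ G, x ⊗ₜ yMono k ∅ = z := by
  constructor
  · intro hz
    refine ⟨_, (mem_kSub_iff.1 hz ∅).1, ?_⟩
    conv_rhs => rw [← sum_kCoord_tmul z]
    rw [Finset.sum_eq_single ∅]
    · intro J _ hJ
      rw [(mem_kSub_iff.1 hz J).2 (by simpa using hJ), TensorProduct.zero_tmul]
    · simp
  · rintro ⟨x, hx, rfl⟩
    exact tmul_mem_kSub hx rfl

/-- The identification of `X ⊠ k` with the cycles of degree `0` in the Koszul complex of `X`. -/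
def cotensorIncl (X : RightComodule k (SymCoalg k m)) :
    cotensor X (trivialComodule k m) →ₗ[k] X.carrier ⊗[k] ExtCoalg k m :=
  (TensorProduct.mk k X.carrier (ExtCoalg k m)).flip (yMono k ∅) ∘ₗ
    (trivialRid X).toLinearMap ∘ₗ (cotensor X (trivialComodule k m)).subtype

theorem cotensorIncl_apply (X : RightComodule k (SymCoalg k m))
    (z : cotensor X (trivialComodule k m)) :
    cotensorIncl X z = trivialRid X z.1 ⊗ₜ yMono k ∅ :=
  rfl

theorem cotensorIncl_injective (X : RightComodule k (SymCoalg k m)) :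
    Function.Injective (cotensorIncl X) := by
  intro z w h
  rw [cotensorIncl_apply, cotensorIncl_apply] at h
  have := congrArg kCoord h
  rw [kCoord_tmul, kCoord_tmul] at this
  exact Subtype.ext ((trivialRid X).injective (Finsupp.single_injective _ this))

/-- An element x ⊗ 1 lies in X ⊠ k and is a Koszul cycle under the same condition on x. The case G =
⊤ serves Cotor, and G a homogeneous part serves its graded version. -/
theorem map_cotensorIncl (X : RightComodule k (SymCoalg k m)) (G : Submodule k X.carrier) :
    ((Submodule.map₂ (TensorProduct.mk k X.carrier (trivialComodule k m).carrier) G ⊤).comap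
      (cotensor X (trivialComodule k m)).subtype).map (cotensorIncl X) =
        kSub m G 0 ⊓ LinearMap.ker (koszulOp (partialOp X)) := by
  ext z
  constructor
  · rintro ⟨⟨w, hw⟩, hwG, rfl⟩
    have hle : Submodule.map₂ (TensorProduct.mk k X.carrier (trivialComodule k m).carrier) G ⊤ ≤
        G.comap (trivialRid X).toLinearMap :=
      Submodule.map₂_le.2 fun x hx r _ => trivialRid_tmul_mem X hx r
    refine ⟨mem_kSub_zero_iff.2 ⟨_, hle hwG, rfl⟩, ?_⟩
    obtain ⟨x, rfl⟩ := exists_tmul_trivialOne X w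
    rw [SetLike.mem_coe, LinearMap.mem_ker, cotensorIncl_apply, tmul_yMono_empty_mem_ker_iff,
      trivialRid_tmul_one]
    exact (tmul_trivialOne_mem_cotensor_iff X x).1 hw
  · rintro ⟨hz, hD⟩
    obtain ⟨x, hx, rfl⟩ := mem_kSub_zero_iff.1 hz
    rw [SetLike.mem_coe, LinearMap.mem_ker, tmul_yMono_empty_mem_ker_iff] at hD
    refine ⟨⟨x ⊗ₜ trivialOne, (tmul_trivialOne_mem_cotensor_iff X x).2 hD⟩, ?_, ?_⟩
    · exact Submodule.apply_mem_map₂ (TensorProduct.mk k X.carrier (trivialComodule k m).carrier) hx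
        Submodule.mem_top
    · rw [cotensorIncl_apply, trivialRid_tmul_one]

end Cotensor

/-! ### The double complex of a resolution; Cotor as Koszul cohomology -/

section Resolution

variable {k : Type u} [CommRing k] {m : ℕ} {A : RightComodule k (SymCoalg k m)}

/-- The Koszul complexes of the terms of a resolution by retracts of cofree comodules form a double
complex with exact rows and columns; `T` and `G` select the part in question. -/
theorem ComoduleResolution.isResolvingDoubleComplex (R : ComoduleResolution A)
    {T : ℕ → Submodule k A.carrier} {G : ∀ p, ℕ → Submodule k (R.X p).carrier}
    (aug_mem : ∀ n, ∀ x ∈ T n, R.aug x ∈ G 0 n)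
    (d_mem : ∀ p n, ∀ x ∈ G p n, R.d p x ∈ G (p + 1) n)
    (t_mem : ∀ p n i, ∀ x ∈ G p n, partialOp (R.X p) i x ∈ G p (n + 1))
    (row_exact_zero : ∀ n x, R.aug x ∈ G 0 n → ∃ y ∈ T n, R.aug y = R.aug x)
    (row_exact : ∀ p n x, R.d p x ∈ G (p + 1) n → ∃ y ∈ G p n, R.d p y = R.d p x)
    (col_exact : ∀ p n, ∀ z ∈ kSub m (G p (n + 1)) (n + 1), koszulOp (partialOp (R.X p)) z = 0 →
      ∃ w ∈ kSub m (G p n) n, koszulOp (partialOp (R.X p)) w = z) :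
    IsResolvingDoubleComplex (fun n => kSub m (T n) n) (koszulOp (partialOp A))
      (M := fun p => (R.X p).carrier ⊗[k] ExtCoalg k m) (R.aug.rTensor (ExtCoalg k m))
      (fun p n => kSub m (G p n) n) (fun p => (R.d p).rTensor (ExtCoalg k m))
      (fun p => koszulOp (partialOp (R.X p))) where
  aug_injective := by
    intro z w h
    apply (kCoord (k := k) (m := m)).injective
    ext J
    apply R.aug_injective
    rw [← kCoord_rTensor, ← kCoord_rTensor, h]
  aug_mem n x hx := rTensor_mem_kSub (aug_mem n) hx
  aug_comm x := koszulOp_rTensor (fun i => coeffOp_hom R.aug_hom _) x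
  d_aug x := by
    rw [← LinearMap.comp_apply, ← LinearMap.rTensor_comp,
      R.exact_zero.linearMap_comp_eq_zero, LinearMap.rTensor_zero, LinearMap.zero_apply]
  d_mem p n x hx := rTensor_mem_kSub (d_mem p n) hx
  d_comm p x := koszulOp_rTensor (fun i => coeffOp_hom (R.d_hom p) _) x
  d_d p x := by
    rw [← LinearMap.comp_apply, ← LinearMap.rTensor_comp, R.d_comp, LinearMap.rTensor_zero,
      LinearMap.zero_apply]
  D_mem p n x hx := koszulOp_mem_kSub (t_mem p n) hx
  D_D p x := LinearMap.congr_fun (koszulOp_comp_self (partialOp_comm (R.X p))) x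
  row_exact_zero n z hz h := by
    -- Each coordinate is lifted by exactness of the resolution, and the lift is then corrected so
    -- as to lie in the selected part.
    refine exists_rTensor_eq hz fun J => ?_
    have h0 : R.d 0 (kCoord z J) = 0 := by
      rw [← kCoord_rTensor, h, map_zero, Finsupp.zero_apply]
    obtain ⟨x, hx⟩ := (R.exact_zero _).1 h0
    obtain ⟨y, hy, hyx⟩ := row_exact_zero n x (hx ▸ (mem_kSub_iff.1 hz J).1)
    exact ⟨y, hy, hyx.trans hx⟩
  row_exact p n z hz h := by
    refine exists_rTensor_eq hz fun J => ?_
    have h0 : R.d (p + 1) (kCoord z J) = 0 := by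
      rw [← kCoord_rTensor, h, map_zero, Finsupp.zero_apply]
    obtain ⟨x, hx⟩ := (R.exact_succ p _).1 h0
    obtain ⟨y, hy, hyx⟩ := row_exact p n x (hx ▸ (mem_kSub_iff.1 hz J).1)
    exact ⟨y, hy, hyx.trans hx⟩
  col_exact := col_exact

theorem cotensorIncl_rTensor {X Y : RightComodule k (SymCoalg k m)} {f : X.carrier →ₗ[k] Y.carrier}
    (hf : IsComoduleHom X Y f) (z : cotensor X (trivialComodule k m)) :
    cotensorIncl Y (((f.rTensor (trivialComodule k m).carrier).restrict
      (cotensor_map_mem (trivialComodule k m) hf)) z) =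
        f.rTensor (ExtCoalg k m) (cotensorIncl X z) := by
  rw [cotensorIncl_apply, cotensorIncl_apply, LinearMap.rTensor_tmul]
  congr 1
  change trivialRid Y (f.rTensor (trivialComodule k m).carrier z.1) = f (trivialRid X z.1)
  obtain ⟨x, hx⟩ := exists_tmul_trivialOne X z.1
  rw [← hx, LinearMap.rTensor_tmul, trivialRid_tmul_one, trivialRid_tmul_one]

/-- Cotor is calculated by the Koszul complex. -/
theorem ComoduleResolution.nonempty_koszul_equiv_cotor (R : ComoduleResolution A)
    (hR : R.IsInjective) (n : ℕ) :
    Nonempty (Subquot (kSub m ⊤ n ⊓ LinearMap.ker (koszulOp (partialOp A)))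
      (prevImage (koszulOp (partialOp A)) (fun n => kSub m ⊤ n) n) ≃ₗ[k]
        R.cotor (trivialComodule k m) n) := by
  have h := R.isResolvingDoubleComplex (T := fun _ => ⊤) (G := fun _ _ => ⊤)
    (fun _ _ _ => Submodule.mem_top) (fun _ _ _ _ => Submodule.mem_top)
    (fun _ _ _ _ _ => Submodule.mem_top) (fun _ x _ => ⟨x, Submodule.mem_top, rfl⟩)
    (fun _ _ x _ => ⟨x, Submodule.mem_top, rfl⟩) fun p n z hz hD =>
      (hR p).isCofreeRetract.exists_mem_kSub (π := LinearMap.id) (π' := LinearMap.id)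
        (fun _ => Submodule.mem_top) (fun _ _ => rfl) (fun _ _ => rfl) hz hD
  obtain ⟨e⟩ := h.nonempty_equiv n
  obtain ⟨e'⟩ := nonempty_homology_of_equiv
    (M := fun p => (R.X p).carrier ⊗[k] ExtCoalg k m)
    (d := fun p => (R.d p).rTensor (ExtCoalg k m))
    (B := fun p => kSub m ⊤ 0 ⊓ LinearMap.ker (koszulOp (partialOp (R.X p))))
    (Y := fun p => cotensor (R.X p) (trivialComodule k m))
    (dY := fun p => R.cotensorD (trivialComodule k m) p)
    (fun n => by rw [← ModuleCat.ofHom_comp, R.cotensorD_comp]; rfl)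
    (fun p => cotensorIncl (R.X p)) (fun p => cotensorIncl_injective _)
    (fun p => by
      rw [← map_cotensorIncl, TensorProduct.map₂_mk_top_top_eq_top, Submodule.comap_top,
        Submodule.map_top])
    (fun p y => cotensorIncl_rTensor (R.d_hom p) y) n
  -- The edge of the double complex and the complex X^• ⊠ k differ only in the order in which the
  -- kernels are intersected.
  obtain ⟨e''⟩ := Subquot.nonempty_equiv_of_eq (inf_right_comm (kSub m ⊤ 0)
    (LinearMap.ker ((R.d n).rTensor (ExtCoalg k m)))
    (LinearMap.ker (koszulOp (partialOp (R.X n))))) (rfl : prevRange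
      (M := fun p => (R.X p).carrier ⊗[k] ExtCoalg k m)
      (fun p => (R.d p).rTensor (ExtCoalg k m)) (fun p => kSub m ⊤ 0 ⊓
        LinearMap.ker (koszulOp (partialOp (R.X p)))) n = _)
  exact ⟨(e.trans e'').trans e'.symm⟩

/-- The part of internal degree `e` of Cotor is calculated by the corresponding part of the Koszul
complex. -/
theorem GradedComoduleResolution.nonempty_koszul_equiv_cotorDeg {𝒜 : ℕ → Submodule k A.carrier}
    {α : ℕ → A.carrier →ₗ[k] A.carrier} (hα : IsProjFamily 𝒜 α)
    (R : GradedComoduleResolution (symGrading k m) A 𝒜) (hR : R.IsInjective) (n e : ℕ) :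
    Nonempty (Subquot (kSub m (strand 𝒜 e n) n ⊓ LinearMap.ker (koszulOp (partialOp A)))
      (prevImage (koszulOp (partialOp A)) (fun n => kSub m (strand 𝒜 e n) n) n) ≃ₗ[k]
        R.cotorDeg (trivialComodule k m) n e) := by
  have hπ := fun p => IsProjFamily.of_isInternal (R.graded p).1
  choose π hπ using hπ
  have h := R.isResolvingDoubleComplex (T := strand 𝒜 e) (G := fun p => strand (R.gr p) e)
    (fun _ _ => apply_mem_strand R.aug_homogeneous)
    (fun p _ _ => apply_mem_strand (R.d_homogeneous p))
    (fun p _ i _ => partialOp_mem_strand (R.graded p) i)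
    (fun _ _ => exists_mem_strand R.aug_homogeneous hα (hπ 0))
    (fun p _ _ => exists_mem_strand (R.d_homogeneous p) (hπ p) (hπ (p + 1)))
    fun p n z hz hD => ((hR p).isCofreeRetract (R.graded p)).exists_mem_kSub_strand (R.graded p)
      hz hD
  obtain ⟨e₁⟩ := h.nonempty_equiv n
  obtain ⟨e₂⟩ := nonempty_homology_of_equiv
    (M := fun p => (R.X p).carrier ⊗[k] ExtCoalg k m)
    (d := fun p => (R.d p).rTensor (ExtCoalg k m))
    (B := fun p => kSub m (strand (R.gr p) e 0) 0 ⊓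
      LinearMap.ker (koszulOp (partialOp (R.X p))))
    (Y := fun p => R.cotensorDeg (trivialComodule k m) e p)
    (dY := fun p => R.cotensorDegD (trivialComodule k m) e p)
    (fun n => by
      rw [← ModuleCat.ofHom_comp]
      have : R.cotensorDegD (trivialComodule k m) e (n + 1) ∘ₗ
          R.cotensorDegD (trivialComodule k m) e n = 0 :=
        LinearMap.ext fun x => Subtype.ext
          (LinearMap.congr_fun (R.cotensorD_comp (trivialComodule k m) n) x.1)
      rw [this]; rfl)
    (fun p => cotensorIncl (R.X p) ∘ₗ (R.cotensorDeg (trivialComodule k m) e p).subtype)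
    (fun p => (cotensorIncl_injective _).comp Subtype.val_injective)
    (fun p => by
      rw [LinearMap.range_comp, Submodule.range_subtype]
      -- In position 0 the strand of internal degree e unfolds to the part of degree e of the
      -- comodule itself.
      exact map_cotensorIncl (R.X p) (R.gr p e))
    (fun p y => cotensorIncl_rTensor (R.d_hom p) y.1) n
  obtain ⟨e₃⟩ := Subquot.nonempty_equiv_of_eq (inf_right_comm (kSub m (strand (R.gr n) e 0) 0)
    (LinearMap.ker ((R.d n).rTensor (ExtCoalg k m)))
    (LinearMap.ker (koszulOp (partialOp (R.X n))))) (rfl : prevRange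
      (M := fun p => (R.X p).carrier ⊗[k] ExtCoalg k m)
      (fun p => (R.d p).rTensor (ExtCoalg k m)) (fun p => kSub m (strand (R.gr p) e 0) 0 ⊓
        LinearMap.ker (koszulOp (partialOp (R.X p)))) n = _)
  exact ⟨(e₁.trans e₃).trans e₂.symm⟩

end Resolution

/-! ### Quasi-isomorphisms tested on elements -/

section QuasiIso

variable {k : Type u} [CommRing k]

theorem exists_iCycles_eq (S : ShortComplex (ModuleCat.{u} k)) (x : S.X₂) (hx : S.g.hom x = 0) :
    ∃ c : S.cycles, S.iCycles.hom c = x :=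
  ⟨S.moduleCatCyclesIso.inv.hom ⟨x, hx⟩,
    LinearMap.congr_fun (congrArg ModuleCat.Hom.hom S.moduleCatCyclesIso_inv_iCycles)
      (⟨x, hx⟩ : LinearMap.ker S.g.hom)⟩

theorem homologyπ_eq_zero_iff (S : ShortComplex (ModuleCat.{u} k)) (c : S.cycles) :
    S.homologyπ.hom c = 0 ↔ ∃ x, S.f.hom x = S.iCycles.hom c := by
  have h1 := LinearMap.congr_fun (congrArg ModuleCat.Hom.hom S.π_moduleCatCyclesIso_hom) c
  have h2 := LinearMap.congr_fun (congrArg ModuleCat.Hom.hom S.moduleCatCyclesIso_hom_i) c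
  let c' : LinearMap.ker S.g.hom := S.moduleCatCyclesIso.hom.hom c
  have h3 : S.homologyπ.hom c = 0 ↔ S.moduleCatHomologyIso.hom.hom (S.homologyπ.hom c) = 0 :=
    (map_eq_zero_iff S.moduleCatHomologyIso.hom.hom
      S.moduleCatHomologyIso.toLinearEquiv.injective).symm
  have h4 : S.moduleCatHomologyIso.hom.hom (S.homologyπ.hom c) =
      (LinearMap.range S.moduleCatToCycles).mkQ c' := h1
  have h5 : c'.1 = S.iCycles.hom c := h2
  rw [h3, h4, ← h5]
  refine (Submodule.Quotient.mk_eq_zero (LinearMap.range S.moduleCatToCycles)).trans ?_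
  constructor
  · rintro ⟨x, hx⟩
    exact ⟨x, congrArg Subtype.val hx⟩
  · rintro ⟨x, hx⟩
    exact ⟨x, Subtype.ext hx⟩

/-- A criterion in terms of elements for a morphism of short complexes of modules to be a
quasi-isomorphism. -/
theorem isIso_homologyMap_of_elements {S S' : ShortComplex (ModuleCat.{u} k)} (φ : S ⟶ S')
    (hinj : ∀ x : S.X₂, S.g.hom x = 0 → (∃ w, S'.f.hom w = φ.τ₂.hom x) → ∃ w, S.f.hom w = x)
    (hsurj : ∀ z : S'.X₂, S'.g.hom z = 0 →
      ∃ x : S.X₂, S.g.hom x = 0 ∧ ∃ w, S'.f.hom w = z - φ.τ₂.hom x) :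
    IsIso (ShortComplex.homologyMap φ) := by
  have hπ : ∀ c, (ShortComplex.homologyMap φ).hom (S.homologyπ.hom c) =
      S'.homologyπ.hom ((ShortComplex.cyclesMap φ).hom c) := fun c =>
    LinearMap.congr_fun (congrArg ModuleCat.Hom.hom (ShortComplex.homologyπ_naturality φ)) c
  have hi : ∀ c, S'.iCycles.hom ((ShortComplex.cyclesMap φ).hom c) =
      φ.τ₂.hom (S.iCycles.hom c) := fun c =>
    LinearMap.congr_fun (congrArg ModuleCat.Hom.hom (ShortComplex.cyclesMap_i φ)) c
  have hg : ∀ (S : ShortComplex (ModuleCat.{u} k)) (c : S.cycles),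
      S.g.hom (S.iCycles.hom c) = 0 := fun S c =>
    LinearMap.congr_fun (congrArg ModuleCat.Hom.hom S.iCycles_g) c
  have hs : ∀ S : ShortComplex (ModuleCat.{u} k), Function.Surjective S.homologyπ.hom := fun S =>
    (ModuleCat.epi_iff_surjective S.homologyπ).1 inferInstance
  have hm : Function.Injective S'.iCycles.hom :=
    (ModuleCat.mono_iff_injective S'.iCycles).1 inferInstance
  rw [ConcreteCategory.isIso_iff_bijective]
  constructor
  · refine (injective_iff_map_eq_zero (ShortComplex.homologyMap φ).hom).2 fun h hh => ?_
    obtain ⟨c, rfl⟩ := hs S h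
    rw [hπ, homologyπ_eq_zero_iff, hi] at hh
    exact (homologyπ_eq_zero_iff S c).2 (hinj _ (hg S c) hh)
  · intro h
    obtain ⟨z, rfl⟩ := hs S' h
    obtain ⟨x, hx, w, hw⟩ := hsurj (S'.iCycles.hom z) (hg S' z)
    obtain ⟨c, rfl⟩ := exists_iCycles_eq S x hx
    refine ⟨S.homologyπ.hom c, ?_⟩
    refine (hπ c).trans ?_
    symm
    rw [← sub_eq_zero, ← map_sub, homologyπ_eq_zero_iff]
    exact ⟨w, by rw [hw, map_sub, hi]⟩

/-- Being a cycle is stated for all l with l + 1 = q, so that it is no condition in degree 0. The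
assumption `hinj` concerns all chains and not only cycles, which the retraction onto the cellular
chains makes available. -/
theorem quasiIso_of_elements {C C' : ChainComplex (ModuleCat.{u} k) ℕ} (φ : C ⟶ C')
    (hinj : ∀ q (x : C.X q), (∃ w, (C'.d (q + 1) q).hom w = (φ.f q).hom x) →
      ∃ w, (C.d (q + 1) q).hom w = x)
    (hsurj : ∀ q (z : C'.X q), (∀ l, l + 1 = q → (C'.d q l).hom z = 0) →
      ∃ x : C.X q, (∀ l, l + 1 = q → (C.d q l).hom x = 0) ∧
        ∃ w, (C'.d (q + 1) q).hom w = z - (φ.f q).hom x) : QuasiIso φ := by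
  refine ⟨fun q => ?_⟩
  obtain _ | q := q
  · rw [quasiIsoAt_iff' φ 1 0 0 (by simp) (by simp), ShortComplex.quasiIso_iff]
    refine isIso_homologyMap_of_elements _ (fun x _ h => hinj 0 x h) fun z _ => ?_
    obtain ⟨x, -, hw⟩ := hsurj 0 z fun l hl => by omega
    refine ⟨x, ?_, hw⟩
    change (C.d 0 0).hom x = 0
    rw [C.shape 0 0 (by simp)]
    rfl
  · rw [quasiIsoAt_iff' φ (q + 1 + 1) (q + 1) q (by simp) (by simp), ShortComplex.quasiIso_iff]
    refine isIso_homologyMap_of_elements _ (fun x _ h => hinj (q + 1) x h) fun z hz => ?_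
    obtain ⟨x, hx, hw⟩ := hsurj (q + 1) z fun l hl => by
      obtain rfl : l = q := by omega
      exact hz
    exact ⟨x, hx q rfl, hw⟩

end QuasiIso

/-! ### Monomial bases and the two gradings of the Koszul complex -/

section Bases

variable (k : Type u) [CommRing k] {m : ℕ}

/-- The basis of `C(S)` that consists of monomials. -/
def avoidBasis (S : Set (Fin m →₀ ℕ)) :
    Module.Basis {a : Fin m →₀ ℕ // ∀ b ∈ S, ¬ b ≤ a} k (avoid k S) :=
  Module.Basis.mk (v := fun a => ⟨mono k m a.1, mono_mem_avoid k a.2⟩)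
    (LinearIndependent.of_comp (avoid k S).subtype
      ((mono k m).linearIndependent.comp Subtype.val Subtype.val_injective)) (by
    rw [← Submodule.map_le_map_iff_of_injective (avoid k S).injective_subtype, Submodule.map_top,
      Submodule.range_subtype, Submodule.map_span, ← Set.range_comp]
    refine Submodule.span_mono ?_
    rintro _ ⟨a, ha, rfl⟩
    exact ⟨⟨a, ha⟩, rfl⟩)

theorem coe_avoidBasis (S : Set (Fin m →₀ ℕ)) (a : {a : Fin m →₀ ℕ // ∀ b ∈ S, ¬ b ≤ a}) :
    (avoidBasis k S a : SymCoalg k m) = mono k m a.1 := by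
  rw [avoidBasis, Module.Basis.mk_apply]

theorem span_basis_inf {M ι : Type*} [AddCommGroup M] [Module k M] (b : Module.Basis ι k M)
    (s t : Set ι) : Submodule.span k (b '' s) ⊓ Submodule.span k (b '' t) =
      Submodule.span k (b '' (s ∩ t)) := by
  ext x
  rw [Submodule.mem_inf, b.mem_span_image, b.mem_span_image, b.mem_span_image,
    Set.subset_inter_iff]

variable (K : AbstractSimplicialComplex (Fin m))

/-- The exponent vectors of the monomials of `k⟨K⟩`. -/
abbrev FaceExp : Type := {a : Fin m →₀ ℕ // ∀ b ∈ missingMonomials K, ¬ b ≤ a}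

theorem faceGrading_eq_span (e : ℕ) : faceGrading k K e =
    Submodule.span k (avoidBasis k (missingMonomials K) '' {a | 2 * a.1.degree = e}) := by
  apply Submodule.map_injective_of_injective (avoid k (missingMonomials K)).injective_subtype
  rw [faceGrading, Submodule.map_comap_subtype, Submodule.map_span, symGrading]
  refine (span_basis_inf k (mono k m) _ _).trans ?_
  rw [Set.image_image]
  congr 1
  ext x
  constructor
  · rintro ⟨a, ⟨h1, h2⟩, rfl⟩
    exact ⟨⟨a, h1⟩, h2, coe_avoidBasis k _ _⟩
  · rintro ⟨a, h, rfl⟩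
    exact ⟨a.1, ⟨a.2, h⟩, (coe_avoidBasis k _ _).symm⟩

/-- The basis of `k⟨K⟩ ⊗ Λ⟨y_1, …, y_m⟩` that consists of the tensors `x^a ⊗ y_J`. -/
def koszulBasis :
    Module.Basis (FaceExp K × Finset (Fin m)) k (FaceCoalg k K ⊗[k] ExtCoalg k m) :=
  (avoidBasis k (missingMonomials K)).tensorProduct (yBasis k m)

theorem koszulBasis_apply (p : FaceExp K × Finset (Fin m)) :
    koszulBasis k K p = avoidBasis k (missingMonomials K) p.1 ⊗ₜ yMono k p.2 := by
  rw [koszulBasis, Module.Basis.tensorProduct_apply', yBasis_apply]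

theorem kSub_span_avoidBasis (s : Set (FaceExp K)) (n : ℕ) :
    kSub m (Submodule.span k (avoidBasis k (missingMonomials K) '' s)) n =
      Submodule.span k (koszulBasis k K '' {p | p.1 ∈ s ∧ #p.2 = n}) := by
  rw [kSub, exteriorPower_eq_span, Submodule.map₂_span_span, Set.image2_image_left,
    Set.image2_image_right]
  congr 1
  ext z
  constructor
  · rintro ⟨a, ha, J, hJ, rfl⟩
    exact ⟨(a, J), ⟨ha, hJ⟩, by simp [koszulBasis_apply, yBasis_apply]⟩
  · rintro ⟨⟨a, J⟩, ⟨ha, hJ⟩, rfl⟩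
    exact ⟨a, ha, J, hJ, by simp [koszulBasis_apply, yBasis_apply]⟩

theorem kSub_top_eq_span (n : ℕ) : kSub m (⊤ : Submodule k (FaceCoalg k K)) n =
    Submodule.span k (koszulBasis k K '' {p | #p.2 = n}) := by
  rw [← (avoidBasis k (missingMonomials K)).span_eq, ← Set.image_univ, kSub_span_avoidBasis]
  simp

theorem koszulDeg_eq_span (q : ℕ) : koszulDeg k K q =
    Submodule.span k (koszulBasis k K '' {p | 2 * p.1.1.degree + #p.2 = q}) := by
  have h : ∀ p : ℕ × ℕ, Submodule.map₂ (TensorProduct.mk k (FaceCoalg k K) (ExtCoalg k m))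
      (faceGrading k K p.1) (⋀[k]^p.2 (Fin m → k)) = Submodule.span k (koszulBasis k K ''
        {r | 2 * r.1.1.degree = p.1 ∧ #r.2 = p.2}) := fun p => by
    rw [faceGrading_eq_span]
    exact kSub_span_avoidBasis k K _ _
  simp only [koszulDeg, h]
  apply le_antisymm
  · refine iSup₂_le fun p hp => Submodule.span_mono (Set.image_mono fun r hr => ?_)
    rw [HasAntidiagonal.mem_antidiagonal] at hp
    rw [← hp, ← hr.1, ← hr.2]
    rfl
  · rw [Submodule.span_le]
    rintro _ ⟨r, hr, rfl⟩
    exact Submodule.mem_iSup_of_mem (2 * r.1.1.degree, #r.2) (Submodule.mem_iSup_of_mem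
      (HasAntidiagonal.mem_antidiagonal.2 hr) (Submodule.subset_span ⟨r, ⟨rfl, rfl⟩, rfl⟩))

/-- The tensor x^a ⊗ y_J with |J| = n has internal degree 2|a| + 2n and total degree 2|a| + n, so
internal degree q + n means total degree q. For n > q both sides are zero. -/
theorem kSub_strand_faceGrading (q n : ℕ) :
    kSub m (strand (faceGrading k K) (q + n) n) n = koszulDeg k K q ⊓ kSub m ⊤ n := by
  rw [koszulDeg_eq_span, kSub_top_eq_span, span_basis_inf, strand]
  split_ifs with h
  · rw [faceGrading_eq_span, kSub_span_avoidBasis]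
    congr 2
    ext p
    simp only [Set.mem_ofPred_eq, Set.mem_inter_iff]
    omega
  · have : {p : FaceExp K × Finset (Fin m) | 2 * p.1.1.degree + #p.2 = q} ∩ {p | #p.2 = n} = ∅ := by
      ext p
      simp only [Set.mem_ofPred_eq, Set.mem_inter_iff, Set.mem_empty_iff_false, iff_false, not_and]
      omega
    rw [this, Set.image_empty, Submodule.span_empty, kSub, Submodule.map₂_bot_left]

theorem isProjFamily_faceGrading : ∃ π, IsProjFamily (faceGrading k K) π := by
  rw [funext (faceGrading_eq_span k K)]
  exact ⟨_, isProjFamily_basisProj _ fun a : FaceExp K => 2 * a.1.degree⟩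

/-- The projections of the Koszul complex onto its parts of fixed total degree. -/
def totalProj (q : ℕ) : FaceCoalg k K ⊗[k] ExtCoalg k m →ₗ[k] FaceCoalg k K ⊗[k] ExtCoalg k m :=
  basisProj (koszulBasis k K) {p | 2 * p.1.1.degree + #p.2 = q}

theorem isProjFamily_totalProj : IsProjFamily (koszulDeg k K) (totalProj k K) := by
  rw [funext (koszulDeg_eq_span k K)]
  exact isProjFamily_basisProj _ fun p : FaceExp K × Finset (Fin m) => 2 * p.1.1.degree + #p.2

/-- The projections of the Koszul complex onto its parts with a fixed number of `y_i`. -/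
def extProj (n : ℕ) : FaceCoalg k K ⊗[k] ExtCoalg k m →ₗ[k] FaceCoalg k K ⊗[k] ExtCoalg k m :=
  basisProj (koszulBasis k K) {p | #p.2 = n}

theorem isProjFamily_extProj : IsProjFamily (koszulCoDeg k K) (extProj k K) := by
  rw [funext (f := koszulCoDeg k K) (kSub_top_eq_span k K)]
  exact isProjFamily_basisProj _ fun p : FaceExp K × Finset (Fin m) => #p.2

theorem extProj_mem_koszulDeg {q : ℕ} (n : ℕ) {z : FaceCoalg k K ⊗[k] ExtCoalg k m}
    (hz : z ∈ koszulDeg k K q) : extProj k K n z ∈ koszulDeg k K q := by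
  rw [koszulDeg_eq_span] at hz ⊢
  exact basisProj_mem_span _ _ _ hz

/-- Only the monomial 1 occurs in total degree 0. Hence the cycles of the ungraded operator agree
with those of the chain complex in degree 0, where there is no target left. -/
theorem koszulD_koszulDeg_zero {z : FaceCoalg k K ⊗[k] ExtCoalg k m} (hz : z ∈ koszulDeg k K 0) :
    koszulD k K z = 0 := by
  suffices h : koszulDeg k K 0 ≤ LinearMap.ker (koszulD k K) from h hz
  rw [koszulDeg_eq_span, Submodule.span_le]
  rintro _ ⟨p, hp, rfl⟩
  have ha : p.1.1.degree = 0 := by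
    have : 2 * p.1.1.degree + #p.2 = 0 := hp
    omega
  rw [SetLike.mem_coe, LinearMap.mem_ker, koszulBasis_apply]
  refine (koszulOp_tmul _ _ _).trans (Finset.sum_eq_zero fun i _ => ?_)
  have : contrAvoid k (missingMonomials K) i (avoidBasis k (missingMonomials K) p.1) = 0 := by
    refine Subtype.ext ?_
    change contr k i (avoidBasis k (missingMonomials K) p.1 : SymCoalg k m) = 0
    rw [coe_avoidBasis, contr_mono, if_pos]
    rw [(Finsupp.degree_eq_zero_iff _).1 ha]
    rfl
  rw [this, TensorProduct.zero_tmul]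

theorem totalProj_koszulD (q : ℕ) (z : FaceCoalg k K ⊗[k] ExtCoalg k m) :
    totalProj k K q (koszulD k K z) = koszulD k K (totalProj k K (q + 1) z) := by
  have h := isProjFamily_totalProj k K
  refine h.linearMap_ext (f := totalProj k K q ∘ₗ koszulD k K)
    (g := koszulD k K ∘ₗ totalProj k K (q + 1)) (fun e x hx => ?_) z
  simp only [LinearMap.comp_apply]
  obtain _ | e := e
  · rw [koszulD_koszulDeg_zero k K hx, h.kill _ _ (by omega) _ hx, map_zero, map_zero]
  · have hD := koszulD_mem_deg k K e x hx
    by_cases he : e = q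
    · subst he
      rw [h.fix _ _ hx, h.fix _ _ hD]
    · rw [h.kill _ _ (by omega) _ hx, h.kill _ _ he _ hD, map_zero]

theorem extProj_zero_koszulD (z : FaceCoalg k K ⊗[k] ExtCoalg k m) :
    extProj k K 0 (koszulD k K z) = 0 := by
  have h := isProjFamily_extProj k K
  have h' : extProj k K 0 ∘ₗ koszulD k K = 0 := LinearMap.ext <| h.linearMap_ext fun e x hx =>
    h.kill (e + 1) 0 e.succ_ne_zero _ (koszulD_mem_coDeg k K e x hx)
  exact LinearMap.congr_fun h' z

theorem extProj_succ_koszulD (n : ℕ) (z : FaceCoalg k K ⊗[k] ExtCoalg k m) :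
    extProj k K (n + 1) (koszulD k K z) = koszulD k K (extProj k K n z) := by
  have h := isProjFamily_extProj k K
  suffices h' : extProj k K (n + 1) ∘ₗ koszulD k K = koszulD k K ∘ₗ extProj k K n from
    LinearMap.congr_fun h' z
  refine LinearMap.ext <| h.linearMap_ext fun e x hx => ?_
  rw [LinearMap.comp_apply, LinearMap.comp_apply]
  have hD := koszulD_mem_coDeg k K e x hx
  by_cases he : e = n
  · subst he
    rw [h.fix _ _ hx, h.fix _ _ hD]
  · rw [h.kill _ _ he _ hx, h.kill _ _ (by omega) _ hD, map_zero]

theorem totalProj_mem_ker {z : FaceCoalg k K ⊗[k] ExtCoalg k m} (hz : koszulD k K z = 0) (q : ℕ) :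
    koszulD k K (totalProj k K q z) = 0 := by
  obtain _ | q := q
  · exact koszulD_koszulDeg_zero k K ((isProjFamily_totalProj k K).mem 0 z)
  · rw [← totalProj_koszulD, hz, map_zero]

theorem extProj_mem_ker {z : FaceCoalg k K ⊗[k] ExtCoalg k m} (hz : koszulD k K z = 0) (n : ℕ) :
    koszulD k K (extProj k K n z) = 0 := by
  rw [← extProj_succ_koszulD, hz, map_zero]

/-- A homogeneous boundary is already the boundary of a homogeneous component of any primitive. The
graded homology can therefore be computed from ker ∂ and im ∂ of the whole complex. -/
theorem range_inf_koszulDeg (q : ℕ) : LinearMap.range (koszulD k K) ⊓ koszulDeg k K q =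
    (koszulDeg k K (q + 1)).map (koszulD k K) := by
  have h := isProjFamily_totalProj k K
  ext z
  constructor
  · rintro ⟨⟨w, rfl⟩, hz⟩
    refine ⟨totalProj k K (q + 1) w, h.mem _ _, ?_⟩
    rw [← totalProj_koszulD, h.fix _ _ hz]
  · rintro ⟨w, hw, rfl⟩
    exact ⟨⟨w, rfl⟩, koszulD_mem_deg k K q w hw⟩

theorem range_inf_kSub (n : ℕ) : LinearMap.range (koszulD k K) ⊓ kSub m ⊤ n =
    prevImage (koszulD k K) (fun n => kSub m ⊤ n) n := by
  have h := isProjFamily_extProj k K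
  ext z
  obtain _ | n := n
  · constructor
    · rintro ⟨⟨w, rfl⟩, hz⟩
      refine (Submodule.mem_bot k).2 ?_
      rw [← h.fix 0 _ hz, extProj_zero_koszulD]
    · intro hz
      rw [(Submodule.mem_bot k).1 hz]
      exact Submodule.zero_mem _
  · constructor
    · rintro ⟨⟨w, rfl⟩, hz⟩
      refine ⟨extProj k K n w, h.mem _ _, ?_⟩
      rw [← extProj_succ_koszulD, h.fix _ _ hz]
    · rintro ⟨w, hw, rfl⟩
      exact ⟨⟨w, rfl⟩, koszulD_mem_coDeg k K n w hw⟩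

theorem map_koszulDeg_inf_kSub (q n : ℕ) :
    (koszulDeg k K (q + 1)).map (koszulD k K) ⊓ kSub m ⊤ n =
      prevImage (koszulD k K) (fun l => kSub m (strand (faceGrading k K) (q + n) l) l) n := by
  have h := isProjFamily_extProj k K
  ext z
  obtain _ | n := n
  · constructor
    · rintro ⟨⟨w, -, rfl⟩, hz⟩
      refine (Submodule.mem_bot k).2 ?_
      rw [← h.fix 0 _ hz, extProj_zero_koszulD]
    · intro hz
      rw [(Submodule.mem_bot k).1 hz]
      exact Submodule.zero_mem _
  -- One position earlier the same internal degree corresponds to the total degree q + 1.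
  · rw [prevImage, show q + (n + 1) = q + 1 + n by omega, kSub_strand_faceGrading]
    constructor
    · rintro ⟨⟨w, hw, rfl⟩, hz⟩
      refine ⟨extProj k K n w, ⟨extProj_mem_koszulDeg k K n hw, h.mem _ _⟩, ?_⟩
      rw [← extProj_succ_koszulD, h.fix _ _ hz]
    · rintro ⟨w, hw, rfl⟩
      exact ⟨⟨w, hw.1, rfl⟩, koszulD_mem_coDeg k K n w hw.2⟩

end Bases

/-! ### Homology of the Koszul complex of the face coalgebra, compared with Cotor -/

section Homology

variable (k : Type u) [CommRing k] {m : ℕ} (K : AbstractSimplicialComplex (Fin m))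

theorem koszulOp_partialOp_faceComodule :
    koszulOp (partialOp (faceComodule k K)) = koszulD k K := by
  rw [funext (partialOp_faceComodule K)]
  rfl

theorem koszulComplex_d (q : ℕ) (z : koszulDeg k K (q + 1)) :
    koszulIncl k K q (((koszulComplex k K).d (q + 1) q).hom z) = koszulD k K z.1 := by
  have h : ((koszulComplex k K).d (q + 1) q).hom =
      (koszulD k K).restrict (koszulD_mem_deg k K q) :=
    congrArg ModuleCat.Hom.hom (ChainComplex.of_d (fun q => ModuleCat.of k (koszulDeg k K q))
      (fun q => ModuleCat.ofHom ((koszulD k K).restrict (koszulD_mem_deg k K q))) q)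
  rw [h]
  rfl

theorem koszulIncl_injective (q : ℕ) : Function.Injective (koszulIncl k K q) :=
  Subtype.val_injective

theorem nonempty_koszulComplex_homology_equiv (q : ℕ) :
    Nonempty ((koszulComplex k K).homology q ≃ₗ[k] Subquot
      (LinearMap.ker (koszulD k K) ⊓ koszulDeg k K q)
      (LinearMap.range (koszulD k K) ⊓ koszulDeg k K q)) := by
  refine nonempty_chain_homology_equiv _ q (koszulIncl k K q) (koszulIncl_injective k K q) ?_ ?_ ?_
  · rw [range_inf_koszulDeg]
    ext z
    constructor
    · rintro ⟨_, ⟨w, rfl⟩, rfl⟩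
      exact ⟨w.1, w.2, (koszulComplex_d k K q w).symm⟩
    · rintro ⟨w, hw, rfl⟩
      exact ⟨_, ⟨⟨w, hw⟩, rfl⟩, koszulComplex_d k K q ⟨w, hw⟩⟩
  · rintro rfl
    refine (inf_eq_right.2 fun z hz => koszulD_koszulDeg_zero k K hz).trans ?_
    exact (Submodule.range_subtype _).symm
  · rintro l rfl
    ext z
    constructor
    · rintro ⟨w, hw, rfl⟩
      refine ⟨?_, w.2⟩
      have := koszulComplex_d k K l w
      rw [LinearMap.mem_ker.1 hw, map_zero] at this
      exact this.symm
    · rintro ⟨hz, hz'⟩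
      exact ⟨⟨z, hz'⟩, koszulIncl_injective k K l
        ((koszulComplex_d k K l ⟨z, hz'⟩).trans (hz.trans (map_zero _).symm)), rfl⟩

theorem nonempty_koszulCoComplex_homology_equiv (n : ℕ) :
    Nonempty ((koszulCoComplex k K).homology n ≃ₗ[k] Subquot
      (LinearMap.ker (koszulD k K) ⊓ kSub m ⊤ n) (LinearMap.range (koszulD k K) ⊓ kSub m ⊤ n)) := by
  obtain ⟨e⟩ := nonempty_homology_of_equiv (M := fun _ => FaceCoalg k K ⊗[k] ExtCoalg k m)
    (d := fun _ => koszulD k K) (B := fun n => kSub m ⊤ n) (Y := fun n => koszulCoDeg k K n)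
    (dY := fun n => (koszulD k K).restrict (koszulD_mem_coDeg k K n))
    (fun n => by
      rw [← ModuleCat.ofHom_comp]
      have : (koszulD k K).restrict (koszulD_mem_coDeg k K (n + 1)) ∘ₗ
          (koszulD k K).restrict (koszulD_mem_coDeg k K n) = 0 :=
        LinearMap.ext fun x => Subtype.ext (LinearMap.congr_fun (koszulD_comp k K) x.1)
      rw [this]; rfl)
    (fun n => (koszulCoDeg k K n).subtype) (fun n => Subtype.val_injective)
    (fun n => Submodule.range_subtype _) (fun _ _ => rfl) n
  obtain ⟨e'⟩ := Subquot.nonempty_equiv_of_eq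
    (inf_comm (kSub m ⊤ n) (LinearMap.ker (koszulD k K)))
    (show prevRange (fun _ => koszulD k K) (fun n => kSub m ⊤ n) n =
      LinearMap.range (koszulD k K) ⊓ kSub m ⊤ n by
        rw [range_inf_kSub]; cases n <;> rfl)
  exact ⟨e.trans e'⟩

theorem ComoduleResolution.nonempty_subquot_equiv_cotor (R : ComoduleResolution (faceComodule k K))
    (hR : R.IsInjective) (n : ℕ) : Nonempty (Subquot
      (LinearMap.ker (koszulD k K) ⊓ kSub m ⊤ n) (LinearMap.range (koszulD k K) ⊓ kSub m ⊤ n) ≃ₗ[k]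
        R.cotor (trivialComodule k m) n) := by
  obtain ⟨e⟩ := R.nonempty_koszul_equiv_cotor hR n
  rw [koszulOp_partialOp_faceComodule] at e
  obtain ⟨e'⟩ := Subquot.nonempty_equiv_of_eq
    (inf_comm (LinearMap.ker (koszulD k K)) (kSub m ⊤ n)) (range_inf_kSub k K n)
  exact ⟨e'.trans e⟩

/-- The total homology of the Koszul complex is the direct sum of its homology modules with
respect to the total degree, and also with respect to the number of factors `y_i`. -/
theorem nonempty_directSum_subquot_equiv :
    Nonempty ((⨁ q, Subquot (LinearMap.ker (koszulD k K) ⊓ koszulDeg k K q)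
      (LinearMap.range (koszulD k K) ⊓ koszulDeg k K q)) ≃ₗ[k]
      ⨁ n, Subquot (LinearMap.ker (koszulD k K) ⊓ kSub m ⊤ n)
        (LinearMap.range (koszulD k K) ⊓ kSub m ⊤ n)) := by
  obtain ⟨e⟩ := (isProjFamily_totalProj k K).nonempty_subquot_equiv
    (Z := LinearMap.ker (koszulD k K)) (N := LinearMap.range (koszulD k K))
    (fun q z hz => totalProj_mem_ker k K hz q) (by
      rintro q _ ⟨w, rfl⟩
      exact ⟨_, (totalProj_koszulD k K q w).symm⟩)
  obtain ⟨e'⟩ := (isProjFamily_extProj k K).nonempty_subquot_equiv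
    (Z := LinearMap.ker (koszulD k K)) (N := LinearMap.range (koszulD k K))
    (fun n z hz => extProj_mem_ker k K hz n) (by
      rintro n _ ⟨w, rfl⟩
      obtain _ | n := n
      · rw [extProj_zero_koszulD]
        exact Submodule.zero_mem _
      · exact ⟨_, (extProj_succ_koszulD k K n w).symm⟩)
  exact ⟨e.symm.trans e'⟩

/-- The homology in total degree q splits by the number n of factors y_i. The n-th summand is the
cohomology at position n of the strand of internal degree q + n, to which the graded double complex
applies. -/
theorem GradedComoduleResolution.nonempty_subquot_equiv_cotorDeg
    (R : GradedComoduleResolution (symGrading k m) (faceComodule k K) (faceGrading k K))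
    (hR : R.IsInjective) (q : ℕ) :
    Nonempty (Subquot (LinearMap.ker (koszulD k K) ⊓ koszulDeg k K q)
      (LinearMap.range (koszulD k K) ⊓ koszulDeg k K q) ≃ₗ[k]
        ⨁ n : ℕ, R.cotorDeg (trivialComodule k m) n (q + n)) := by
  obtain ⟨π, hπ⟩ := isProjFamily_faceGrading k K
  obtain ⟨e⟩ := (isProjFamily_extProj k K).nonempty_subquot_equiv
    (Z := LinearMap.ker (koszulD k K) ⊓ koszulDeg k K q)
    (N := LinearMap.range (koszulD k K) ⊓ koszulDeg k K q)
    (fun n z hz => ⟨extProj_mem_ker k K hz.1 n, extProj_mem_koszulDeg k K n hz.2⟩) (by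
      rintro n _ ⟨⟨w, rfl⟩, hz⟩
      refine ⟨?_, extProj_mem_koszulDeg k K n hz⟩
      obtain _ | n := n
      · rw [extProj_zero_koszulD]
        exact Submodule.zero_mem _
      · exact ⟨_, (extProj_succ_koszulD k K n w).symm⟩)
  have h : ∀ n, Nonempty (Subquot (LinearMap.ker (koszulD k K) ⊓ koszulDeg k K q ⊓ kSub m ⊤ n)
      (LinearMap.range (koszulD k K) ⊓ koszulDeg k K q ⊓ kSub m ⊤ n) ≃ₗ[k]
        R.cotorDeg (trivialComodule k m) n (q + n)) := fun n => by
    obtain ⟨e⟩ := R.nonempty_koszul_equiv_cotorDeg hπ hR n (q + n)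
    rw [koszulOp_partialOp_faceComodule] at e
    obtain ⟨e'⟩ := Subquot.nonempty_equiv_of_eq
      (Z := LinearMap.ker (koszulD k K) ⊓ koszulDeg k K q ⊓ kSub m ⊤ n)
      (Z' := kSub m (strand (faceGrading k K) (q + n) n) n ⊓ LinearMap.ker (koszulD k K))
      (by rw [kSub_strand_faceGrading, inf_assoc, inf_comm])
      ((congrArg (· ⊓ kSub m ⊤ n) (range_inf_koszulDeg k K q)).trans
        (map_koszulDeg_inf_kSub k K q n))
    exact ⟨e'.trans e⟩
  exact ⟨e.trans (DFinsupp.mapRange.linearEquiv fun n => (h n).some)⟩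

end Homology

/-! ### The cellular chains as a homotopy retract of the Koszul complex -/

section CellularPart

variable (k : Type u) [CommRing k] {m : ℕ}

theorem contr_comm (i l : Fin m) (x : SymCoalg k m) :
    contr k i (contr k l x) = contr k l (contr k i x) := by
  refine LinearMap.congr_fun (f := contr k i ∘ₗ contr k l) (g := contr k l ∘ₗ contr k i)
    ((mono k m).ext fun a => ?_) x
  by_cases hil : i = l
  · rw [hil]
  · have h1 : (Finsupp.single l 1 : Fin m →₀ ℕ) i = 0 := by simp [Ne.symm hil]
    have h2 : (Finsupp.single i 1 : Fin m →₀ ℕ) l = 0 := by simp [hil]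
    simp only [LinearMap.comp_apply, contr_mono]
    by_cases hi : a i = 0 <;> by_cases hl : a l = 0 <;>
      simp [hi, hl, contr_mono, h1, h2, tsub_right_comm]

/-- The operator that multiplies the monomials divisible by `x_i` by `x_i` and annihilates the
other ones. -/
def growGen (i : Fin m) : SymCoalg k m →ₗ[k] SymCoalg k m :=
  mulGen k i ∘ₗ mulGen k i ∘ₗ contr k i

theorem growGen_mono (i : Fin m) (a : Fin m →₀ ℕ) : growGen k i (mono k m a) =
    if a i = 0 then 0 else mono k m (a + Finsupp.single i 1) := by
  rw [growGen, LinearMap.comp_apply, LinearMap.comp_apply, mulGen_contr_mono]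
  split_ifs
  · rw [map_zero]
  · rw [mulGen_mono]

theorem contr_growGen_mono (i : Fin m) (a : Fin m →₀ ℕ) :
    contr k i (growGen k i (mono k m a)) = if a i = 0 then 0 else mono k m a := by
  rw [growGen, LinearMap.comp_apply, LinearMap.comp_apply, contr_mulGen_self, mulGen_contr_mono]

/-- An exponent 1 is first lowered to 0, and then the monomial is annihilated. Because of this,
tensors with x_i to the first power survive the projection when i ∉ J. -/
theorem growGen_contr_mono (i : Fin m) (a : Fin m →₀ ℕ) :
    growGen k i (contr k i (mono k m a)) = if a i ≤ 1 then 0 else mono k m a := by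
  rw [contr_mono]
  by_cases h0 : a i = 0
  · rw [if_pos h0, if_pos (by omega), map_zero]
  · have hle : Finsupp.single i 1 ≤ a := Finsupp.single_le_iff.2 (Nat.one_le_iff_ne_zero.2 h0)
    have h1 : (a - Finsupp.single i 1 : Fin m →₀ ℕ) i = a i - 1 := by simp
    rw [if_neg h0, growGen_mono, h1, tsub_add_cancel_of_le hle]
    exact if_congr (by omega) rfl rfl

theorem contr_growGen {i l : Fin m} (h : l ≠ i) (x : SymCoalg k m) :
    contr k l (growGen k i x) = growGen k i (contr k l x) := by
  simp only [growGen, LinearMap.comp_apply, contr_mulGen h, contr_comm k l i]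

variable (K : AbstractSimplicialComplex (Fin m))

/-- The monomials x_J are square-free, so raising a positive exponent creates no new divisor among
them. Plain multiplication by x_i could leave k⟨K⟩. -/
theorem growGen_mem_avoid (i : Fin m) : ∀ x ∈ avoid k (missingMonomials K),
    growGen k i x ∈ avoid k (missingMonomials K) := by
  classical
  suffices h : avoid k (missingMonomials K) ≤
      (avoid k (missingMonomials K)).comap (growGen k i) from h
  refine Submodule.span_le.2 ?_
  rintro _ ⟨a, ha, rfl⟩
  rw [SetLike.mem_coe, Submodule.mem_comap, growGen_mono]
  split_ifs with h0
  · exact Submodule.zero_mem _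
  · refine mono_mem_avoid k ?_
    rintro _ ⟨J, hJ, rfl⟩ hle
    refine ha _ ⟨J, hJ, rfl⟩ fun l => ?_
    have h1 := hle l
    by_cases hl : l = i
    · subst hl
      have : sqfree J l ≤ 1 := by
        simp only [sqfree, Finsupp.indicator_apply]
        split_ifs <;> simp
      omega
    · simpa [Ne.symm hl] using h1

/-- The restriction of `growGen` to `k⟨K⟩`. -/
def growFace (i : Fin m) : FaceCoalg k K →ₗ[k] FaceCoalg k K :=
  (growGen k i).restrict (growGen_mem_avoid k K i)

theorem contrAvoid_comm (i l : Fin m) (x : FaceCoalg k K) :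
    contrAvoid k (missingMonomials K) i (contrAvoid k (missingMonomials K) l x) =
      contrAvoid k (missingMonomials K) l (contrAvoid k (missingMonomials K) i x) :=
  Subtype.ext (contr_comm k i l x.1)

theorem koszulProj_koszulBasis (i : Fin m) (p : FaceExp K × Finset (Fin m)) :
    koszulProj (contrAvoid k (missingMonomials K)) (growFace k K i) i (koszulBasis k K p) =
      if (if i ∈ p.2 then p.1.1 i = 0 else p.1.1 i ≤ 1) then koszulBasis k K p else 0 := by
  rw [koszulBasis_apply, koszulProj_apply]
  · have h1 : contrAvoid k (missingMonomials K) i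
        (growFace k K i (avoidBasis k (missingMonomials K) p.1)) =
          if p.1.1 i = 0 then 0 else avoidBasis k (missingMonomials K) p.1 := by
      refine Subtype.ext ?_
      refine (congrArg (fun x => contr k i (growGen k i x)) (coe_avoidBasis k _ p.1)).trans ?_
      refine (contr_growGen_mono k i p.1.1).trans ?_
      split_ifs
      · rfl
      · exact (coe_avoidBasis k _ p.1).symm
    have h2 : growFace k K i (contrAvoid k (missingMonomials K) i
        (avoidBasis k (missingMonomials K) p.1)) =
          if p.1.1 i ≤ 1 then 0 else avoidBasis k (missingMonomials K) p.1 := by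
      refine Subtype.ext ?_
      refine (congrArg (fun x => growGen k i (contr k i x)) (coe_avoidBasis k _ p.1)).trans ?_
      refine (growGen_contr_mono k i p.1.1).trans ?_
      split_ifs
      · rfl
      · exact (coe_avoidBasis k _ p.1).symm
    rw [h1, h2]
    split_ifs <;> simp
  · exact fun l hl x => Subtype.ext (contr_growGen k hl x.1)

/-- The projection of the Koszul complex onto the cellular chains. -/
def cellProj : FaceCoalg k K ⊗[k] ExtCoalg k m →ₗ[k] FaceCoalg k K ⊗[k] ExtCoalg k m :=
  ((univ : Finset (Fin m)).toList.map fun i =>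
    koszulProj (contrAvoid k (missingMonomials K)) (growFace k K i) i).prod

theorem koszulD_cellProj (z : FaceCoalg k K ⊗[k] ExtCoalg k m) :
    koszulD k K (cellProj k K z) = cellProj k K (koszulD k K z) :=
  koszulOp_comp_koszulProj_list (contrAvoid_comm k K) (growFace k K) _ z

theorem exists_koszulD_eq_sub_cellProj {z : FaceCoalg k K ⊗[k] ExtCoalg k m}
    (hz : koszulD k K z = 0) : ∃ w, koszulD k K w = z - cellProj k K z :=
  koszulProj_list_cycle (contrAvoid_comm k K) (growFace k K) _ hz

/-- The surviving tensors x^a ⊗ y_J are those with a square-free and of support disjoint from J,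
that is, those that come from cells. -/
theorem cellProj_koszulBasis (p : FaceExp K × Finset (Fin m)) :
    cellProj k K (koszulBasis k K p) =
      if ∀ i, if i ∈ p.2 then p.1.1 i = 0 else p.1.1 i ≤ 1 then koszulBasis k K p else 0 := by
  refine (koszulProj_list_apply _ (growFace k K) _
    (fun i => if i ∈ p.2 then p.1.1 i = 0 else p.1.1 i ≤ 1)
    fun i => koszulProj_koszulBasis k K i p).trans (if_congr ?_ rfl rfl)
  simp

variable {K}

/-- A minimal non-face inside I does it. Consequently a square-free monomial of k⟨K⟩ is x_I for a
face I. -/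
theorem exists_isMissingFace_subset {I : Finset (Fin m)} (h : ¬ IsFace K I) :
    ∃ J ⊆ I, IsMissingFace K J := by
  induction I using Finset.strongInduction with
  | H I ih =>
    by_cases hI : ∀ I', I' ⊂ I → IsFace K I'
    · exact ⟨I, subset_rfl, h, hI⟩
    · push Not at hI
      obtain ⟨I', h1, h2⟩ := hI
      obtain ⟨J, h3, h4⟩ := ih I' h1 h2
      exact ⟨J, h3.trans h1.subset, h4⟩

/-- The index of `x_I ⊗ y_J` in the basis of the Koszul complex. -/
def cellIndex {q : ℕ} (c : Cell K q) : FaceExp K × Finset (Fin m) :=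
  (⟨sqfree c.1.2, by
    rintro _ ⟨J, hJ, rfl⟩ hle
    exact hJ.1 (((cellSet_subset_iff K c.2.1).1 c.2.2.1).mono (sqfree_le_iff.1 hle))⟩, c.1.1)

theorem koszulBasis_cellIndex {q : ℕ} (c : Cell K q) :
    koszulBasis k K (cellIndex c) = koszulMono k K c := by
  rw [koszulBasis_apply, koszulMono]
  congr 1
  exact Subtype.ext (coe_avoidBasis k _ _)

theorem sqfree_apply (I : Finset (Fin m)) (i : Fin m) : sqfree I i = if i ∈ I then 1 else 0 := by
  rw [sqfree, Finsupp.indicator_apply]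
  split_ifs <;> rfl

theorem cellIndex_injective (q : ℕ) : Function.Injective (cellIndex : Cell K q → _) := by
  intro c c' h
  have h1 : sqfree c.1.2 = sqfree c'.1.2 := congrArg (fun p => p.1.1) h
  have h2 : c.1.1 = c'.1.1 := congrArg Prod.snd h
  refine Subtype.ext (Prod.ext h2 ?_)
  exact (sqfree_le_iff.1 h1.le).antisymm (sqfree_le_iff.1 h1.ge)

theorem degree_sqfree (I : Finset (Fin m)) : (sqfree I).degree = #I := by
  rw [Finsupp.degree_eq_sum]
  simp [sqfree_apply]

theorem two_mul_degree_cellIndex {q : ℕ} (c : Cell K q) :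
    2 * (cellIndex c).1.1.degree + #(cellIndex c).2 = q := by
  change 2 * (sqfree c.1.2).degree + #c.1.1 = q
  rw [degree_sqfree, add_comm]
  exact c.2.2.2

theorem koszulMono_mem {q : ℕ} (c : Cell K q) : koszulMono k K c ∈ koszulDeg k K q := by
  rw [koszulDeg_eq_span, ← koszulBasis_cellIndex]
  exact Submodule.subset_span ⟨_, two_mul_degree_cellIndex c, rfl⟩

theorem cellProj_koszulMono {q : ℕ} (c : Cell K q) :
    cellProj k K (koszulMono k K c) = koszulMono k K c := by
  rw [← koszulBasis_cellIndex, cellProj_koszulBasis, if_pos]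
  intro i
  change if i ∈ c.1.1 then sqfree c.1.2 i = 0 else sqfree c.1.2 i ≤ 1
  rw [sqfree_apply]
  split_ifs with h1 h2
  · exact absurd h2 (Finset.disjoint_left.1 c.2.1 h1)
  all_goals simp

theorem exists_cellIndex_eq {p : FaceExp K × Finset (Fin m)}
    (hp : ∀ i, if i ∈ p.2 then p.1.1 i = 0 else p.1.1 i ≤ 1) {q : ℕ}
    (hq : 2 * p.1.1.degree + #p.2 = q) : ∃ c : Cell K q, cellIndex c = p := by
  obtain ⟨⟨a, ha⟩, J⟩ := p
  simp only at hp hq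
  obtain ⟨I, rfl⟩ : ∃ I, sqfree I = a := by
    refine ⟨a.support, Finsupp.ext fun i => ?_⟩
    have := hp i
    rw [sqfree_apply]
    simp only [Finsupp.mem_support_iff]
    split_ifs at this ⊢ <;> omega
  have hd : Disjoint J I := Finset.disjoint_left.2 fun i hJ hI => by
    have := hp i
    rw [if_pos hJ, sqfree_apply, if_pos hI] at this
    omega
  have hI : IsFace K I := by
    by_contra h
    obtain ⟨I', h1, h2⟩ := exists_isMissingFace_subset h
    exact ha _ ⟨I', h2, rfl⟩ (sqfree_le_iff.2 h1)
  rw [degree_sqfree] at hq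
  exact ⟨⟨(J, I), hd, (cellSet_subset_iff K hd).2 hI, by simp only; omega⟩, rfl⟩

variable (K)

/-- The inclusion of the cellular chains into the Koszul complex. -/
def cellMap (q : ℕ) : (Cell K q →₀ k) →ₗ[k] FaceCoalg k K ⊗[k] ExtCoalg k m :=
  Finsupp.linearCombination k (koszulMono k K)

theorem cellMap_single {q : ℕ} (c : Cell K q) :
    cellMap k K q (Finsupp.single c 1) = koszulMono k K c := by
  rw [cellMap, Finsupp.linearCombination_single, one_smul]

theorem cellMap_injective (q : ℕ) : Function.Injective (cellMap k K q) := by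
  have h := (koszulBasis k K).linearIndependent.comp _ (cellIndex_injective (K := K) q)
  rwa [funext (g := koszulMono k K) (f := koszulBasis k K ∘ cellIndex)
    (koszulBasis_cellIndex k)] at h

theorem cellMap_mem {q : ℕ} (x : Cell K q →₀ k) : cellMap k K q x ∈ koszulDeg k K q := by
  rw [cellMap, Finsupp.linearCombination_apply]
  exact Submodule.sum_mem _ fun c _ => Submodule.smul_mem _ _ (koszulMono_mem k c)

theorem cellProj_cellMap {q : ℕ} (x : Cell K q →₀ k) :
    cellProj k K (cellMap k K q x) = cellMap k K q x := by
  simp only [cellMap, Finsupp.linearCombination_apply, Finsupp.sum, map_sum, map_smul,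
    cellProj_koszulMono]

theorem exists_cellMap_eq_cellProj {q : ℕ} {z : FaceCoalg k K ⊗[k] ExtCoalg k m}
    (hz : z ∈ koszulDeg k K q) : ∃ x, cellMap k K q x = cellProj k K z := by
  suffices h : koszulDeg k K q ≤ (LinearMap.range (cellMap k K q)).comap (cellProj k K) from h hz
  rw [koszulDeg_eq_span, Submodule.span_le]
  rintro _ ⟨p, hp, rfl⟩
  rw [SetLike.mem_coe, Submodule.mem_comap, cellProj_koszulBasis]
  split_ifs with h
  · obtain ⟨c, rfl⟩ := exists_cellIndex_eq h hp
    exact ⟨Finsupp.single c 1, (cellMap_single k K c).trans (koszulBasis_cellIndex k c).symm⟩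
  · exact Submodule.zero_mem _

/-- The map `κ(J,I) ↦ x_I ⊗ y_J` for all pairs `(J,I)`, with values in
`k⟨x_1, …, x_m⟩ ⊗ Λ⟨y_1, …, y_m⟩`. -/
def pairMap : (Finset (Fin m) × Finset (Fin m) →₀ k) →ₗ[k] SymCoalg k m ⊗[k] ExtCoalg k m :=
  Finsupp.linearCombination k fun p => mono k m (sqfree p.2) ⊗ₜ yMono k p.1

/-- ∂/∂x_i annihilates x_I unless i ∈ I, and sorting y_i into y_J produces the sign `cellSign`. In
k⟨m⟩ ⊗ Λ the comparison involves no condition on faces. -/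
theorem koszulOp_contr_pairMap {p : Finset (Fin m) × Finset (Fin m)} (hp : Disjoint p.1 p.2) :
    koszulOp (contr k) (pairMap k (Finsupp.single p 1)) =
      pairMap k (totalBoundary k m (Finsupp.single p 1)) := by
  simp only [pairMap, totalBoundary, Finsupp.linearCombination_single, one_smul, map_sum]
  rw [koszulOp_tmul, ← Finset.sum_subset (Finset.subset_univ p.2)]
  · refine Finset.sum_congr rfl fun i hi => ?_
    have h1 : contr k i (mono k m (sqfree p.2)) = mono k m (sqfree (p.2.erase i)) := by
      rw [contr_mono, sqfree_apply, if_pos hi, if_neg one_ne_zero]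
      congr 1
      ext l
      rw [Finsupp.tsub_apply, sqfree_apply, sqfree_apply, Finsupp.single_apply]
      by_cases hl : i = l
      · subst hl; simp [hi]
      · simp [hl, Ne.symm hl]
    rw [h1, yGen_mul_yMono k (Finset.disjoint_right.1 hp hi), TensorProduct.tmul_smul]
    simp [cellSign, flipCell]
  · intro i _ hi
    rw [contr_mono, sqfree_apply, if_neg hi, if_pos rfl, TensorProduct.zero_tmul]

theorem rTensor_cellMap {q : ℕ} (x : Cell K q →₀ k) :
    (avoid k (missingMonomials K)).subtype.rTensor (ExtCoalg k m) (cellMap k K q x) =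
      pairMap k (cellIncl k K q x) := by
  refine LinearMap.congr_fun
    (f := (avoid k (missingMonomials K)).subtype.rTensor (ExtCoalg k m) ∘ₗ cellMap k K q)
    (g := pairMap k ∘ₗ cellIncl k K q) (Finsupp.lhom_ext' fun c => LinearMap.ext_ring ?_) x
  simp only [LinearMap.comp_apply, Finsupp.lsingle_apply, cellIncl, Finsupp.lmapDomain_apply,
    Finsupp.mapDomain_single, pairMap, Finsupp.linearCombination_single, one_smul]
  rw [cellMap_single]
  rfl

theorem koszulD_cellMap {q : ℕ} (x : Cell K (q + 1) →₀ k) :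
    koszulD k K (cellMap k K (q + 1) x) = cellMap k K q (cellBoundary k K q x) := by
  -- Freeness of Λ keeps k⟨K⟩ ⊗ Λ → k⟨m⟩ ⊗ Λ injective, so the identity may be checked in the larger
  -- module, one cell at a time.
  have hinj : Function.Injective
      ((avoid k (missingMonomials K)).subtype.rTensor (ExtCoalg k m)) := fun z w h => by
    refine kCoord.injective (Finsupp.ext fun J => Subtype.ext ?_)
    have := congrArg (fun z => kCoord z J) h
    simp only [kCoord_rTensor] at this
    exact this
  refine LinearMap.congr_fun (f := koszulD k K ∘ₗ cellMap k K (q + 1))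
    (g := cellMap k K q ∘ₗ cellBoundary k K q)
    (Finsupp.lhom_ext' fun c => LinearMap.ext_ring (hinj ?_)) x
  simp only [LinearMap.comp_apply, Finsupp.lsingle_apply]
  rw [rTensor_cellMap, ← LinearMap.comp_apply (cellIncl k K q), cellIncl_boundary,
    LinearMap.comp_apply]
  refine (koszulOp_rTensor (t := contrAvoid k (missingMonomials K)) (t' := contr k)
    (fun _ _ => rfl) (cellMap k K (q + 1) (Finsupp.single c 1))).trans ?_
  rw [rTensor_cellMap]
  simp only [cellIncl, Finsupp.lmapDomain_apply, Finsupp.mapDomain_single]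
  exact koszulOp_contr_pairMap k c.2.1

theorem cellularComplex_d (q : ℕ) : ((cellularComplex k K).d (q + 1) q).hom =
    cellBoundary k K q :=
  congrArg ModuleCat.Hom.hom (ChainComplex.of_d (fun q => ModuleCat.of k (Cell K q →₀ k))
    (fun q => ModuleCat.ofHom (cellBoundary k K q)) q)

/-- The morphism `κ(J,I) ↦ x_I ⊗ y_J` of chain complexes. -/
def cellularToKoszul : cellularComplex k K ⟶ koszulComplex k K where
  f q := ModuleCat.ofHom ((cellMap k K q).codRestrict (koszulDeg k K q) (cellMap_mem k K))
  comm' := by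
    rintro _ q rfl
    refine ModuleCat.hom_ext (LinearMap.ext fun x => koszulIncl_injective k K q ?_)
    refine (koszulComplex_d k K q _).trans ((koszulD_cellMap k K x).trans ?_)
    exact congrArg (cellMap k K q) (LinearMap.congr_fun (cellularComplex_d k K q).symm x)

theorem quasiIso_cellularToKoszul : QuasiIso (cellularToKoszul k K) := by
  refine quasiIso_of_elements _ (fun q (x : Cell K q →₀ k) hx => ?_)
    fun q (z : koszulDeg k K q) hz => ?_
  -- With P = `cellProj`: if the cellular chain x equals ∂w, then x = Px = ∂(Pw), and Pw is a
  -- cellular chain.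
  · obtain ⟨w, hw⟩ := hx
    change koszulDeg k K (q + 1) at w
    have hw' : koszulD k K w.1 = cellMap k K q x :=
      (koszulComplex_d k K q w).symm.trans (congrArg (koszulIncl k K q) hw)
    obtain ⟨u, hu⟩ := exists_cellMap_eq_cellProj k K w.2
    refine ⟨u, cellMap_injective k K q ?_⟩
    rw [cellularComplex_d]
    refine (koszulD_cellMap k K u).symm.trans ?_
    rw [hu, koszulD_cellProj, hw', cellProj_cellMap]
  · have hz' : koszulD k K z.1 = 0 := by
      obtain _ | q := q
      · exact koszulD_koszulDeg_zero k K z.2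
      · exact (koszulComplex_d k K q z).symm.trans
          ((congrArg (koszulIncl k K q) (hz q rfl)).trans (map_zero _))
    obtain ⟨x, hx⟩ := exists_cellMap_eq_cellProj k K z.2
    -- A cycle z differs from the cellular cycle Pz by some ∂w. The homotopy argument does not
    -- control the degree of w, so its component of degree q + 1 is used.
    obtain ⟨w, hw⟩ := exists_koszulD_eq_sub_cellProj k K hz'
    have h := isProjFamily_totalProj k K
    refine ⟨x, ?_, ⟨totalProj k K (q + 1) w, h.mem _ _⟩, koszulIncl_injective k K q ?_⟩
    · rintro l rfl
      refine cellMap_injective k K l ?_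
      rw [cellularComplex_d]
      refine (koszulD_cellMap k K x).symm.trans ?_
      rw [hx, koszulD_cellProj, hz', map_zero]
      exact (map_zero _).symm
    · refine (koszulComplex_d k K q _).trans ?_
      rw [← totalProj_koszulD, hw, ← hx]
      exact h.fix q _ (Submodule.sub_mem _ z.2 (cellMap_mem k K x))

theorem nonempty_cellularHomology_equiv (q : ℕ) :
    Nonempty (cellularHomology k K q ≃ₗ[k] Subquot
      (LinearMap.ker (koszulD k K) ⊓ koszulDeg k K q)
      (LinearMap.range (koszulD k K) ⊓ koszulDeg k K q)) := by
  obtain ⟨e⟩ := nonempty_koszulComplex_homology_equiv k K q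
  have := quasiIso_cellularToKoszul k K
  exact ⟨(isoOfQuasiIsoAt (cellularToKoszul k K) q).toLinearEquiv.trans e⟩

end CellularPart

end MomentAngle
end

/-! ### Cellular chains, the Koszul complex and Cotor combined -/

theorem theorem6p4 (k : Type u) [CommRing k] (m : ℕ) (K : AbstractSimplicialComplex (Fin m)) :
    -- the inclusion of chain complexes, which is a quasi-isomorphism
    (∃ φ : cellularComplex k K ⟶ koszulComplex k K,
      (∀ (q : ℕ) (c : Cell K q),
        koszulIncl k K q ((φ.f q).hom (cellChain k K c)) = koszulMono k K c) ∧
      (∀ q : ℕ, Function.Injective (φ.f q).hom) ∧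
      QuasiIso φ) ∧
    -- the homology of the Koszul complex is Cotor, and so is the homology of `Z_K`
    (∀ R : ComoduleResolution (faceComodule k K), R.IsInjective →
      (∀ n : ℕ, Nonempty
        ((koszulCoComplex k K).homology n ≃ₗ[k] R.cotor (trivialComodule k m) n)) ∧
      Nonempty ((⨁ q : ℕ, cellularHomology k K q) ≃ₗ[k]
        (⨁ n : ℕ, R.cotor (trivialComodule k m) n))) ∧
    -- the same degree by degree, with the intrinsic grading of Cotor
    (∀ R : GradedComoduleResolution (symGrading k m) (faceComodule k K) (faceGrading k K),
      R.IsInjective → ∀ q : ℕ, Nonempty (cellularHomology k K q ≃ₗ[k]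
        (⨁ n : ℕ, R.cotorDeg (trivialComodule k m) n (q + n)))) := by
  refine ⟨⟨cellularToKoszul k K, fun q c => cellMap_single k K c,
    fun q x y h => cellMap_injective k K q (congrArg (koszulIncl k K q) h),
    quasiIso_cellularToKoszul k K⟩, fun R hR => ⟨fun n => ?_, ?_⟩, fun R hR q => ?_⟩
  · obtain ⟨e⟩ := nonempty_koszulCoComplex_homology_equiv k K n
    obtain ⟨e'⟩ := R.nonempty_subquot_equiv_cotor k K hR n
    exact ⟨e.trans e'⟩
  · obtain ⟨e⟩ := nonempty_directSum_subquot_equiv k K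
    exact ⟨(DFinsupp.mapRange.linearEquiv fun q =>
      (nonempty_cellularHomology_equiv k K q).some).trans (e.trans
        (DFinsupp.mapRange.linearEquiv fun n => (R.nonempty_subquot_equiv_cotor k K hR n).some))⟩
  · obtain ⟨e⟩ := nonempty_cellularHomology_equiv k K q
    obtain ⟨e'⟩ := R.nonempty_subquot_equiv_cotorDeg k K hR q
    exact ⟨e.trans e'⟩
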